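/- Let $V:\mathbb R^d\to\mathbb R$ be continuously differentiable with $\int e^{-V}<\infty$, and let $\pi$ be the probability measure with Lebesgue density proportional to $e^{-V}$. Let $H^1(\pi)$ be the weighted Sobolev space, i.e. the closure of $C_c^\infty(\mathbb R^d)$ under the norm $(\|f\|_{L^2(\pi)}^2+\|\nabla f\|_{L^2(\pi)}^2)^{1/2}$. Let $\mathscr L=-\Delta+\langle\nabla V,\nabla\cdot\rangle$ be the Langevin generator, with domain the set of $f\in H^1(\pi)$ for which there is $g=:\mathscr Lf\in L^2(\pi)$ with $\mathbb E_\pi[f\,(-\Delta\psi+\langle\nabla V,\nabla\psi\rangle)]=\mathbb E_\pi[g\psi]$ for all $\psi\in C_c^\infty(\mathbb R^d)$. Assume that $\mathscr L$ has a discrete spectrum: there are eigenvalues $0=\lambda_0\le\lambda_1\le\lambda_2\le\cdots$ of $\mathscr L$ with eigenfunctions $\phi_0,\phi_1,\phi_2,\dots$ forming an orthonormal basis of $L^2(\pi)$. Assume also that $\pi$ satisfies a Poincaré inequality with some finite constant $C_{\mathsf P}$: $\operatorname{var}_\pi f\le C_{\mathsf P}\,\mathbb E_\pi[\|\nabla f\|^2]$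 for all locally Lipschitz $f\in L^2(\pi)$. Let $\mathcal K_\pi$ be the integral operator on $L^2(\pi)$ with the spectral kernel $K(x,y)=\sum_{i\ge1}\phi_i(x)\phi_i(y)/\lambda_i$, i.e. $\mathcal K_\pi f=\sum_{i\ge1}\lambda_i^{-1}\langle\phi_i,f\rangle_{L^2(\pi)}\,\phi_i$ with convergence in $L^2(\pi)$. Then $\lambda_1>0$, and $\mathcal K_\pi=\mathscr L^{-1}$ on mean-zero functions: for $f,g\in L^2(\pi)$ with $\mathbb E_\pi f=\mathbb E_\pi g=0$, one has $\mathcal K_\pi g=f$ if and only if $f$ is in the domain of $\mathscr L$ and $\mathscr Lf=g$. Moreover, let $(\mu_t)_{t\ge0}$ be any weak solution of the LAWGD equation $$\partial_t\mu_t=\operatorname{div}\Bigl(\mu_t\nabla\mathcal K_\pi\frac{d\mu_t}{d\pi}\Bigr),$$ that is: every $\mu_t$ is a probability measure with a Lebesgue density; $d\mu_t/d\pi\in L^2(\pi)$ for almost every $t>0$, with $\int_0^T\|d\mu_t/d\pi\|_{L^2(\pi)}^2\,dt<\infty$ for every $T>0$; and for every $\psi\in C_c^\infty(\mathbb R^d)$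 and $t\ge0$, $$\int\psi\,d\mu_t=\int\psi\,d\mu_0-\int_0^t\int\Bigl\langle\nabla\psi,\nabla\mathcal K_\pi\frac{d\mu_s}{d\pi}\Bigr\rangle\,d\mu_s\,ds,$$ the integrand being integrable in time. Then $$D_{\mathrm{KL}}(\mu_t\,\|\,\pi)\le\bigl(D_{\mathrm{KL}}(\mu_0\,\|\,\pi)\wedge2\bigr)\,e^{-t}\qquad\text{for all }t\ge1.$$ In particular the rate does not depend on the Poincaré constant. -/

import Mathlib

open MeasureTheory ProbabilityTheory InformationTheory Set
open scoped ENNReal NNReal RealInnerProductSpace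

noncomputable section

/-- The target probability measure on `ℝ^d`, with Lebesgue density `exp (-V) / ∫ exp (-V)`. -/
def target {d : ℕ} (V : EuclideanSpace ℝ (Fin d) → ℝ) : Measure (EuclideanSpace ℝ (Fin d)) :=
  (volume : Measure (EuclideanSpace ℝ (Fin d))).tilted (fun x => -V x)

/-- Poincaré inequality with constant `C`: `Var_π f ≤ C * E_π ‖∇f‖²` for every locally Lipschitz
`f ∈ L²(π)`; both sides are `[0, ∞]`-valued, and `∇f` exists almost everywhere by Rademacher. -/
def PoincareInequality {d : ℕ} (π : Measure (EuclideanSpace ℝ (Fin d))) (C : ℝ≥0) : Prop :=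
  ∀ f : EuclideanSpace ℝ (Fin d) → ℝ, LocallyLipschitz f → MemLp f 2 π →
    evariance f π ≤ C * ∫⁻ x, ‖gradient f x‖ₑ ^ 2 ∂π

/-- Smooth compactly supported test functions on `ℝ^d`. -/
def IsTestFunction {d : ℕ} (ψ : EuclideanSpace ℝ (Fin d) → ℝ) : Prop :=
  ContDiff ℝ (⊤ : ℕ∞) ψ ∧ HasCompactSupport ψ

/-- The graph of the gradient on the weighted Sobolev space `H¹(π)`: the closure in
`L²(π) × L²(π; ℝ^d)` of the pairs `(ψ, ∇ψ)`, `ψ` a test function. Thus `(f, G) ∈ sobolevGraph π`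
says that `f ∈ H¹(π)` with gradient `∇f = G`. -/
def sobolevGraph {d : ℕ} (π : Measure (EuclideanSpace ℝ (Fin d))) :
    Set (Lp ℝ 2 π × Lp (EuclideanSpace ℝ (Fin d)) 2 π) :=
  closure {p | ∃ ψ : EuclideanSpace ℝ (Fin d) → ℝ,
    IsTestFunction ψ ∧ p.1 =ᵐ[π] ψ ∧ p.2 =ᵐ[π] gradient ψ}

/-- The differential expression `-Δψ + ⟨∇V, ∇ψ⟩`. -/
def langevinExpr {d : ℕ} (V ψ : EuclideanSpace ℝ (Fin d) → ℝ) (x : EuclideanSpace ℝ (Fin d)) : ℝ :=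
  -(Laplacian.laplacian ψ x) + ⟪gradient V x, gradient ψ x⟫

/-- The (negative) Langevin generator `L = -Δ + ⟨∇V, ∇·⟩` as an unbounded operator on `L²(π)`:
`IsLangevin V f g` says that `f` is in the domain of `L` and `L f = g`. The domain consists of the
`f ∈ H¹(π)` for which `-Δf + ⟨∇V, ∇f⟩`, computed by duality against test functions (the expression
is symmetric with respect to `π`), belongs to `L²(π)`. -/
def IsLangevin {d : ℕ} (V : EuclideanSpace ℝ (Fin d) → ℝ) (f g : Lp ℝ 2 (target V)) : Prop :=
  (∃ G, (f, G) ∈ sobolevGraph (target V)) ∧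
    ∀ ψ : EuclideanSpace ℝ (Fin d) → ℝ, IsTestFunction ψ →
      ∫ x, f x * langevinExpr V ψ x ∂(target V) = ∫ x, g x * ψ x ∂(target V)

/-- `L` has discrete spectrum, with eigenvalues `0 = lam 0 ≤ lam 1 ≤ lam 2 ≤ ⋯` and eigenfunctions
`φ 0, φ 1, …` forming an orthonormal basis. -/
structure HasDiscreteSpectrum {d : ℕ} (V : EuclideanSpace ℝ (Fin d) → ℝ)
    (lam : ℕ → ℝ) (φ : HilbertBasis ℕ ℝ (Lp ℝ 2 (target V))) : Prop where
  zero : lam 0 = 0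
  mono : Monotone lam
  eigen : ∀ i, IsLangevin V (φ i) (lam i • φ i)

/-- `IsSpectralKernelImage lam φ f u` says that `u = K_π f`, where `K_π` is the integral operator
on `L²(π)` with the spectral kernel `∑_{i ≥ 1} φ_i(x) φ_i(y) / λ_i`, that is,
`u = ∑_{i ≥ 1} λ_i⁻¹ ⟨φ_i, f⟩ φ_i` with convergence in `L²(π)`. -/
def IsSpectralKernelImage {d : ℕ} {π : Measure (EuclideanSpace ℝ (Fin d))}
    (lam : ℕ → ℝ) (φ : HilbertBasis ℕ ℝ (Lp ℝ 2 π)) (f u : Lp ℝ 2 π) : Prop :=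
  HasSum (fun i : ℕ => ((lam (i + 1))⁻¹ * ⟪φ (i + 1), f⟫) • φ (i + 1)) u

/-- `(μ_t)_{t ≥ 0}` is a weak solution of the LAWGD equation
`∂_t μ_t = div (μ_t ∇ K_π (dμ_t/dπ))` with the spectral kernel. Here `ρ t` is the density
`dμ_t/dπ`, `u t = K_π (ρ t)` and `v t = ∇ (u t)`. For the equation to make sense the density is in `L²(π)` for
almost every `t`, with square-integrable norm on bounded time intervals, so that the flux `v t • μ t`
is integrable in space and time. -/
structure IsLAWGDFlow {d : ℕ} (V : EuclideanSpace ℝ (Fin d) → ℝ) (lam : ℕ → ℝ)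
    (φ : HilbertBasis ℕ ℝ (Lp ℝ 2 (target V)))
    (μ : ℝ → Measure (EuclideanSpace ℝ (Fin d))) : Prop where
  prob : ∀ t, 0 ≤ t → IsProbabilityMeasure (μ t)
  ac : ∀ t, 0 ≤ t → μ t ≪ volume
  weak : ∃ (ρ u : ℝ → Lp ℝ 2 (target V))
      (v : ℝ → Lp (EuclideanSpace ℝ (Fin d)) 2 (target V)),
    (∀ T : ℝ, (∫⁻ t in Ioc 0 T, ‖ρ t‖ₑ ^ 2) < ⊤) ∧
    (∀ᵐ t ∂(volume.restrict (Ioi (0 : ℝ))),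
      (∀ᵐ x ∂(target V), ρ t x = ((μ t).rnDeriv (target V) x).toReal) ∧
      IsSpectralKernelImage lam φ (ρ t) (u t) ∧
      (u t, v t) ∈ sobolevGraph (target V)) ∧
    ∀ ψ : EuclideanSpace ℝ (Fin d) → ℝ, IsTestFunction ψ → ∀ t : ℝ, 0 ≤ t →
      IntervalIntegrable (fun s => ∫ x, ⟪gradient ψ x, v s x⟫ ∂(μ s)) volume 0 t ∧
      (∫ x, ψ x ∂(μ t)) =
        (∫ x, ψ x ∂(μ 0)) - ∫ s in (0 : ℝ)..t, (∫ x, ⟪gradient ψ x, v s x⟫ ∂(μ s))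

end

/-! Write `ρ` for the density of the flow with respect to the target `π`, `u` for its image under
the spectral kernel and `v = ∇u`. Since `ρ` has mean one, `L u = ρ - 1`. Formally, the derivative of
the entropy along the flow is `-∫ ⟨∇ log ρ, v⟩ dμ = -∫ ⟨∇ρ, ∇u⟩ dπ = -∫ ρ L u dπ = -‖ρ - 1‖²`. The
kernel inverts the generator, so the dissipation is the chi-squared divergence itself and no
spectral gap enters the rate. By Jensen the entropy `k` satisfies `k ≤ log (1 + χ²)`, so `k' ≤ 1 -
exp k`, and `exp t * (1 - exp (-k))` is nonincreasing. Convexity of the exponential turns this into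
`k t ≤ exp (-t) * k 0`. Bounding `1 - exp (-k 0)` by `1` instead gives `k t ≤ 2 exp (-t)` as soon as
`exp (-t) ≤ 1 / 2`, which `t ≥ 1` ensures; this holds even from infinite initial entropy.

The spectral claims rest on the weak formulation `IsLangevinTriple`. The Poincaré inequality makes
every zero mode constant, whence `HasDiscreteSpectrum.pos`. The identity `‖∇f‖² = ⟨L f, f⟩` makes
the generator closed (`IsLangevinTriple.of_tendsto`), so the spectral series solves `L f = g`; the
converse is symmetry of the Dirichlet form.

The real work is to justify the entropy computation for a weak solution whose density is only in
`L²(π)` at almost every time. The method is DiPerna–Lions renormalisation. Since `L u` is in `L²`,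
difference quotients show that `v` is locally Lipschitz under translations in `L²`
(`HasWeakGradient.eLpNorm_gradient_comp_sub_sub_le`), so the commutator of transport and
mollification converges in `L¹` (`tendsto_commutator`). The mollified equation is an ordinary
differential equation at each point `x`, where the chain rule for `β` is elementary. Removing the
mollification (`IsRegularFlow.local_balance`) and then the spatial cutoff (`IsRegularFlow.balance`)
gives `∫ β(ρ_b) dπ - ∫ β(ρ_a) dπ = ∫ ∫ (ρ - 1) (β(ρ) - ρ β'(ρ)) dπ ds`. With `β` the affine
extension of `klFun` from `[e⁻ⁿ, eⁿ]`, the integrand is `-(ρ - 1) (clamp ρ - 1)`, which has a sign.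
Fatou's lemma yields the entropy inequality `IsRegularFlow.klDiv_add_lintegral_le`, and
`one_sub_exp_neg_le_of_forall_add_mul_le` extracts the decay without any regularity of the entropy
in time. -/

open Filter Topology

noncomputable section

set_option linter.unusedSectionVars false

/-! ### Gradients, Laplacians and Green's identity -/

section Gradient

variable {E : Type*} [NormedAddCommGroup E] [InnerProductSpace ℝ E] [FiniteDimensional ℝ E]

lemma continuous_gradient {f : E → ℝ} (hf : ContDiff ℝ 1 f) : Continuous (gradient f) := by
  have h := hf.continuous_fderiv one_ne_zero
  exact (InnerProductSpace.toDual ℝ E).symm.continuous.comp h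

lemma contDiff_gradient {f : E → ℝ} (hf : ContDiff ℝ (⊤ : ℕ∞) f) :
    ContDiff ℝ (⊤ : ℕ∞) (gradient f) :=
  (InnerProductSpace.toDual ℝ E).symm.toContinuousLinearEquiv.contDiff.comp
    (hf.fderiv_right (m := (⊤ : ℕ∞)) (by simp))

lemma support_gradient_subset (f : E → ℝ) : Function.support (gradient f) ⊆ tsupport f := by
  intro x hx
  by_contra h
  refine hx ?_
  have : fderiv ℝ f x = 0 := by
    by_contra h'
    exact h (support_fderiv_subset ℝ h')
  simp [gradient, this]

lemma HasCompactSupport.gradient {f : E → ℝ} (hf : HasCompactSupport f) :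
    HasCompactSupport (gradient f) :=
  hf.mono' (support_gradient_subset f)

lemma gradient_mul' {f g : E → ℝ} {x : E} (hf : DifferentiableAt ℝ f x)
    (hg : DifferentiableAt ℝ g x) :
    gradient (fun y => f y * g y) x = f x • gradient g x + g x • gradient f x := by
  have := (hf.hasFDerivAt.mul hg.hasFDerivAt).fderiv
  simp only [gradient]
  rw [show (fun y => f y * g y) = f * g from rfl, this]
  simp

lemma gradient_comp' {f : E → ℝ} {β : ℝ → ℝ} {β' : ℝ} {x : E} (hf : DifferentiableAt ℝ f x)
    (hβ : HasDerivAt β β' (f x)) :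
    gradient (fun y => β (f y)) x = β' • gradient f x := by
  have := (hβ.comp_hasFDerivAt x hf.hasFDerivAt).fderiv
  simp only [gradient]
  rw [show (fun y => β (f y)) = β ∘ f from rfl, this]
  simp

lemma gradient_add' {f g : E → ℝ} {x : E} (hf : DifferentiableAt ℝ f x)
    (hg : DifferentiableAt ℝ g x) :
    gradient (fun y => f y + g y) x = gradient f x + gradient g x := by
  have := (hf.hasFDerivAt.add hg.hasFDerivAt).fderiv
  simp only [gradient]
  rw [show (fun y => f y + g y) = f + g from rfl, this]
  simp

lemma gradient_const_mul' {f : E → ℝ} {x : E} (c : ℝ) (hf : DifferentiableAt ℝ f x) :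
    gradient (fun y => c * f y) x = c • gradient f x := by
  have := (hf.hasFDerivAt.const_mul c).fderiv
  simp only [gradient]
  rw [this]
  simp

lemma continuous_laplacian {f : E → ℝ} (hf : ContDiff ℝ 2 f) :
    Continuous (Laplacian.laplacian f) := by
  rw [InnerProductSpace.laplacian_eq_iteratedFDeriv_stdOrthonormalBasis]
  have := hf.continuous_iteratedFDeriv (m := 2) (by norm_num)
  fun_prop

lemma HasCompactSupport.laplacian {f : E → ℝ} (hf : HasCompactSupport f) :
    HasCompactSupport (Laplacian.laplacian f) := by
  refine HasCompactSupport.mono' (hf.iteratedFDeriv (𝕜 := ℝ) 2) ?_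
  rw [InnerProductSpace.laplacian_eq_iteratedFDeriv_stdOrthonormalBasis]
  intro x hx
  apply subset_tsupport
  intro h
  apply hx
  simp [h]

variable [MeasurableSpace E] [BorelSpace E]

/-- Green's identity on the whole space. -/
theorem integral_inner_gradient_eq_neg_integral_mul_laplacian {f ψ : E → ℝ}
    (hf : ContDiff ℝ 1 f) (hψ : ContDiff ℝ 2 ψ) (hc : HasCompactSupport ψ) :
    ∫ x, ⟪gradient f x, gradient ψ x⟫ = -∫ x, f x * Laplacian.laplacian ψ x := by
  set b := stdOrthonormalBasis ℝ E
  have hf' : Continuous (fderiv ℝ f) := hf.continuous_fderiv one_ne_zero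
  have hψ' : ContDiff ℝ 1 (fderiv ℝ ψ) := hψ.fderiv_right (by norm_num)
  have hψ1 : ∀ v, ContDiff ℝ 1 (fun x => fderiv ℝ ψ x v) := fun v => hψ'.clm_apply contDiff_const
  have hψ2 : ∀ v, Continuous (fun x => fderiv ℝ (fun y => fderiv ℝ ψ y v) x v) := fun v =>
    ((hψ1 v).continuous_fderiv one_ne_zero).clm_apply continuous_const
  have hcs : ∀ v, HasCompactSupport (fun x => fderiv ℝ ψ x v) := fun v =>
    hc.fderiv_apply ℝ v
  have hcs2 : ∀ v, HasCompactSupport (fun x => fderiv ℝ (fun y => fderiv ℝ ψ y v) x v) := fun v =>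
    (hcs v).fderiv_apply ℝ v
  have h1 : ∀ x, ⟪gradient f x, gradient ψ x⟫ = ∑ i, fderiv ℝ f x (b i) * fderiv ℝ ψ x (b i) := by
    intro x
    rw [← b.sum_inner_mul_inner]
    simp [inner_gradient_left]
  have h2 : ∀ x, Laplacian.laplacian ψ x =
      ∑ i, fderiv ℝ (fun y => fderiv ℝ ψ y (b i)) x (b i) := by
    intro x
    rw [InnerProductSpace.laplacian_eq_iteratedFDeriv_stdOrthonormalBasis]
    refine Finset.sum_congr rfl fun i _ => ?_
    rw [iteratedFDeriv_two_apply]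
    have := (hψ'.differentiable one_ne_zero).differentiableAt (x := x)
    rw [fderiv_clm_apply this (differentiableAt_const _)]
    simp [b]
  simp_rw [h1, h2, Finset.mul_sum]
  have i1 : ∀ i, Integrable (fun x => fderiv ℝ f x (b i) * fderiv ℝ ψ x (b i)) := fun i =>
    ((hf'.clm_apply continuous_const).mul (hψ1 (b i)).continuous).integrable_of_hasCompactSupport
      (hcs (b i)).mul_left
  have i2 : ∀ i, Integrable (fun x => f x * fderiv ℝ (fun y => fderiv ℝ ψ y (b i)) x (b i)) :=
    fun i => (hf.continuous.mul (hψ2 (b i))).integrable_of_hasCompactSupport (hcs2 (b i)).mul_left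
  rw [integral_finsetSum _ fun i _ => i1 i, integral_finsetSum _ fun i _ => i2 i,
    ← Finset.sum_neg_distrib]
  refine Finset.sum_congr rfl fun i _ => ?_
  rw [integral_mul_fderiv_eq_neg_fderiv_mul_of_integrable (i1 i) (i2 i), neg_neg]
  · exact (hf.continuous.mul (hψ1 (b i)).continuous).integrable_of_hasCompactSupport
      (hcs (b i)).mul_left
  · exact fun x _ => hf.differentiable one_ne_zero x
  · exact fun x _ => (hψ1 (b i)).differentiable one_ne_zero x

end Gradient

lemma IsTestFunction.contDiff_one {d : ℕ} {ψ : EuclideanSpace ℝ (Fin d) → ℝ}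
    (hψ : IsTestFunction ψ) : ContDiff ℝ 1 ψ :=
  contDiff_infty.1 hψ.1 1

lemma IsTestFunction.contDiff_two {d : ℕ} {ψ : EuclideanSpace ℝ (Fin d) → ℝ}
    (hψ : IsTestFunction ψ) : ContDiff ℝ 2 ψ :=
  contDiff_infty.1 hψ.1 2

/-! ### The target measure: Lebesgue density and Dirichlet form -/

section Target

variable {d : ℕ} {V : EuclideanSpace ℝ (Fin d) → ℝ}

/-- The Lebesgue density of `target V`. -/
def targetDensity (V : EuclideanSpace ℝ (Fin d) → ℝ) (x : EuclideanSpace ℝ (Fin d)) : ℝ :=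
  Real.exp (-V x) / ∫ y, Real.exp (-V y)

lemma targetDensity_pos (hint : Integrable (fun x => Real.exp (-V x)) volume)
    (x : EuclideanSpace ℝ (Fin d)) : 0 < targetDensity V x :=
  div_pos (Real.exp_pos _) (integral_exp_pos hint)

lemma contDiff_targetDensity (hV : ContDiff ℝ 1 V) : ContDiff ℝ 1 (targetDensity V) :=
  (Real.contDiff_exp.comp hV.neg).div_const _

lemma gradient_targetDensity (hV : ContDiff ℝ 1 V) (x : EuclideanSpace ℝ (Fin d)) :
    gradient (targetDensity V) x = -(targetDensity V x • gradient V x) := by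
  have h : HasDerivAt (fun s : ℝ => Real.exp (-s) / ∫ y, Real.exp (-V y))
      (Real.exp (-V x) * (-1) / ∫ y, Real.exp (-V y)) (V x) :=
    ((hasDerivAt_neg (V x)).exp).div_const _
  have := gradient_comp' (hV.differentiable one_ne_zero x) h
  rw [show gradient (targetDensity V) x = _ from this, ← neg_smul]
  congr 1
  simp only [targetDensity]
  ring

lemma integral_target {F : Type*} [NormedAddCommGroup F] [NormedSpace ℝ F]
    (f : EuclideanSpace ℝ (Fin d) → F) :
    ∫ x, f x ∂(target V) = ∫ x, targetDensity V x • f x :=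
  integral_tilted _ _

lemma lintegral_target (f : EuclideanSpace ℝ (Fin d) → ℝ≥0∞) :
    ∫⁻ x, f x ∂(target V) = ∫⁻ x, ENNReal.ofReal (targetDensity V x) * f x :=
  lintegral_tilted _ _

lemma integrable_target_iff {F : Type*} [NormedAddCommGroup F] [NormedSpace ℝ F]
    (hint : Integrable (fun x => Real.exp (-V x)) volume) (f : EuclideanSpace ℝ (Fin d) → F) :
    Integrable f (target V) ↔ Integrable (fun x => targetDensity V x • f x) := by
  rw [target, integrable_tilted_iff hint]
  have hZ : (∫ y, Real.exp (-V y)) ≠ 0 := (integral_exp_pos hint).ne'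
  have : (fun x => targetDensity V x • f x) =
      (∫ y, Real.exp (-V y))⁻¹ • fun x => Real.exp (-V x) • f x := by
    ext x
    simp [targetDensity, smul_smul, div_eq_inv_mul]
  rw [this, integrable_smul_iff (inv_ne_zero hZ)]

lemma isProbabilityMeasure_target (hint : Integrable (fun x => Real.exp (-V x)) volume) :
    IsProbabilityMeasure (target V) :=
  isProbabilityMeasure_tilted hint

lemma absolutelyContinuous_target (hint : Integrable (fun x => Real.exp (-V x)) volume) :
    (volume : Measure (EuclideanSpace ℝ (Fin d))) ≪ target V :=
  absolutelyContinuous_tilted hint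

/-- The Dirichlet form of the Langevin generator on smooth functions. -/
theorem integral_mul_langevinExpr (hV : ContDiff ℝ 1 V)
    {f ψ : EuclideanSpace ℝ (Fin d) → ℝ} (hf : ContDiff ℝ 1 f) (hψ : IsTestFunction ψ) :
    ∫ x, f x * langevinExpr V ψ x ∂(target V) = ∫ x, ⟪gradient f x, gradient ψ x⟫ ∂(target V) := by
  have hψ2 := hψ.contDiff_two
  have hψ1 := hψ.contDiff_one
  have hp := contDiff_targetDensity hV
  -- Green's identity for `f` times the density `p`: the drift arises from `∇p = -p ∇V`, so one
  -- derivative of `V` suffices.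
  have key := integral_inner_gradient_eq_neg_integral_mul_laplacian (hf.mul hp) hψ2 hψ.2
  have hg : ∀ x, ⟪gradient (fun y => f y * targetDensity V y) x, gradient ψ x⟫ =
      targetDensity V x * ⟪gradient f x, gradient ψ x⟫
        - targetDensity V x * (f x * ⟪gradient V x, gradient ψ x⟫) := by
    intro x
    rw [gradient_mul' (hf.differentiable one_ne_zero x) (hp.differentiable one_ne_zero x),
      gradient_targetDensity hV]
    simp only [smul_neg, inner_add_left, inner_neg_left, real_inner_smul_left]
    ring
  have cV := continuous_gradient hV
  have cf := continuous_gradient hf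
  have cψ := continuous_gradient hψ1
  have cΔ := continuous_laplacian hψ2
  have i1 : Integrable fun x => targetDensity V x * ⟪gradient f x, gradient ψ x⟫ := by
    refine (hp.continuous.mul (cf.inner cψ)).integrable_of_hasCompactSupport ?_
    refine hψ.2.gradient.mono fun x hx hx' => hx ?_
    simp only [Pi.mul_apply, hx', inner_zero_right, mul_zero]
  have i2 : Integrable fun x => targetDensity V x * (f x * ⟪gradient V x, gradient ψ x⟫) := by
    refine (hp.continuous.mul (hf.continuous.mul (cV.inner cψ))).integrable_of_hasCompactSupport ?_
    refine hψ.2.gradient.mono fun x hx hx' => hx ?_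
    simp only [Pi.mul_apply, hx', inner_zero_right, mul_zero]
  have i3 : Integrable fun x => f x * targetDensity V x * Laplacian.laplacian ψ x :=
    ((hf.continuous.mul hp.continuous).mul cΔ).integrable_of_hasCompactSupport
      hψ.2.laplacian.mul_left
  simp_rw [hg] at key
  rw [integral_sub i1 i2] at key
  simp only [integral_target, smul_eq_mul, langevinExpr]
  have : ∀ x, targetDensity V x * (f x * (-Laplacian.laplacian ψ x + ⟪gradient V x, gradient ψ x⟫))
      = targetDensity V x * (f x * ⟪gradient V x, gradient ψ x⟫)
        - f x * targetDensity V x * Laplacian.laplacian ψ x := fun x => by ring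
  simp_rw [this]
  rw [integral_sub i2 i3]
  linarith

end Target

/-! ### Mollification and its convergence in `L^p` -/

section Mollifier

variable {E : Type*} [NormedAddCommGroup E] [InnerProductSpace ℝ E] [FiniteDimensional ℝ E]
  [MeasurableSpace E] [BorelSpace E]
  {F : Type*} [NormedAddCommGroup F] [NormedSpace ℝ F]

/-- A smooth probability density supported in the unit ball. -/
def mollifierBase (E : Type*) [NormedAddCommGroup E] [InnerProductSpace ℝ E]
    [FiniteDimensional ℝ E] [MeasurableSpace E] [BorelSpace E] : E → ℝ :=
  (⟨1 / 2, 1, by norm_num, by norm_num⟩ : ContDiffBump (0 : E)).normed volume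

/-- Rescalings of `mollifierBase`, supported in the ball of radius `1 / (n + 1)`. -/
def mollifier (n : ℕ) (z : E) : ℝ :=
  ((n : ℝ) + 1) ^ Module.finrank ℝ E * mollifierBase E (((n : ℝ) + 1) • z)

lemma contDiff_mollifierBase : ContDiff ℝ (⊤ : ℕ∞) (mollifierBase E) :=
  ContDiffBump.contDiff_normed _

lemma contDiff_mollifier (n : ℕ) : ContDiff ℝ (⊤ : ℕ∞) (mollifier n : E → ℝ) :=
  contDiff_const.mul (contDiff_mollifierBase.comp (contDiff_const.smul contDiff_id))

lemma mollifier_nonneg (n : ℕ) (z : E) : 0 ≤ mollifier n z :=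
  mul_nonneg (by positivity) (ContDiffBump.nonneg_normed _ _)

lemma support_mollifier_subset (n : ℕ) :
    Function.support (mollifier n : E → ℝ) ⊆ Metric.closedBall 0 (1 / ((n : ℝ) + 1)) := by
  intro z hz
  have h : mollifierBase E (((n : ℝ) + 1) • z) ≠ 0 := right_ne_zero_of_mul hz
  have h' : ((n : ℝ) + 1) • z ∈ Metric.ball (0 : E) 1 := by
    rw [← ContDiffBump.support_normed_eq (⟨1 / 2, 1, by norm_num, by norm_num⟩ :
      ContDiffBump (0 : E)) (μ := volume)]
    exact h
  have hn : (0 : ℝ) < (n : ℝ) + 1 := by positivity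
  rw [mem_ball_zero_iff, norm_smul, Real.norm_of_nonneg hn.le] at h'
  rw [mem_closedBall_zero_iff, le_div_iff₀ hn]
  linarith

lemma tsupport_mollifier_subset (n : ℕ) :
    tsupport (mollifier n : E → ℝ) ⊆ Metric.closedBall 0 (1 / ((n : ℝ) + 1)) :=
  closure_minimal (support_mollifier_subset n) Metric.isClosed_closedBall

lemma hasCompactSupport_mollifier (n : ℕ) : HasCompactSupport (mollifier n : E → ℝ) :=
  (isCompact_closedBall _ _).of_isClosed_subset isClosed_closure (tsupport_mollifier_subset n)

lemma mollifier_radius_le_one (n : ℕ) : 1 / ((n : ℝ) + 1) ≤ 1 := by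
  rw [div_le_one (by positivity)]
  have : (0 : ℝ) ≤ n := n.cast_nonneg
  linarith

lemma integral_mollifier (n : ℕ) : ∫ z : E, mollifier n z = 1 := by
  have hn : (0 : ℝ) < (n : ℝ) + 1 := by positivity
  simp only [mollifier]
  rw [integral_const_mul, Measure.integral_comp_smul, smul_eq_mul,
    abs_of_nonneg (by positivity), ← mul_assoc, mul_inv_cancel₀ (by positivity), one_mul]
  exact ContDiffBump.integral_normed _

/-- The factor `n + 1` is what the support radius `1 / (n + 1)` compensates in the commutator
estimate. -/
lemma integral_norm_gradient_mollifier (n : ℕ) :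
    ∫ z : E, ‖gradient (mollifier n) z‖ =
      ((n : ℝ) + 1) * ∫ z : E, ‖gradient (mollifierBase E) z‖ := by
  have hn : (0 : ℝ) < (n : ℝ) + 1 := by positivity
  have h : ∀ z : E, ‖gradient (mollifier n) z‖ = ((n : ℝ) + 1) ^ Module.finrank ℝ E *
      (((n : ℝ) + 1) * ‖gradient (mollifierBase E) (((n : ℝ) + 1) • z)‖) := by
    intro z
    have hd : DifferentiableAt ℝ (mollifierBase E) (((n : ℝ) + 1) • z) :=
      (contDiff_mollifierBase.differentiable (by simp)).differentiableAt
    have h1 : fderiv ℝ (mollifier n) z = ((n : ℝ) + 1) ^ Module.finrank ℝ E •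
        (((n : ℝ) + 1) • fderiv ℝ (mollifierBase E) (((n : ℝ) + 1) • z)) := by
      have h2 : HasFDerivAt (fun y : E => ((n : ℝ) + 1) • y)
          (((n : ℝ) + 1) • ContinuousLinearMap.id ℝ E) z := (hasFDerivAt_id z).const_smul _
      have h3 := ((hd.hasFDerivAt.comp z h2).const_mul
        (((n : ℝ) + 1) ^ Module.finrank ℝ E)).fderiv
      refine h3.trans ?_
      ext v
      simp
    simp only [gradient, LinearIsometryEquiv.norm_map, h1, norm_smul, norm_pow]
    rw [Real.norm_of_nonneg hn.le]
  simp_rw [h]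
  rw [integral_const_mul, integral_const_mul,
    Measure.integral_comp_smul volume (fun z : E => ‖gradient (mollifierBase E) z‖), smul_eq_mul,
    abs_of_nonneg (by positivity)]
  field_simp

lemma integrable_mollifier (n : ℕ) : Integrable (mollifier n : E → ℝ) :=
  (contDiff_mollifier n).continuous.integrable_of_hasCompactSupport (hasCompactSupport_mollifier n)

lemma lintegral_mollifier (n : ℕ) : ∫⁻ z : E, ENNReal.ofReal (mollifier n z) = 1 := by
  rw [← ofReal_integral_eq_lintegral_ofReal (integrable_mollifier n)
    (Eventually.of_forall (mollifier_nonneg n)), integral_mollifier, ENNReal.ofReal_one]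

/-- Convolution of `f` with the mollifier. -/
def mollify (n : ℕ) (f : E → F) (x : E) : F := ∫ y, mollifier n (x - y) • f y

lemma mollify_eq_integral_sub (n : ℕ) (f : E → F) (x : E) :
    mollify n f x = ∫ z, mollifier n z • f (x - z) := by
  rw [mollify, ← integral_sub_left_eq_self _ volume x]
  simp

lemma mollify_eq_convolution (n : ℕ) (f : E → F) :
    mollify n f = convolution (mollifier n) f (ContinuousLinearMap.lsmul ℝ ℝ) volume := by
  ext x
  rw [mollify_eq_integral_sub, convolution_def]
  rfl

lemma integrable_mollify_integrand (n : ℕ) {f : E → F} (hf : LocallyIntegrable f) (x : E) :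
    Integrable (fun y => mollifier n (x - y) • f y) := by
  refine hf.integrable_smul_left_of_hasCompactSupport
    ((contDiff_mollifier n).continuous.comp (continuous_const.sub continuous_id)) ?_
  exact (hasCompactSupport_mollifier n).comp_homeomorph (Homeomorph.subLeft x)

lemma integrable_mollify_integrand_sub (n : ℕ) {f : E → F} (hf : LocallyIntegrable f) (x : E) :
    Integrable (fun z => mollifier n z • f (x - z)) := by
  have := (integrable_mollify_integrand n hf x).comp_sub_left x
  simpa using this

lemma contDiff_mollify [CompleteSpace F] (n : ℕ) {f : E → F} (hf : LocallyIntegrable f) :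
    ContDiff ℝ (⊤ : ℕ∞) (mollify n f) := by
  rw [mollify_eq_convolution]
  exact (hasCompactSupport_mollifier n).contDiff_convolution_left _ (contDiff_mollifier n) hf

lemma continuous_gradient_mollifier (n : ℕ) : Continuous (gradient (mollifier n : E → ℝ)) :=
  (contDiff_gradient (contDiff_mollifier n)).continuous

lemma integrable_gradient_mollifier (n : ℕ) :
    Integrable (gradient (mollifier n : E → ℝ)) :=
  (continuous_gradient_mollifier n).integrable_of_hasCompactSupport
    (hasCompactSupport_mollifier n).gradient

lemma integrable_gradient_mollify_integrand (n : ℕ) {f : E → ℝ} (hf : LocallyIntegrable f)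
    (x : E) : Integrable (fun y => f y • gradient (mollifier n) (x - y)) := by
  refine hf.integrable_smul_right_of_hasCompactSupport
    ((continuous_gradient_mollifier n).comp (continuous_const.sub continuous_id)) ?_
  exact (hasCompactSupport_mollifier n).gradient.comp_homeomorph (Homeomorph.subLeft x)

lemma gradient_mollify (n : ℕ) {f : E → ℝ} (hf : LocallyIntegrable f) (x : E) :
    gradient (mollify n f) x = ∫ y, f y • gradient (mollifier n) (x - y) := by
  have h := (hasCompactSupport_mollifier (E := E) n).hasFDerivAt_convolution_left
    (ContinuousLinearMap.lsmul ℝ ℝ) ((contDiff_mollifier n).of_le (by simp)) hf x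
  rw [← mollify_eq_convolution] at h
  apply ext_inner_right ℝ
  intro v
  rw [inner_gradient_left, h.fderiv, convolution_eq_swap]
  have hi : Integrable (fun t => ((ContinuousLinearMap.precompL E (ContinuousLinearMap.lsmul ℝ ℝ))
      (fderiv ℝ (mollifier n) (x - t))) (f t)) := by
    have h0 : Continuous (fun t => fderiv ℝ (mollifier n : E → ℝ) (x - t)) :=
      ((contDiff_mollifier n).continuous_fderiv (by simp)).comp
        (continuous_const.sub continuous_id)
    have := hf.integrable_smul_right_of_hasCompactSupport h0
      (((hasCompactSupport_mollifier n).fderiv ℝ).comp_homeomorph (Homeomorph.subLeft x))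
    refine this.congr (Eventually.of_forall fun t => ?_)
    ext v
    simp [mul_comm]
  rw [ContinuousLinearMap.integral_apply hi, real_inner_comm v, ← integral_inner]
  · refine integral_congr_ae (Eventually.of_forall fun t => ?_)
    simp [real_inner_smul_right, inner_gradient_right, mul_comm]
  · exact integrable_gradient_mollify_integrand n hf x

lemma gradient_mollify_of_contDiff (n : ℕ) {f : E → ℝ} (hf : ContDiff ℝ 1 f)
    (hc : HasCompactSupport f) (x : E) :
    gradient (mollify n f) x = mollify n (gradient f) x := by
  have h := hc.hasFDerivAt_convolution_right (ContinuousLinearMap.lsmul ℝ ℝ)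
    ((contDiff_mollifier (E := E) n).continuous.locallyIntegrable (μ := volume)) hf x
  rw [← mollify_eq_convolution] at h
  apply ext_inner_right ℝ
  intro v
  rw [inner_gradient_left, h.fderiv, convolution_def, mollify_eq_integral_sub]
  have hg := (continuous_gradient hf).locallyIntegrable (μ := volume)
  have hi : Integrable (fun t => ((ContinuousLinearMap.precompR E (ContinuousLinearMap.lsmul ℝ ℝ))
      (mollifier n t)) (fderiv ℝ f (x - t))) := by
    have := integrable_mollify_integrand_sub n
      ((hf.continuous_fderiv one_ne_zero).locallyIntegrable (μ := volume)) x
    refine this.congr (Eventually.of_forall fun t => ?_)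
    ext v
    simp
  rw [ContinuousLinearMap.integral_apply hi, real_inner_comm v, ← integral_inner]
  · refine integral_congr_ae (Eventually.of_forall fun t => ?_)
    simp [real_inner_smul_right, inner_gradient_right]
  · exact integrable_mollify_integrand_sub n hg x

lemma hasCompactSupport_mollify (n : ℕ) {f : E → F} (hc : HasCompactSupport f) :
    HasCompactSupport (mollify n f) := by
  rw [mollify_eq_convolution]
  exact (hasCompactSupport_mollifier n).convolution _ hc

/-- The mollifier has mass one, so the error is an average of increments of `f` over the ball of
radius `1 / (n + 1)`. Both convergence results below start from this formula. -/
lemma mollify_const_sub [CompleteSpace F] (n : ℕ) {f : E → F} (hf : LocallyIntegrable f) (x : E) :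
    mollify n f x - f x = ∫ z, mollifier n z • (f (x - z) - f x) := by
  rw [mollify_eq_integral_sub]
  simp only [smul_sub]
  rw [integral_sub (integrable_mollify_integrand_sub n hf x)
    ((integrable_mollifier n).smul_const _), integral_smul_const, integral_mollifier, one_smul]

/-- Mollification of a uniformly continuous function converges uniformly. -/
lemma tendstoUniformly_mollify [CompleteSpace F] {f : E → F} (hf : UniformContinuous f) {ε : ℝ}
    (hε : 0 < ε) : ∀ᶠ n in atTop, ∀ x, ‖mollify n f x - f x‖ ≤ ε := by
  obtain ⟨δ, hδ, h⟩ := Metric.uniformContinuous_iff.1 hf ε hε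
  have h1 : ∀ᶠ n : ℕ in atTop, 1 / ((n : ℝ) + 1) < δ :=
    tendsto_one_div_add_atTop_nhds_zero_nat.eventually_lt_const hδ
  filter_upwards [h1] with n hn x
  rw [mollify_const_sub n hf.continuous.locallyIntegrable]
  calc ‖∫ z, mollifier n z • (f (x - z) - f x)‖ ≤ ∫ z : E, mollifier n z * ε := by
        refine norm_integral_le_of_norm_le ((integrable_mollifier n).mul_const _)
          (Eventually.of_forall fun z => ?_)
        rw [norm_smul, Real.norm_of_nonneg (mollifier_nonneg n z)]
        by_cases hz : mollifier n z = 0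
        · simp [hz]
        · refine mul_le_mul_of_nonneg_left ?_ (mollifier_nonneg n z)
          have := support_mollifier_subset n hz
          rw [mem_closedBall_zero_iff] at this
          rw [← dist_eq_norm]
          exact (h (by rw [dist_eq_norm]; simpa using this.trans_lt hn)).le
    _ = ε := by rw [integral_mul_const, integral_mollifier, one_mul]

/-- Jensen's inequality for averages with respect to the mollifier, integrated. -/
lemma lintegral_rpow_lintegral_mollifier_le (n : ℕ) {p : ℝ} (hp : 1 ≤ p) {G : E → E → ℝ≥0∞}
    (hG : AEMeasurable (Function.uncurry G) (volume.prod volume)) :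
    ∫⁻ x, (∫⁻ z, ENNReal.ofReal (mollifier n z) * G x z) ^ p ≤
      ∫⁻ z, ENNReal.ofReal (mollifier n z) * ∫⁻ x, G x z ^ p := by
  have hk : Measurable (fun z : E => ENNReal.ofReal (mollifier n z)) :=
    (contDiff_mollifier n).continuous.measurable.ennreal_ofReal
  set ν : Measure E := volume.withDensity (fun z => ENNReal.ofReal (mollifier n z)) with hν
  have : IsProbabilityMeasure ν := ⟨by
    rw [hν, withDensity_apply _ MeasurableSet.univ, Measure.restrict_univ, lintegral_mollifier]⟩
  have hsec : ∀ᵐ x : E, AEMeasurable (G x) volume := by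
    filter_upwards [hG.aestronglyMeasurable.prodMk_left] with x hx using hx.aemeasurable
  have hνd : ∀ g : E → ℝ≥0∞, AEMeasurable g volume → ∫⁻ z, g z ∂ν =
      ∫⁻ z, ENNReal.ofReal (mollifier n z) * g z := fun g hg => by
    rw [hν, lintegral_withDensity_eq_lintegral_mul₀ hk.aemeasurable hg]
    rfl
  have hac : ν ≪ volume := withDensity_absolutelyContinuous _ _
  calc ∫⁻ x, (∫⁻ z, ENNReal.ofReal (mollifier n z) * G x z) ^ p
      ≤ ∫⁻ x, ∫⁻ z, ENNReal.ofReal (mollifier n z) * G x z ^ p := by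
        refine lintegral_mono_ae ?_
        filter_upwards [hsec] with x hx
        rw [← hνd _ hx, ← hνd _ (hx.pow_const p)]
        have h := eLpNorm'_le_eLpNorm'_of_exponent_le (μ := ν) (f := G x) one_pos hp
          (hx.mono_ac hac).aestronglyMeasurable
        simp only [eLpNorm', enorm_eq_self, ENNReal.rpow_one, ne_eq, one_ne_zero,
          not_false_eq_true, div_self] at h
        calc (∫⁻ z, G x z ∂ν) ^ p ≤ ((∫⁻ z, G x z ^ p ∂ν) ^ (1 / p)) ^ p :=
              ENNReal.rpow_le_rpow h (by linarith)
          _ = ∫⁻ z, G x z ^ p ∂ν := by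
              rw [← ENNReal.rpow_mul, one_div, inv_mul_cancel₀ (by linarith), ENNReal.rpow_one]
    _ = ∫⁻ z, ∫⁻ x, ENNReal.ofReal (mollifier n z) * G x z ^ p := by
        rw [lintegral_lintegral_swap]
        exact (hk.comp measurable_snd).aemeasurable.mul (hG.pow_const p)
    _ = ∫⁻ z, ENNReal.ofReal (mollifier n z) * ∫⁻ x, G x z ^ p := by
        refine lintegral_congr fun z => ?_
        rw [lintegral_const_mul' _ _ ENNReal.ofReal_ne_top]

lemma aestronglyMeasurable_mollify [CompleteSpace F] (n : ℕ) {f : E → F}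
    (hf : LocallyIntegrable f) : AEStronglyMeasurable (mollify n f) volume :=
  (contDiff_mollify n hf).continuous.aestronglyMeasurable

lemma eLpNorm_rpow_toReal {α G : Type*} [MeasurableSpace α] [NormedAddCommGroup G] {p : ℝ≥0∞}
    (hp0 : p ≠ 0) (hp : p ≠ ⊤) (f : α → G) (μ : Measure α) :
    eLpNorm f p μ ^ p.toReal = ∫⁻ x, ‖f x‖ₑ ^ p.toReal ∂μ := by
  rw [eLpNorm_eq_lintegral_rpow_enorm_toReal hp0 hp, ← ENNReal.rpow_mul, one_div,
    inv_mul_cancel₀ (ENNReal.toReal_pos hp0 hp).ne', ENNReal.rpow_one]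

/-- If every difference in the ball of radius `1 / (n + 1)` is small, so is the averaged one. -/
lemma eLpNorm_integral_mollifier_smul_le (n : ℕ) {p : ℝ≥0∞} (hp1 : 1 ≤ p)
    (hp : p ≠ ⊤) {H : E → E → F}
    (hH : AEStronglyMeasurable (Function.uncurry H) (volume.prod volume)) {c : ℝ≥0∞}
    (hc : ∀ z, ‖z‖ ≤ 1 / ((n : ℝ) + 1) → eLpNorm (fun x => H x z) p volume ≤ c) :
    eLpNorm (fun x => ∫ z, mollifier n z • H x z) p volume ≤ c := by
  have hp0 : p ≠ 0 := (one_pos.trans_le hp1).ne'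
  have hpr : 0 < p.toReal := ENNReal.toReal_pos hp0 hp
  have hpr1 : 1 ≤ p.toReal := by
    rw [← ENNReal.toReal_one]; exact ENNReal.toReal_mono hp hp1
  rw [← ENNReal.rpow_le_rpow_iff hpr, eLpNorm_rpow_toReal hp0 hp]
  calc ∫⁻ x, ‖∫ z, mollifier n z • H x z‖ₑ ^ p.toReal
      ≤ ∫⁻ x, (∫⁻ z, ENNReal.ofReal (mollifier n z) * ‖H x z‖ₑ) ^ p.toReal := by
        refine lintegral_mono fun x => ENNReal.rpow_le_rpow ?_ hpr.le
        refine (enorm_integral_le_lintegral_enorm _).trans (lintegral_mono fun z => ?_)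
        rw [enorm_smul, Real.enorm_of_nonneg (mollifier_nonneg n z)]
    _ ≤ ∫⁻ z, ENNReal.ofReal (mollifier n z) * ∫⁻ x, ‖H x z‖ₑ ^ p.toReal :=
        lintegral_rpow_lintegral_mollifier_le n hpr1 hH.enorm
    _ ≤ ∫⁻ z : E, ENNReal.ofReal (mollifier n z) * c ^ p.toReal := by
        refine lintegral_mono fun z => ?_
        by_cases hz : mollifier n z = 0
        · simp [hz]
        · have := support_mollifier_subset n hz
          rw [mem_closedBall_zero_iff] at this
          rw [← eLpNorm_rpow_toReal hp0 hp (fun x => H x z)]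
          gcongr
          exact hc z this
    _ = c ^ p.toReal := by
        rw [lintegral_mul_const _
          (contDiff_mollifier n).continuous.measurable.ennreal_ofReal, lintegral_mollifier, one_mul]

lemma aestronglyMeasurable_comp_sub {f : E → F} (hf : AEStronglyMeasurable f volume) :
    AEStronglyMeasurable (fun q : E × E => f (q.1 - q.2)) (volume.prod volume) :=
  hf.comp_quasiMeasurePreserving (quasiMeasurePreserving_sub volume volume)

lemma eLpNorm_comp_sub_right (f : E → F) (p : ℝ≥0∞) (z : E)
    (hf : AEStronglyMeasurable f volume) :
    eLpNorm (fun x => f (x - z)) p volume = eLpNorm f p volume :=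
  eLpNorm_comp_measurePreserving hf (measurePreserving_sub_right volume z)

lemma eLpNorm_mollify_le [CompleteSpace F] (n : ℕ) {p : ℝ≥0∞} (hp1 : 1 ≤ p) (hp : p ≠ ⊤) {f : E → F}
    (hf : MemLp f p volume) : eLpNorm (mollify n f) p volume ≤ eLpNorm f p volume := by
  have := eLpNorm_integral_mollifier_smul_le n hp1 hp (H := fun x z => f (x - z))
    (aestronglyMeasurable_comp_sub hf.1) (c := eLpNorm f p volume)
    (fun z _ => (eLpNorm_comp_sub_right f p z hf.1).le)
  simpa only [← mollify_eq_integral_sub] using this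

lemma memLp_mollify [CompleteSpace F] (n : ℕ) {p : ℝ≥0∞} (hp1 : 1 ≤ p) (hp : p ≠ ⊤) {f : E → F}
    (hf : MemLp f p volume) : MemLp (mollify n f) p volume :=
  ⟨aestronglyMeasurable_mollify n (hf.locallyIntegrable hp1),
    (eLpNorm_mollify_le n hp1 hp hf).trans_lt hf.2⟩

/-- Translations act continuously on `L^p`. -/
lemma tendsto_eLpNorm_comp_sub_sub {p : ℝ≥0∞} (hp1 : 1 ≤ p) (hp : p ≠ ⊤) {f : E → F}
    (hf : MemLp f p volume) :
    Tendsto (fun z : E => eLpNorm (fun x => f (x - z) - f x) p volume) (𝓝 0) (𝓝 0) := by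
  have : Fact (1 ≤ p) := ⟨hp1⟩
  let g : E → C(E, E) := fun z => ⟨fun x => x - z, by fun_prop⟩
  have hg : Continuous g := by
    apply ContinuousMap.continuous_of_continuous_uncurry
    simp only [g]
    exact continuous_snd.sub continuous_fst
  have hgm : ∀ z, MeasurePreserving (g z) volume volume := fun z =>
    measurePreserving_sub_right volume z
  have h := (tendsto_const_nhds (x := hf.toLp f)).compMeasurePreservingLp
    (hg.tendsto 0) hgm (hgm 0) hp
  rw [Lp.tendsto_Lp_iff_tendsto_eLpNorm'] at h
  refine h.congr fun z => eLpNorm_congr_ae ?_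
  have h1 := Lp.coeFn_compMeasurePreserving (hf.toLp f) (hgm z)
  have h2 := Lp.coeFn_compMeasurePreserving (hf.toLp f) (hgm 0)
  have h3 := (hgm z).quasiMeasurePreserving.ae_eq_comp hf.coeFn_toLp
  have h4 := (hgm 0).quasiMeasurePreserving.ae_eq_comp hf.coeFn_toLp
  filter_upwards [h1, h2, h3, h4] with x e1 e2 e3 e4
  rw [Pi.sub_apply, e1, e2, e3, e4]
  simp [g]

/-- Mollification converges in `L^p`. -/
theorem tendsto_eLpNorm_mollify_sub [CompleteSpace F] {p : ℝ≥0∞} (hp1 : 1 ≤ p) (hp : p ≠ ⊤)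
    {f : E → F} (hf : MemLp f p volume) :
    Tendsto (fun n => eLpNorm (fun x => mollify n f x - f x) p volume) atTop (𝓝 0) := by
  have hfl : LocallyIntegrable f := hf.locallyIntegrable hp1
  rw [ENNReal.tendsto_nhds_zero]
  intro ε hε
  have h := (ENNReal.tendsto_nhds_zero.1 (tendsto_eLpNorm_comp_sub_sub hp1 hp hf)) ε hε
  obtain ⟨δ, hδ, hball⟩ := Metric.eventually_nhds_iff.1 h
  have h1 : ∀ᶠ n : ℕ in atTop, 1 / ((n : ℝ) + 1) < δ :=
    tendsto_one_div_add_atTop_nhds_zero_nat.eventually_lt_const hδ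
  filter_upwards [h1] with n hn
  simp_rw [mollify_const_sub n hfl]
  refine eLpNorm_integral_mollifier_smul_le n hp1 hp (H := fun x z => f (x - z) - f x)
    ((aestronglyMeasurable_comp_sub hf.1).sub hf.1.comp_fst) fun z hz => ?_
  exact hball (by simpa using hz.trans_lt hn)

end Mollifier

/-! ### Pairings in `L²` and their limits -/

section LTwo

variable {α : Type*} [MeasurableSpace α] {μ : Measure α} {F : Type*} [NormedAddCommGroup F]
  [InnerProductSpace ℝ F]

lemma MeasureTheory.MemLp.integrable_inner_two {a f : α → F} (ha : MemLp a 2 μ) (hf : MemLp f 2 μ) :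
    Integrable (fun x => ⟪a x, f x⟫) μ := by
  refine (L2.integrable_inner (𝕜 := ℝ) (ha.toLp a) (hf.toLp f)).congr ?_
  filter_upwards [ha.coeFn_toLp, hf.coeFn_toLp] with x h1 h2
  rw [h1, h2]

lemma integral_inner_eq_inner_toLp {a f : α → F} (ha : MemLp a 2 μ) (hf : MemLp f 2 μ) :
    ∫ x, ⟪a x, f x⟫ ∂μ = ⟪ha.toLp a, hf.toLp f⟫ := by
  rw [L2.inner_def]
  refine integral_congr_ae ?_
  filter_upwards [ha.coeFn_toLp, hf.coeFn_toLp] with x h1 h2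
  rw [h1, h2]

lemma abs_integral_inner_le {a f : α → F} (ha : MemLp a 2 μ) (hf : MemLp f 2 μ) :
    |∫ x, ⟪a x, f x⟫ ∂μ| ≤ (eLpNorm a 2 μ).toReal * (eLpNorm f 2 μ).toReal := by
  rw [integral_inner_eq_inner_toLp ha hf, ← Lp.norm_toLp a ha, ← Lp.norm_toLp f hf]
  exact abs_real_inner_le_norm _ _

lemma abs_integral_mul_le {a f : α → ℝ} (ha : MemLp a 2 μ) (hf : MemLp f 2 μ) :
    |∫ x, a x * f x ∂μ| ≤ (eLpNorm a 2 μ).toReal * (eLpNorm f 2 μ).toReal := by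
  simpa [mul_comm] using abs_integral_inner_le ha hf

lemma tendsto_integral_inner_of_eLpNorm {ι : Type*} {l : Filter ι} {a f : ι → α → F} {a' f' : α → F}
    (ha : ∀ i, MemLp (a i) 2 μ) (ha' : MemLp a' 2 μ)
    (hf : ∀ i, MemLp (f i) 2 μ) (hf' : MemLp f' 2 μ)
    (hta : Tendsto (fun i => eLpNorm (fun x => a i x - a' x) 2 μ) l (𝓝 0))
    (htf : Tendsto (fun i => eLpNorm (fun x => f i x - f' x) 2 μ) l (𝓝 0)) :
    Tendsto (fun i => ∫ x, ⟪a i x, f i x⟫ ∂μ) l (𝓝 (∫ x, ⟪a' x, f' x⟫ ∂μ)) := by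
  simp_rw [fun i => integral_inner_eq_inner_toLp (ha i) (hf i), integral_inner_eq_inner_toLp ha' hf']
  exact ((Lp.tendsto_Lp_iff_tendsto_eLpNorm'' a ha a' ha').2 hta).inner
    ((Lp.tendsto_Lp_iff_tendsto_eLpNorm'' f hf f' hf').2 htf)

lemma tendsto_integral_mul_of_eLpNorm {ι : Type*} {l : Filter ι} {a f : ι → α → ℝ} {a' f' : α → ℝ}
    (ha : ∀ i, MemLp (a i) 2 μ) (ha' : MemLp a' 2 μ)
    (hf : ∀ i, MemLp (f i) 2 μ) (hf' : MemLp f' 2 μ)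
    (hta : Tendsto (fun i => eLpNorm (fun x => a i x - a' x) 2 μ) l (𝓝 0))
    (htf : Tendsto (fun i => eLpNorm (fun x => f i x - f' x) 2 μ) l (𝓝 0)) :
    Tendsto (fun i => ∫ x, a i x * f i x ∂μ) l (𝓝 (∫ x, a' x * f' x ∂μ)) := by
  simpa [mul_comm] using tendsto_integral_inner_of_eLpNorm ha ha' hf hf' hta htf

end LTwo

section TestFunctions

variable {d : ℕ} {ψ χ : EuclideanSpace ℝ (Fin d) → ℝ}

lemma IsTestFunction.add (hψ : IsTestFunction ψ) (hχ : IsTestFunction χ) :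
    IsTestFunction (fun x => ψ x + χ x) := ⟨hψ.1.add hχ.1, hψ.2.add hχ.2⟩

lemma IsTestFunction.const_mul (c : ℝ) (hψ : IsTestFunction ψ) :
    IsTestFunction (fun x => c * ψ x) := ⟨contDiff_const.mul hψ.1, hψ.2.mul_left⟩

lemma IsTestFunction.mul (hχ : IsTestFunction χ) (hψ : ContDiff ℝ (⊤ : ℕ∞) ψ) :
    IsTestFunction (fun x => χ x * ψ x) := ⟨hχ.1.mul hψ, hχ.2.mul_right⟩

lemma isTestFunction_zero : IsTestFunction (fun _ : EuclideanSpace ℝ (Fin d) => (0 : ℝ)) :=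
  ⟨contDiff_const, HasCompactSupport.zero⟩

lemma IsTestFunction.differentiableAt (hψ : IsTestFunction ψ) (x : EuclideanSpace ℝ (Fin d)) :
    DifferentiableAt ℝ ψ x := hψ.contDiff_one.differentiable one_ne_zero x

lemma IsTestFunction.continuous_gradient (hψ : IsTestFunction ψ) : Continuous (gradient ψ) :=
  _root_.continuous_gradient hψ.contDiff_one

variable (μ : Measure (EuclideanSpace ℝ (Fin d))) [IsFiniteMeasureOnCompacts μ]

lemma IsTestFunction.memLp (hψ : IsTestFunction ψ) (p : ℝ≥0∞) : MemLp ψ p μ :=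
  hψ.1.continuous.memLp_of_hasCompactSupport hψ.2

lemma IsTestFunction.memLp_gradient (hψ : IsTestFunction ψ) (p : ℝ≥0∞) :
    MemLp (gradient ψ) p μ :=
  hψ.continuous_gradient.memLp_of_hasCompactSupport hψ.2.gradient

end TestFunctions

/-! ### Weighted Sobolev functions and cutoffs -/

section Sobolev

variable {d : ℕ} {μ : Measure (EuclideanSpace ℝ (Fin d))}
  {f g : EuclideanSpace ℝ (Fin d) → ℝ} {G H : EuclideanSpace ℝ (Fin d) → EuclideanSpace ℝ (Fin d)}

/-- `f ∈ H¹(μ)` with gradient `G`, for functions instead of classes. -/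
def HasWeakGradient (μ : Measure (EuclideanSpace ℝ (Fin d))) (f : EuclideanSpace ℝ (Fin d) → ℝ)
    (G : EuclideanSpace ℝ (Fin d) → EuclideanSpace ℝ (Fin d)) : Prop :=
  MemLp f 2 μ ∧ MemLp G 2 μ ∧ ∃ ψ : ℕ → EuclideanSpace ℝ (Fin d) → ℝ,
    (∀ n, IsTestFunction (ψ n)) ∧
    Tendsto (fun n => eLpNorm (fun x => ψ n x - f x) 2 μ) atTop (𝓝 0) ∧
    Tendsto (fun n => eLpNorm (fun x => gradient (ψ n) x - G x) 2 μ) atTop (𝓝 0)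

lemma HasWeakGradient.congr (h : HasWeakGradient μ f G) (hf : f =ᵐ[μ] g) (hG : G =ᵐ[μ] H) :
    HasWeakGradient μ g H := by
  obtain ⟨h1, h2, ψ, hψ, h3, h4⟩ := h
  refine ⟨h1.ae_eq hf, h2.ae_eq hG, ψ, hψ, h3.congr fun n => eLpNorm_congr_ae ?_,
    h4.congr fun n => eLpNorm_congr_ae ?_⟩
  · filter_upwards [hf] with x hx
    rw [hx]
  · filter_upwards [hG] with x hx
    rw [hx]

lemma mem_sobolevGraph_iff [IsFiniteMeasureOnCompacts μ] {u : Lp ℝ 2 μ}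
    {v : Lp (EuclideanSpace ℝ (Fin d)) 2 μ} :
    (u, v) ∈ sobolevGraph μ ↔ HasWeakGradient μ u v := by
  rw [sobolevGraph, mem_closure_iff_seq_limit]
  constructor
  · rintro ⟨q, hq, hlim⟩
    choose ψ hψ h1 h2 using hq
    refine ⟨Lp.memLp u, Lp.memLp v, ψ, hψ, ?_, ?_⟩
    · have := (Lp.tendsto_Lp_iff_tendsto_eLpNorm' _ _).1 ((continuous_fst.tendsto _).comp hlim)
      refine this.congr fun n => eLpNorm_congr_ae ?_
      filter_upwards [h1 n] with x hx
      simp [hx]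
    · have := (Lp.tendsto_Lp_iff_tendsto_eLpNorm' _ _).1 ((continuous_snd.tendsto _).comp hlim)
      refine this.congr fun n => eLpNorm_congr_ae ?_
      filter_upwards [h2 n] with x hx
      simp [hx]
  · rintro ⟨_, _, ψ, hψ, h3, h4⟩
    refine ⟨fun n => (((hψ n).memLp μ 2).toLp _, ((hψ n).memLp_gradient μ 2).toLp _), fun n => ?_, ?_⟩
    · exact ⟨ψ n, hψ n, ((hψ n).memLp μ 2).coeFn_toLp, ((hψ n).memLp_gradient μ 2).coeFn_toLp⟩
    · rw [nhds_prod_eq]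
      refine Tendsto.prodMk ?_ ?_
      · rw [Lp.tendsto_Lp_iff_tendsto_eLpNorm']
        refine h3.congr fun n => eLpNorm_congr_ae ?_
        filter_upwards [((hψ n).memLp μ 2).coeFn_toLp] with x hx
        simp [hx]
      · rw [Lp.tendsto_Lp_iff_tendsto_eLpNorm']
        refine h4.congr fun n => eLpNorm_congr_ae ?_
        filter_upwards [((hψ n).memLp_gradient μ 2).coeFn_toLp] with x hx
        simp [hx]

lemma hasWeakGradient_iff_toLp [IsFiniteMeasureOnCompacts μ] (hf : MemLp f 2 μ)
    (hG : MemLp G 2 μ) :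
    HasWeakGradient μ f G ↔ (hf.toLp f, hG.toLp G) ∈ sobolevGraph μ := by
  rw [mem_sobolevGraph_iff]
  exact ⟨fun h => h.congr hf.coeFn_toLp.symm hG.coeFn_toLp.symm,
    fun h => h.congr hf.coeFn_toLp hG.coeFn_toLp⟩

lemma IsTestFunction.hasWeakGradient [IsFiniteMeasureOnCompacts μ] {ψ : EuclideanSpace ℝ (Fin d) → ℝ}
    (hψ : IsTestFunction ψ) : HasWeakGradient μ ψ (gradient ψ) :=
  ⟨hψ.memLp μ 2, hψ.memLp_gradient μ 2, fun _ => ψ, fun _ => hψ, by simp, by simp⟩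

/-- A continuous linear identity on `H¹` can be checked on test functions. -/
lemma HasWeakGradient.integral_add_integral_eq_zero [IsFiniteMeasureOnCompacts μ]
    (h : HasWeakGradient μ f G) {a : EuclideanSpace ℝ (Fin d) → ℝ}
    {A : EuclideanSpace ℝ (Fin d) → EuclideanSpace ℝ (Fin d)} (ha : MemLp a 2 μ) (hA : MemLp A 2 μ)
    (htest : ∀ ψ, IsTestFunction ψ → ∫ x, a x * ψ x ∂μ + ∫ x, ⟪A x, gradient ψ x⟫ ∂μ = 0) :
    ∫ x, a x * f x ∂μ + ∫ x, ⟪A x, G x⟫ ∂μ = 0 := by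
  obtain ⟨h1, h2, ψ, hψ, h3, h4⟩ := h
  have t1 := tendsto_integral_mul_of_eLpNorm (l := atTop) (a := fun _ => a) (fun _ => ha) ha
    (fun n => (hψ n).memLp μ 2) h1 (by simp) h3
  have t2 := tendsto_integral_inner_of_eLpNorm (l := atTop) (a := fun _ => A) (fun _ => hA) hA
    (fun n => (hψ n).memLp_gradient μ 2) h2 (by simp) h4
  exact tendsto_nhds_unique (t1.add t2) (by simp only [htest _ (hψ _)]; exact tendsto_const_nhds)

/-- The subspace of `L² × L²` underlying `sobolevGraph`. -/
def sobolevSubmodule (μ : Measure (EuclideanSpace ℝ (Fin d))) :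
    Submodule ℝ (Lp ℝ 2 μ × Lp (EuclideanSpace ℝ (Fin d)) 2 μ) :=
  Submodule.topologicalClosure
  { carrier := {p | ∃ ψ : EuclideanSpace ℝ (Fin d) → ℝ,
      IsTestFunction ψ ∧ p.1 =ᵐ[μ] ψ ∧ p.2 =ᵐ[μ] gradient ψ}
    add_mem' := by
      rintro ⟨a, A⟩ ⟨b, B⟩ ⟨ψ, hψ, h1, h2⟩ ⟨χ, hχ, h3, h4⟩
      refine ⟨fun x => ψ x + χ x, hψ.add hχ, ?_, ?_⟩
      · filter_upwards [Lp.coeFn_add a b, h1, h3] with x e1 e2 e3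
        simp only [Prod.mk_add_mk, e1, Pi.add_apply]
        rw [← e2, ← e3]
      · filter_upwards [Lp.coeFn_add A B, h2, h4] with x e1 e2 e3
        simp only [Prod.mk_add_mk, e1, Pi.add_apply]
        rw [gradient_add' (hψ.differentiableAt x) (hχ.differentiableAt x), ← e2, ← e3]
    zero_mem' := by
      refine ⟨fun _ => 0, isTestFunction_zero, Lp.coeFn_zero _ _ _, ?_⟩
      rw [gradient_fun_const']
      exact Lp.coeFn_zero _ _ _
    smul_mem' := by
      rintro c ⟨a, A⟩ ⟨ψ, hψ, h1, h2⟩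
      refine ⟨fun x => c * ψ x, hψ.const_mul c, ?_, ?_⟩
      · filter_upwards [Lp.coeFn_smul c a, h1] with x e1 e2
        simp only [Prod.smul_mk, e1, Pi.smul_apply]
        rw [← e2, smul_eq_mul]
      · filter_upwards [Lp.coeFn_smul c A, h2] with x e1 e2
        simp only [Prod.smul_mk, e1, Pi.smul_apply]
        rw [gradient_const_mul' c (hψ.differentiableAt x), ← e2] }

lemma mem_sobolevSubmodule {q : Lp ℝ 2 μ × Lp (EuclideanSpace ℝ (Fin d)) 2 μ} :
    q ∈ sobolevSubmodule μ ↔ q ∈ sobolevGraph μ := Iff.rfl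

lemma sobolevGraph_sub {p q : Lp ℝ 2 μ × Lp (EuclideanSpace ℝ (Fin d)) 2 μ}
    (hp : p ∈ sobolevGraph μ) (hq : q ∈ sobolevGraph μ) : p - q ∈ sobolevGraph μ :=
  (sobolevSubmodule μ).sub_mem hp hq

section Finite

variable [IsFiniteMeasure μ]

lemma tendsto_eLpNorm_zero_of_uniform {F : Type*} [NormedAddCommGroup F] {α : Type*}
    [MeasurableSpace α] {ν : Measure α} [IsFiniteMeasure ν] {fn : ℕ → α → F} {p : ℝ≥0∞}
    (h : ∀ ε : ℝ, 0 < ε → ∀ᶠ n in atTop, ∀ x, ‖fn n x‖ ≤ ε) :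
    Tendsto (fun n => eLpNorm (fn n) p ν) atTop (𝓝 0) := by
  have key : ∀ ε : ℝ, 0 < ε →
      ∀ᶠ n in atTop, eLpNorm (fn n) p ν ≤ ν univ ^ p.toReal⁻¹ * ENNReal.ofReal ε := by
    intro ε hε
    filter_upwards [h ε hε] with n hn
    exact eLpNorm_le_of_ae_bound (Eventually.of_forall hn)
  have hfin : ν univ ^ p.toReal⁻¹ ≠ ⊤ := by finiteness
  have hlim : Tendsto (fun ε : ℝ => ν univ ^ p.toReal⁻¹ * ENNReal.ofReal ε) (𝓝[>] 0) (𝓝 0) := by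
    have h1 : Tendsto (fun ε : ℝ => ENNReal.ofReal ε) (𝓝[>] 0) (𝓝 0) := by
      have := (ENNReal.continuous_ofReal.tendsto (0 : ℝ)).mono_left
        (nhdsWithin_le_nhds (s := Ioi (0 : ℝ)))
      simpa using this
    simpa using ENNReal.Tendsto.const_mul h1 (Or.inr hfin)
  rw [ENNReal.tendsto_nhds_zero]
  intro δ hδ
  obtain ⟨ε, hε1, hε2⟩ := ((ENNReal.tendsto_nhds_zero.1 hlim δ hδ).and self_mem_nhdsWithin).exists
  filter_upwards [key ε hε2] with n hn using hn.trans hε1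

/-- Mollification converges uniformly together with its gradient, hence in `L²` of a finite measure.
This is needed because test functions divided by the density of the target are only `C¹`. -/
lemma hasWeakGradient_of_contDiff (hf : ContDiff ℝ 1 f) (hc : HasCompactSupport f) :
    HasWeakGradient μ f (gradient f) := by
  refine ⟨hf.continuous.memLp_of_hasCompactSupport hc,
    (continuous_gradient hf).memLp_of_hasCompactSupport hc.gradient,
    fun n => mollify n f, fun n => ⟨contDiff_mollify n hf.continuous.locallyIntegrable,
      hasCompactSupport_mollify n hc⟩, ?_, ?_⟩
  · exact tendsto_eLpNorm_zero_of_uniform fun ε hε =>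
      tendstoUniformly_mollify (hc.uniformContinuous_of_continuous hf.continuous) hε
  · refine tendsto_eLpNorm_zero_of_uniform fun ε hε => ?_
    simp_rw [gradient_mollify_of_contDiff _ hf hc]
    exact tendstoUniformly_mollify
      (hc.gradient.uniformContinuous_of_continuous (continuous_gradient hf)) hε

/-- A smooth cutoff equal to `1` on the ball of radius `1`. -/
def cutoffBase (d : ℕ) : ContDiffBump (0 : EuclideanSpace ℝ (Fin d)) :=
  ⟨1, 2, by norm_num, by norm_num⟩

/-- Smooth cutoffs equal to `1` on the ball of radius `n + 1`. -/
def cutoff (n : ℕ) (x : EuclideanSpace ℝ (Fin d)) : ℝ :=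
  cutoffBase d (((n : ℝ) + 1)⁻¹ • x)

lemma isTestFunction_cutoff (n : ℕ) : IsTestFunction (cutoff n : EuclideanSpace ℝ (Fin d) → ℝ) := by
  have hn : ((n : ℝ) + 1)⁻¹ ≠ 0 := by positivity
  refine ⟨(cutoffBase d).contDiff.comp (contDiff_id.const_smul ((n : ℝ) + 1)⁻¹), ?_⟩
  exact (cutoffBase d).hasCompactSupport.comp_homeomorph (Homeomorph.smulOfNeZero _ hn)

lemma cutoff_nonneg (n : ℕ) (x : EuclideanSpace ℝ (Fin d)) : 0 ≤ cutoff n x :=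
  (cutoffBase d).nonneg

lemma cutoff_le_one (n : ℕ) (x : EuclideanSpace ℝ (Fin d)) : cutoff n x ≤ 1 :=
  (cutoffBase d).le_one

lemma cutoff_eq_one {n : ℕ} {x : EuclideanSpace ℝ (Fin d)} (hx : ‖x‖ ≤ (n : ℝ) + 1) :
    cutoff n x = 1 := by
  have hn : (0 : ℝ) < (n : ℝ) + 1 := by positivity
  refine (cutoffBase d).one_of_mem_closedBall ?_
  rw [mem_closedBall_zero_iff, norm_smul, norm_inv, Real.norm_of_nonneg hn.le,
    inv_mul_le_iff₀ hn]
  simpa [cutoffBase] using hx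

lemma exists_norm_gradient_cutoff_le (d : ℕ) : ∃ C : ℝ, 0 ≤ C ∧
    ∀ (n : ℕ) (x : EuclideanSpace ℝ (Fin d)), ‖gradient (cutoff n) x‖ ≤ C / ((n : ℝ) + 1) := by
  have hsm : ContDiff ℝ (⊤ : ℕ∞) (cutoffBase d) := (cutoffBase d).contDiff
  have hc : Continuous (gradient (cutoffBase d)) := (contDiff_gradient hsm |>.continuous)
  obtain ⟨C, hC⟩ := hc.bounded_above_of_compact_support (cutoffBase d).hasCompactSupport.gradient
  refine ⟨C, (norm_nonneg _).trans (hC 0), fun n x => ?_⟩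
  have hn : (0 : ℝ) < (n : ℝ) + 1 := by positivity
  have hd := (hsm.differentiable (by simp)).differentiableAt (x := ((n : ℝ) + 1)⁻¹ • x)
  have h2 : HasFDerivAt (fun y : EuclideanSpace ℝ (Fin d) => ((n : ℝ) + 1)⁻¹ • y)
      (((n : ℝ) + 1)⁻¹ • ContinuousLinearMap.id ℝ _) x :=
    (hasFDerivAt_id x).const_smul (((n : ℝ) + 1)⁻¹)
  have h3 : gradient (cutoff n) x =
      ((n : ℝ) + 1)⁻¹ • gradient (cutoffBase d) (((n : ℝ) + 1)⁻¹ • x) := by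
    simp only [gradient]
    rw [show (cutoff n : EuclideanSpace ℝ (Fin d) → ℝ) =
      (cutoffBase d) ∘ (fun y => ((n : ℝ) + 1)⁻¹ • y) from rfl, (hd.hasFDerivAt.comp x h2).fderiv]
    simp
  rw [h3, norm_smul, norm_inv, Real.norm_of_nonneg hn.le, div_eq_inv_mul]
  gcongr
  exact hC _

lemma tendsto_cutoff (x : EuclideanSpace ℝ (Fin d)) :
    Tendsto (fun n => cutoff n x) atTop (𝓝 1) := by
  refine tendsto_const_nhds.congr' ?_
  filter_upwards [eventually_ge_atTop ⌈‖x‖⌉₊] with n hn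
  refine (cutoff_eq_one ?_).symm
  have := Nat.ceil_le.1 hn
  linarith

end Finite

end Sobolev

/-! ### The Langevin generator, its kernel and its inverse -/

section Spectral

variable {d : ℕ} {V : EuclideanSpace ℝ (Fin d) → ℝ}

lemma Lp_two_enorm_sq {α F : Type*} [MeasurableSpace α] {μ : Measure α} [NormedAddCommGroup F]
    (f : Lp F 2 μ) : ‖f‖ₑ ^ 2 = ∫⁻ x, ‖f x‖ₑ ^ 2 ∂μ := by
  have h := eLpNorm_rpow_toReal (p := 2) (by norm_num) (by norm_num) f μ
  simpa [Lp.enorm_def] using h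

lemma continuous_langevinExpr (hV : ContDiff ℝ 1 V) {ψ : EuclideanSpace ℝ (Fin d) → ℝ}
    (hψ : IsTestFunction ψ) : Continuous (langevinExpr V ψ) :=
  (continuous_laplacian hψ.contDiff_two).neg.add
    ((continuous_gradient hV).inner hψ.continuous_gradient)

lemma hasCompactSupport_langevinExpr {ψ : EuclideanSpace ℝ (Fin d) → ℝ}
    (hψ : IsTestFunction ψ) : HasCompactSupport (langevinExpr V ψ) := by
  refine hψ.2.laplacian.neg.add (hψ.2.gradient.mono fun x hx hx' => hx ?_)
  simp only [hx', inner_zero_right]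

section

variable [IsProbabilityMeasure (target V)]

/-- For fixed `ψ` both sides are continuous in the pair `(f, G)`, so the identity for smooth `f`
extends by density. It shows that the domain defined by duality agrees with the form domain picture.
-/
lemma HasWeakGradient.integral_mul_langevinExpr (hV : ContDiff ℝ 1 V)
    {f : EuclideanSpace ℝ (Fin d) → ℝ} {G : EuclideanSpace ℝ (Fin d) → EuclideanSpace ℝ (Fin d)}
    (h : HasWeakGradient (target V) f G) {ψ : EuclideanSpace ℝ (Fin d) → ℝ}
    (hψ : IsTestFunction ψ) :
    ∫ x, f x * langevinExpr V ψ x ∂(target V) = ∫ x, ⟪G x, gradient ψ x⟫ ∂(target V) := by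
  have := h.integral_add_integral_eq_zero (a := langevinExpr V ψ) (A := fun x => -gradient ψ x)
    ((continuous_langevinExpr hV hψ).memLp_of_hasCompactSupport (hasCompactSupport_langevinExpr hψ))
    (hψ.memLp_gradient _ 2).neg (fun χ hχ => by
      simp only [inner_neg_left, integral_neg]
      rw [show (fun x => langevinExpr V ψ x * χ x) = fun x => χ x * langevinExpr V ψ x by
        ext; ring, _root_.integral_mul_langevinExpr hV hχ.contDiff_one hψ]
      simp_rw [real_inner_comm (gradient χ _)]
      ring)
  simp only [inner_neg_left, integral_neg] at this
  simp_rw [real_inner_comm (gradient ψ _), mul_comm (f _)]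
  linarith

/-- Weak form of `L f = g` and `∇f = G`, tested against all of `H¹`. -/
def IsLangevinTriple (V : EuclideanSpace ℝ (Fin d) → ℝ) (f : Lp ℝ 2 (target V))
    (G : Lp (EuclideanSpace ℝ (Fin d)) 2 (target V)) (g : Lp ℝ 2 (target V)) : Prop :=
  (f, G) ∈ sobolevGraph (target V) ∧ ∀ h H, (h, H) ∈ sobolevGraph (target V) → ⟪G, H⟫ = ⟪g, h⟫

lemma inner_Lp_real (f g : Lp ℝ 2 (target V)) : ⟪f, g⟫ = ∫ x, f x * g x ∂(target V) := by
  rw [L2.inner_def]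
  simp [mul_comm]

/-- Density of test functions in the Sobolev graph. The stronger side allows `f` itself, or an
eigenfunction, to be inserted as a test function. -/
lemma isLangevinTriple_iff {f g : Lp ℝ 2 (target V)}
    {G : Lp (EuclideanSpace ℝ (Fin d)) 2 (target V)} :
    IsLangevinTriple V f G g ↔ (f, G) ∈ sobolevGraph (target V) ∧
      ∀ ψ, IsTestFunction ψ → ∫ x, ⟪G x, gradient ψ x⟫ ∂(target V) = ∫ x, g x * ψ x ∂(target V) := by
  constructor
  · rintro ⟨h1, h2⟩
    refine ⟨h1, fun ψ hψ => ?_⟩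
    have h := h2 _ _ ((hasWeakGradient_iff_toLp (hψ.memLp (target V) 2)
      (hψ.memLp_gradient (target V) 2)).1 hψ.hasWeakGradient)
    rw [L2.inner_def, inner_Lp_real] at h
    refine Eq.trans (integral_congr_ae ?_) (h.trans (integral_congr_ae ?_))
    · filter_upwards [(hψ.memLp_gradient (target V) 2).coeFn_toLp] with x hx
      rw [hx]
    · filter_upwards [(hψ.memLp (target V) 2).coeFn_toLp] with x hx
      rw [hx]
  · rintro ⟨h1, h2⟩
    refine ⟨h1, fun h H hH => ?_⟩
    have := (mem_sobolevGraph_iff.1 hH).integral_add_integral_eq_zero (a := fun x => -g x)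
      (A := G) (Lp.memLp g).neg (Lp.memLp G) (fun ψ hψ => by
        rw [h2 ψ hψ]
        simp [integral_neg])
    rw [L2.inner_def, inner_Lp_real]
    simp only [neg_mul, integral_neg] at this
    linarith

lemma IsLangevin.isLangevinTriple (hV : ContDiff ℝ 1 V) {f g : Lp ℝ 2 (target V)}
    (h : IsLangevin V f g) {G : Lp (EuclideanSpace ℝ (Fin d)) 2 (target V)}
    (hG : (f, G) ∈ sobolevGraph (target V)) : IsLangevinTriple V f G g := by
  rw [isLangevinTriple_iff]
  refine ⟨hG, fun ψ hψ => ?_⟩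
  rw [← h.2 ψ hψ, (mem_sobolevGraph_iff.1 hG).integral_mul_langevinExpr hV hψ]

lemma IsLangevinTriple.isLangevin (hV : ContDiff ℝ 1 V) {f g : Lp ℝ 2 (target V)}
    {G : Lp (EuclideanSpace ℝ (Fin d)) 2 (target V)} (h : IsLangevinTriple V f G g) :
    IsLangevin V f g := by
  have h' := isLangevinTriple_iff.1 h
  refine ⟨⟨G, h.1⟩, fun ψ hψ => ?_⟩
  rw [← h'.2 ψ hψ, (mem_sobolevGraph_iff.1 h.1).integral_mul_langevinExpr hV hψ]

variable {f f' g g' : Lp ℝ 2 (target V)} {G G' : Lp (EuclideanSpace ℝ (Fin d)) 2 (target V)}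

lemma IsLangevinTriple.sub (h : IsLangevinTriple V f G g) (h' : IsLangevinTriple V f' G' g') :
    IsLangevinTriple V (f - f') (G - G') (g - g') :=
  ⟨sobolevGraph_sub h.1 h'.1, fun k K hK => by
    rw [inner_sub_left, inner_sub_left, h.2 k K hK, h'.2 k K hK]⟩

lemma IsLangevinTriple.smul (c : ℝ) (h : IsLangevinTriple V f G g) :
    IsLangevinTriple V (c • f) (c • G) (c • g) :=
  ⟨(sobolevSubmodule _).smul_mem c (x := (f, G)) h.1, fun k K hK => by
    rw [real_inner_smul_left, real_inner_smul_left, h.2 k K hK]⟩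

lemma IsLangevinTriple.sum {ι : Type*} (s : Finset ι) {f g : ι → Lp ℝ 2 (target V)}
    {G : ι → Lp (EuclideanSpace ℝ (Fin d)) 2 (target V)}
    (h : ∀ i, IsLangevinTriple V (f i) (G i) (g i)) :
    IsLangevinTriple V (∑ i ∈ s, f i) (∑ i ∈ s, G i) (∑ i ∈ s, g i) := by
  refine ⟨?_, fun k K hK => ?_⟩
  · have := (sobolevSubmodule (target V)).sum_mem (t := s) (f := fun i => (f i, G i))
      fun i _ => (h i).1
    rw [mem_sobolevSubmodule] at this
    have h2 : ∑ i ∈ s, (f i, G i) = (∑ i ∈ s, f i, ∑ i ∈ s, G i) :=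
      Prod.ext Prod.fst_sum Prod.snd_sum
    rwa [h2] at this
  · rw [sum_inner, sum_inner]
    exact Finset.sum_congr rfl fun i _ => (h i).2 k K hK

lemma IsLangevinTriple.norm_sq (h : IsLangevinTriple V f G g) : ‖G‖ ^ 2 = ⟪g, f⟫ := by
  rw [← h.2 f G h.1, real_inner_self_eq_norm_sq]

lemma IsLangevinTriple.norm_sq_le (h : IsLangevinTriple V f G g) : ‖G‖ ^ 2 ≤ ‖g‖ * ‖f‖ :=
  h.norm_sq ▸ real_inner_le_norm _ _

/-- The Langevin generator is closed, with convergence of gradients. -/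
lemma IsLangevinTriple.of_tendsto {fn gn : ℕ → Lp ℝ 2 (target V)}
    {Gn : ℕ → Lp (EuclideanSpace ℝ (Fin d)) 2 (target V)}
    (h : ∀ n, IsLangevinTriple V (fn n) (Gn n) (gn n)) (hf : Tendsto fn atTop (𝓝 f))
    (hg : Tendsto gn atTop (𝓝 g)) :
    ∃ G, Tendsto Gn atTop (𝓝 G) ∧ IsLangevinTriple V f G g := by
  have hpair : Tendsto (fun n => (fn n, gn n)) atTop (𝓝 (f, g)) := hf.prodMk_nhds hg
  -- The energy identity gives `‖∇f‖² ≤ ‖L f‖ ‖f‖` for differences, and the product distance is the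
  -- maximum of the two distances. So the gradients inherit the Cauchy property from the functions
  -- and their images.
  have hd : ∀ n m, dist (Gn n) (Gn m) ≤ dist (fn n, gn n) (fn m, gn m) := by
    intro n m
    have h1 := ((h n).sub (h m)).norm_sq_le
    have h2 : ‖fn n - fn m‖ ≤ dist (fn n, gn n) (fn m, gn m) := by
      rw [← dist_eq_norm]; exact le_max_left _ _
    have h3 : ‖gn n - gn m‖ ≤ dist (fn n, gn n) (fn m, gn m) := by
      rw [← dist_eq_norm]; exact le_max_right _ _
    rw [dist_eq_norm]
    refine le_of_sq_le_sq ?_ dist_nonneg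
    calc ‖Gn n - Gn m‖ ^ 2 ≤ ‖gn n - gn m‖ * ‖fn n - fn m‖ := h1
      _ ≤ dist (fn n, gn n) (fn m, gn m) * dist (fn n, gn n) (fn m, gn m) := by gcongr
      _ = _ := by ring
  have hc : CauchySeq Gn := by
    have := hpair.cauchySeq
    rw [Metric.cauchySeq_iff'] at this ⊢
    intro ε hε
    obtain ⟨N, hN⟩ := this ε hε
    exact ⟨N, fun n hn => (hd n N).trans_lt (hN n hn)⟩
  obtain ⟨G, hG⟩ := cauchySeq_tendsto_of_complete hc
  refine ⟨G, hG, ?_, fun k K hK => ?_⟩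
  · exact isClosed_closure.mem_of_tendsto (hf.prodMk_nhds hG) (Eventually.of_forall fun n => (h n).1)
  · refine tendsto_nhds_unique (hG.inner tendsto_const_nhds) ?_
    simp_rw [fun n => (h n).2 k K hK]
    exact hg.inner tendsto_const_nhds

lemma inner_const_one (f : Lp ℝ 2 (target V)) :
    ⟪Lp.const 2 (target V) (1 : ℝ), f⟫ = ∫ x, f x ∂(target V) := by
  rw [inner_Lp_real]
  refine integral_congr_ae ?_
  filter_upwards [Lp.coeFn_const 2 (target V) (1 : ℝ)] with x hx
  rw [hx]
  simp

lemma isClosed_norm_sub_mean_le (C : ℝ≥0) (one : Lp ℝ 2 (target V)) :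
    IsClosed {q : Lp ℝ 2 (target V) × Lp (EuclideanSpace ℝ (Fin d)) 2 (target V) |
      ‖q.1 - ⟪one, q.1⟫ • one‖ₑ ^ 2 ≤ C * ‖q.2‖ₑ ^ 2} := by
  refine isClosed_le ?_ ?_
  · have h1 : Continuous fun q : Lp ℝ 2 (target V) => q - ⟪one, q⟫ • one :=
      continuous_id.sub (Continuous.smul (f := fun q : Lp ℝ 2 (target V) => ⟪one, q⟫)
        (g := fun _ => one) (continuous_const.inner continuous_id) continuous_const)
    exact (ENNReal.continuous_pow 2).comp (h1.comp continuous_fst).enorm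
  · exact (ENNReal.continuous_const_mul ENNReal.coe_ne_top).comp
      ((ENNReal.continuous_pow 2).comp continuous_snd.enorm)

lemma PoincareInequality.norm_sub_mean_le_of_test {C : ℝ≥0}
    (hP : PoincareInequality (target V) C) {ψ : EuclideanSpace ℝ (Fin d) → ℝ}
    (hψ : IsTestFunction ψ) (h1 : f =ᵐ[target V] ψ) (h2 : G =ᵐ[target V] gradient ψ) :
    ‖f - ⟪Lp.const 2 (target V) (1 : ℝ), f⟫ • Lp.const 2 (target V) (1 : ℝ)‖ₑ ^ 2 ≤
      C * ‖G‖ₑ ^ 2 := by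
  have := hP ψ hψ.contDiff_one.locallyLipschitz (hψ.memLp _ 2)
  rw [Lp_two_enorm_sq, Lp_two_enorm_sq]
  refine Eq.trans_le (lintegral_congr_ae ?_) (this.trans_eq ?_)
  · have hm : ⟪Lp.const 2 (target V) (1 : ℝ), f⟫ = ∫ x, ψ x ∂(target V) := by
      rw [inner_const_one]; exact integral_congr_ae h1
    rw [hm]
    filter_upwards [Lp.coeFn_sub f ((∫ x, ψ x ∂(target V)) • Lp.const 2 (target V) (1 : ℝ)),
      Lp.coeFn_smul (∫ x, ψ x ∂(target V)) (Lp.const 2 (target V) (1 : ℝ)),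
      Lp.coeFn_const 2 (target V) (1 : ℝ), h1] with x e1 e2 e3 e4
    rw [e1, Pi.sub_apply, e2, Pi.smul_apply, e3, e4]
    simp
  · congr 1
    refine lintegral_congr_ae ?_
    filter_upwards [h2] with x hx
    rw [hx]

/-- The Poincaré inequality extends to `H¹`. -/
lemma PoincareInequality.norm_sub_mean_le {C : ℝ≥0} (hP : PoincareInequality (target V) C)
    (h : (f, G) ∈ sobolevGraph (target V)) :
    ‖f - ⟪Lp.const 2 (target V) (1 : ℝ), f⟫ • Lp.const 2 (target V) (1 : ℝ)‖ₑ ^ 2 ≤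
      C * ‖G‖ₑ ^ 2 := by
  have hcl := isClosed_norm_sub_mean_le C (Lp.const 2 (target V) (1 : ℝ))
  have key := closure_minimal (fun q hq => ?_) hcl (s := {p | ∃ ψ : EuclideanSpace ℝ (Fin d) → ℝ,
    IsTestFunction ψ ∧ p.1 =ᵐ[target V] ψ ∧ p.2 =ᵐ[target V] gradient ψ})
  · have h' := key h
    rw [mem_ofPred_eq] at h'
    exact h'
  · rw [mem_ofPred_eq] at hq ⊢
    obtain ⟨ψ, hψ, h1, h2⟩ := hq
    exact hP.norm_sub_mean_le_of_test hψ h1 h2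

variable {lam : ℕ → ℝ} {φ : HilbertBasis ℕ ℝ (Lp ℝ 2 (target V))}

lemma HasDiscreteSpectrum.exists_gradient (hV : ContDiff ℝ 1 V) (h : HasDiscreteSpectrum V lam φ) :
    ∃ Gφ : ℕ → Lp (EuclideanSpace ℝ (Fin d)) 2 (target V),
      ∀ i, IsLangevinTriple V (φ i) (Gφ i) (lam i • φ i) := by
  choose Gφ hG using fun i => (h.eigen i).1
  exact ⟨Gφ, fun i => (h.eigen i).isLangevinTriple hV (hG i)⟩

/-- An eigenfunction for the eigenvalue `0` is constant. -/
lemma HasDiscreteSpectrum.eq_const_of_eq_zero (hV : ContDiff ℝ 1 V)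
    (h : HasDiscreteSpectrum V lam φ) {C : ℝ≥0} (hP : PoincareInequality (target V) C) {i : ℕ}
    (hi : lam i = 0) :
    φ i = ⟪Lp.const 2 (target V) (1 : ℝ), φ i⟫ • Lp.const 2 (target V) (1 : ℝ) := by
  obtain ⟨Gφ, hG⟩ := h.exists_gradient hV
  have h1 := (hG i).norm_sq
  rw [hi, zero_smul, inner_zero_left] at h1
  have h2 : Gφ i = 0 := norm_eq_zero.1 (pow_eq_zero_iff two_ne_zero |>.1 h1)
  have h3 := hP.norm_sub_mean_le (hG i).1
  rw [h2] at h3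
  simpa [sub_eq_zero] using h3

lemma HasDiscreteSpectrum.one_eq (hV : ContDiff ℝ 1 V)
    (h : HasDiscreteSpectrum V lam φ) {C : ℝ≥0} (hP : PoincareInequality (target V) C) :
    ∃ c : ℝ, c ≠ 0 ∧ φ 0 = c • Lp.const 2 (target V) (1 : ℝ) := by
  refine ⟨_, fun hc => ?_, h.eq_const_of_eq_zero hV hP h.zero⟩
  have h0 := h.eq_const_of_eq_zero hV hP h.zero
  rw [hc, zero_smul] at h0
  have := φ.orthonormal.1 0
  rw [h0] at this
  simp at this

lemma HasDiscreteSpectrum.inner_one_eq_zero (hV : ContDiff ℝ 1 V)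
    (h : HasDiscreteSpectrum V lam φ) {C : ℝ≥0} (hP : PoincareInequality (target V) C) (i : ℕ) :
    ⟪φ (i + 1), Lp.const 2 (target V) (1 : ℝ)⟫ = 0 := by
  obtain ⟨c, hc, h0⟩ := h.one_eq hV hP
  have h1 := φ.orthonormal.2 (show i + 1 ≠ 0 by omega)
  change ⟪φ (i + 1), φ 0⟫ = 0 at h1
  rw [h0, real_inner_smul_right] at h1
  exact (mul_eq_zero.1 h1).resolve_left hc

/-- If `λ₁` vanished, `φ₁` would be constant, yet it is orthogonal to the constants because `φ₀` is
a nonzero one. A unit vector cannot be both. -/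
lemma HasDiscreteSpectrum.pos (hV : ContDiff ℝ 1 V)
    (h : HasDiscreteSpectrum V lam φ) {C : ℝ≥0} (hP : PoincareInequality (target V) C) :
    0 < lam 1 := by
  have h01 : lam 0 ≤ lam 1 := h.mono zero_le_one
  rw [h.zero] at h01
  refine lt_of_le_of_ne h01 fun h1 => ?_
  have h2 := h.eq_const_of_eq_zero hV hP h1.symm
  have h3 := h.inner_one_eq_zero hV hP 0
  rw [zero_add, real_inner_comm] at h3
  rw [h3, zero_smul] at h2
  have := φ.orthonormal.1 1
  rw [h2] at this
  simp at this

lemma HasDiscreteSpectrum.pos_succ (hV : ContDiff ℝ 1 V)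
    (h : HasDiscreteSpectrum V lam φ) {C : ℝ≥0} (hP : PoincareInequality (target V) C) (i : ℕ) :
    0 < lam (i + 1) :=
  (h.pos hV hP).trans_le (h.mono (by omega))

/-- The zero mode is constant, so its coefficient is a multiple of the mean and drops out of the
expansion. -/
lemma HasDiscreteSpectrum.hasSum_succ (hV : ContDiff ℝ 1 V)
    (h : HasDiscreteSpectrum V lam φ) {C : ℝ≥0} (hP : PoincareInequality (target V) C)
    (hf : ∫ x, f x ∂(target V) = 0) :
    HasSum (fun i => ⟪φ (i + 1), f⟫ • φ (i + 1)) f := by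
  obtain ⟨c, hc, h0⟩ := h.one_eq hV hP
  have h1 := φ.hasSum_repr f
  rw [← hasSum_nat_add_iff' 1] at h1
  simp only [φ.repr_apply_apply] at h1
  rwa [Finset.sum_range_one, h0, real_inner_smul_left, inner_const_one, hf, mul_zero, zero_smul,
    sub_zero] at h1

/-- Partial sums of the spectral representation solve `L f = g`, with converging gradients. -/
lemma IsSpectralKernelImage.exists_isLangevinTriple (hV : ContDiff ℝ 1 V)
    (h : HasDiscreteSpectrum V lam φ) {C : ℝ≥0} (hP : PoincareInequality (target V) C)
    {Gφ : ℕ → Lp (EuclideanSpace ℝ (Fin d)) 2 (target V)}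
    (hGφ : ∀ i, IsLangevinTriple V (φ i) (Gφ i) (lam i • φ i))
    (hg : ∫ x, g x ∂(target V) = 0) (hfg : IsSpectralKernelImage lam φ g f) :
    ∃ G, Tendsto (fun n => ∑ i ∈ Finset.range n,
        ((lam (i + 1))⁻¹ * ⟪φ (i + 1), g⟫) • Gφ (i + 1)) atTop (𝓝 G) ∧
      IsLangevinTriple V f G g := by
  refine IsLangevinTriple.of_tendsto (fun n => ?_) hfg.tendsto_sum_nat
    (h.hasSum_succ hV hP hg).tendsto_sum_nat
  refine IsLangevinTriple.sum _ fun i => ?_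
  have := (hGφ (i + 1)).smul ((lam (i + 1))⁻¹ * ⟪φ (i + 1), g⟫)
  convert this using 1
  rw [smul_smul]
  congr 1
  have := (h.pos_succ hV hP i).ne'
  field_simp

theorem HasDiscreteSpectrum.isSpectralKernelImage_iff (hV : ContDiff ℝ 1 V)
    (h : HasDiscreteSpectrum V lam φ) {C : ℝ≥0} (hP : PoincareInequality (target V) C)
    (hf : ∫ x, f x ∂(target V) = 0) (hg : ∫ x, g x ∂(target V) = 0) :
    IsSpectralKernelImage lam φ g f ↔ IsLangevin V f g := by
  obtain ⟨Gφ, hGφ⟩ := h.exists_gradient hV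
  constructor
  · intro hfg
    obtain ⟨G, -, hG⟩ := hfg.exists_isLangevinTriple hV h hP hGφ hg
    exact hG.isLangevin hV
  · intro hL
    obtain ⟨G, hG⟩ := hL.1
    have hT := hL.isLangevinTriple hV hG
    have := h.hasSum_succ hV hP hf
    refine this.congr_fun fun i => ?_
    congr 1
    -- Symmetry of the Dirichlet form: evaluating `⟨G, ∇φ⟩` through either triple gives `⟨φ, g⟩ = λ
    -- ⟨φ, f⟩`, which identifies the coefficients.
    have h1 := hT.2 _ _ (hGφ (i + 1)).1
    have h2 := (hGφ (i + 1)).2 _ _ hG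
    rw [real_inner_comm, h1, real_inner_smul_left, real_inner_comm] at h2
    rw [h2, inv_mul_cancel_left₀ (h.pos_succ hV hP i).ne']

end

end Spectral

/-! ### Translations of Sobolev functions and interior regularity -/

section Translation

variable {d : ℕ} {μ : Measure (EuclideanSpace ℝ (Fin d))}
  {f g : EuclideanSpace ℝ (Fin d) → ℝ} {G H : EuclideanSpace ℝ (Fin d) → EuclideanSpace ℝ (Fin d)}

lemma HasWeakGradient.sub [IsFiniteMeasureOnCompacts μ] (hf : HasWeakGradient μ f G)
    (hg : HasWeakGradient μ g H) :
    HasWeakGradient μ (fun x => f x - g x) (fun x => G x - H x) := by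
  have h1 := (hasWeakGradient_iff_toLp hf.1 hf.2.1).1 hf
  have h2 := (hasWeakGradient_iff_toLp hg.1 hg.2.1).1 hg
  exact (hasWeakGradient_iff_toLp (hf.1.sub hg.1) (hf.2.1.sub hg.2.1)).2 (sobolevGraph_sub h1 h2)

lemma gradient_comp_sub_right {ψ : EuclideanSpace ℝ (Fin d) → ℝ} (h x : EuclideanSpace ℝ (Fin d)) :
    gradient (fun y => ψ (y - h)) x = gradient ψ (x - h) := by
  simp only [gradient]
  simp only [sub_eq_add_neg]
  rw [fderiv_comp_add_right]

lemma IsTestFunction.comp_sub_right {ψ : EuclideanSpace ℝ (Fin d) → ℝ} (hψ : IsTestFunction ψ)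
    (h : EuclideanSpace ℝ (Fin d)) : IsTestFunction (fun x => ψ (x - h)) :=
  ⟨hψ.1.comp (contDiff_id.sub contDiff_const), hψ.2.comp_homeomorph (Homeomorph.subRight h)⟩

lemma MeasureTheory.MemLp.comp_sub_right {F : Type*} [NormedAddCommGroup F]
    {f : EuclideanSpace ℝ (Fin d) → F} {p : ℝ≥0∞} (hf : MemLp f p volume)
    (h : EuclideanSpace ℝ (Fin d)) : MemLp (fun x => f (x - h)) p volume :=
  hf.comp_measurePreserving (measurePreserving_sub_right volume h)

lemma HasWeakGradient.comp_sub_right (hf : HasWeakGradient volume f G)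
    (h : EuclideanSpace ℝ (Fin d)) :
    HasWeakGradient volume (fun x => f (x - h)) (fun x => G (x - h)) := by
  obtain ⟨h1, h2, ψ, hψ, h3, h4⟩ := hf
  refine ⟨h1.comp_sub_right h, h2.comp_sub_right h, fun n x => ψ n (x - h),
    fun n => (hψ n).comp_sub_right h, h3.congr fun n => ?_, h4.congr fun n => ?_⟩
  · have ms : MemLp (fun x => ψ n x - f x) 2 volume := ((hψ n).memLp volume 2).sub h1
    exact (eLpNorm_comp_sub_right _ 2 h ms.1).symm
  · have ms : MemLp (fun x => gradient (ψ n) x - G x) 2 volume :=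
      ((hψ n).memLp_gradient volume 2).sub h2
    simp_rw [gradient_comp_sub_right]
    exact (eLpNorm_comp_sub_right _ 2 h ms.1).symm

lemma lintegral_sq_le_of_isProbabilityMeasure {α : Type*} [MeasurableSpace α] {ν : Measure α}
    [IsProbabilityMeasure ν] {g : α → ℝ≥0∞} (hg : AEMeasurable g ν) :
    (∫⁻ x, g x ∂ν) ^ 2 ≤ ∫⁻ x, g x ^ 2 ∂ν := by
  have h := eLpNorm'_le_eLpNorm'_of_exponent_le (μ := ν) (f := g) one_pos one_le_two
    hg.aestronglyMeasurable
  simp only [eLpNorm', enorm_eq_self, ENNReal.rpow_one, ne_eq, one_ne_zero,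
    not_false_eq_true, div_self, ENNReal.rpow_two] at h
  calc (∫⁻ x, g x ∂ν) ^ 2 ≤ ((∫⁻ x, g x ^ 2 ∂ν) ^ (1 / 2 : ℝ)) ^ 2 := by gcongr
    _ = ∫⁻ x, g x ^ 2 ∂ν := by
        rw [← ENNReal.rpow_natCast, ← ENNReal.rpow_mul]
        norm_num

lemma eLpNorm_two_sq {α F : Type*} [MeasurableSpace α] [NormedAddCommGroup F] (f : α → F)
    (ν : Measure α) : eLpNorm f 2 ν ^ 2 = ∫⁻ x, ‖f x‖ₑ ^ 2 ∂ν := by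
  simpa using eLpNorm_rpow_toReal (p := 2) (by norm_num) (by norm_num) f ν

/-- The increment is the integral of the derivative along the segment; Jensen in the segment
parameter and translation invariance of Lebesgue measure give the bound. -/
lemma IsTestFunction.eLpNorm_comp_sub_sub_le {ψ : EuclideanSpace ℝ (Fin d) → ℝ}
    (hψ : IsTestFunction ψ) (h : EuclideanSpace ℝ (Fin d)) :
    eLpNorm (fun x => ψ (x - h) - ψ x) 2 volume ≤ ‖h‖ₑ * eLpNorm (gradient ψ) 2 volume := by
  have hc := hψ.continuous_gradient
  have hpt : ∀ x, ‖ψ (x - h) - ψ x‖ₑ ≤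
      ∫⁻ t : ℝ in Ioc 0 1, ‖h‖ₑ * ‖gradient ψ (x - t • h)‖ₑ := by
    intro x
    have hder : ∀ t : ℝ, HasDerivAt (fun t : ℝ => ψ (x - t • h))
        (-⟪gradient ψ (x - t • h), h⟫) t := by
      intro t
      have h1 : HasDerivAt (fun t : ℝ => x - t • h) (-h) t := by
        simpa using ((hasDerivAt_id t).smul_const h).const_sub x
      have h2 := (hψ.differentiableAt (x - t • h)).hasFDerivAt.comp_hasDerivAt t h1
      rw [inner_gradient_left, ← map_neg]
      exact h2
    have hcont : Continuous fun t : ℝ => -⟪gradient ψ (x - t • h), h⟫ :=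
      ((hc.comp (by fun_prop)).inner continuous_const).neg
    have h3 := intervalIntegral.integral_eq_sub_of_hasDerivAt (a := 0) (b := 1)
      (fun t _ => hder t) (hcont.intervalIntegrable _ _)
    simp only [one_smul, zero_smul, sub_zero] at h3
    rw [← h3, intervalIntegral.integral_of_le zero_le_one]
    refine (enorm_integral_le_lintegral_enorm _).trans (lintegral_mono fun t => ?_)
    rw [enorm_neg, mul_comm]
    simp only [enorm_eq_nnnorm]
    exact_mod_cast nnnorm_inner_le_nnnorm (𝕜 := ℝ) _ _
  have : IsProbabilityMeasure (volume.restrict (Ioc (0 : ℝ) 1)) := ⟨by simp⟩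
  rw [← ENNReal.pow_le_pow_left_iff (two_ne_zero), mul_pow, eLpNorm_two_sq, eLpNorm_two_sq]
  have hm : Measurable fun q : EuclideanSpace ℝ (Fin d) × ℝ => ‖gradient ψ (q.1 - q.2 • h)‖ₑ :=
    (hc.comp (by fun_prop)).enorm.measurable
  calc ∫⁻ x, ‖ψ (x - h) - ψ x‖ₑ ^ 2
      ≤ ∫⁻ x, ∫⁻ t : ℝ in Ioc 0 1, (‖h‖ₑ * ‖gradient ψ (x - t • h)‖ₑ) ^ 2 := by
        refine lintegral_mono fun x => ?_
        calc ‖ψ (x - h) - ψ x‖ₑ ^ 2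
            ≤ (∫⁻ t : ℝ in Ioc 0 1, ‖h‖ₑ * ‖gradient ψ (x - t • h)‖ₑ) ^ 2 := by
              gcongr; exact hpt x
          _ ≤ _ := lintegral_sq_le_of_isProbabilityMeasure
              ((hm.comp measurable_prodMk_left).const_mul _).aemeasurable
    _ = ∫⁻ t : ℝ in Ioc 0 1, ∫⁻ x, (‖h‖ₑ * ‖gradient ψ (x - t • h)‖ₑ) ^ 2 := by
        rw [lintegral_lintegral_swap]
        exact ((hm.const_mul _).pow_const 2).aemeasurable
    _ = ∫⁻ t : ℝ in Ioc 0 1, ‖h‖ₑ ^ 2 * ∫⁻ x, ‖gradient ψ x‖ₑ ^ 2 := by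
        refine lintegral_congr fun t => ?_
        simp_rw [mul_pow]
        rw [lintegral_const_mul' _ _ (by finiteness),
          lintegral_sub_right_eq_self (fun x => ‖gradient ψ x‖ₑ ^ 2) (t • h)]
    _ = ‖h‖ₑ ^ 2 * ∫⁻ x, ‖gradient ψ x‖ₑ ^ 2 := by simp

lemma HasWeakGradient.eLpNorm_comp_sub_sub_le (hf : HasWeakGradient volume f G)
    (h : EuclideanSpace ℝ (Fin d)) :
    eLpNorm (fun x => f (x - h) - f x) 2 volume ≤ ‖h‖ₑ * eLpNorm G 2 volume := by
  obtain ⟨h1, h2, ψ, hψ, h3, h4⟩ := hf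
  have key : ∀ n, eLpNorm (fun x => f (x - h) - f x) 2 volume ≤
      ‖h‖ₑ * (eLpNorm (fun x => gradient (ψ n) x - G x) 2 volume + eLpNorm G 2 volume) +
        (eLpNorm (fun x => ψ n x - f x) 2 volume + eLpNorm (fun x => ψ n x - f x) 2 volume) := by
    intro n
    have m1 := (hψ n).memLp volume 2
    have ms : MemLp (fun x => ψ n x - f x) 2 volume := m1.sub h1
    have msh : MemLp (fun x => ψ n (x - h) - f (x - h)) 2 volume := ms.comp_sub_right h
    have mp : MemLp (fun x => ψ n (x - h) - ψ n x) 2 volume := (m1.comp_sub_right h).sub m1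
    have mg : MemLp (fun x => gradient (ψ n) x - G x) 2 volume :=
      ((hψ n).memLp_gradient volume 2).sub h2
    have e1 : eLpNorm (fun x => f (x - h) - f x) 2 volume ≤
        eLpNorm (fun x => ψ n (x - h) - ψ n x) 2 volume +
          (eLpNorm (fun x => ψ n x - f x) 2 volume +
            eLpNorm (fun x => ψ n (x - h) - f (x - h)) 2 volume) := by
      have : (fun x => f (x - h) - f x) = (fun x => ψ n (x - h) - ψ n x) +
          ((fun x => ψ n x - f x) - (fun x => ψ n (x - h) - f (x - h))) := by
        ext x; simp only [Pi.add_apply, Pi.sub_apply]; ring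
      rw [this]
      exact (eLpNorm_add_le mp.1 (ms.sub msh).1 one_le_two).trans
        (add_le_add le_rfl (eLpNorm_sub_le ms.1 msh.1 one_le_two))
    have e2 : eLpNorm (fun x => ψ n (x - h) - f (x - h)) 2 volume =
        eLpNorm (fun x => ψ n x - f x) 2 volume := by
      exact eLpNorm_comp_sub_right (fun x => ψ n x - f x) 2 h ms.1
    rw [e2] at e1
    refine e1.trans (add_le_add (((hψ n).eLpNorm_comp_sub_sub_le h).trans
      (mul_le_mul_right ?_ _)) le_rfl)
    have : gradient (ψ n) = (fun x => gradient (ψ n) x - G x) + G := by ext1 x; simp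
    conv_lhs => rw [this]
    exact eLpNorm_add_le mg.1 h2.1 one_le_two
  have t1 := (ENNReal.Tendsto.const_mul (h4.add_const (eLpNorm G 2 volume))
    (Or.inr (enorm_ne_top (x := h)))).add (h3.add h3)
  simp only [zero_add, add_zero] at t1
  exact ge_of_tendsto' t1 key

/-- Interior regularity by difference quotients: if `∇w = v` and `-Δw = F` in `L²`, then `v` is
Lipschitz under translations in `L²`. -/
theorem HasWeakGradient.eLpNorm_gradient_comp_sub_sub_le {w F : EuclideanSpace ℝ (Fin d) → ℝ}
    {v : EuclideanSpace ℝ (Fin d) → EuclideanSpace ℝ (Fin d)} (hw : HasWeakGradient volume w v)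
    (hF : MemLp F 2 volume)
    (hweak : ∀ ψ, IsTestFunction ψ → ∫ x, ⟪v x, gradient ψ x⟫ = ∫ x, F x * ψ x)
    (h : EuclideanSpace ℝ (Fin d)) :
    eLpNorm (fun x => v (x - h) - v x) 2 volume ≤ eLpNorm F 2 volume * ‖h‖ₑ := by
  have hv := hw.2.1
  have hweak' : ∀ k K, HasWeakGradient volume k K → ∫ x, ⟪v x, K x⟫ = ∫ x, F x * k x := by
    intro k K hk
    have := hk.integral_add_integral_eq_zero (a := fun x => -F x) (A := v) hF.neg hv
      (fun ψ hψ => by rw [hweak ψ hψ]; simp [integral_neg])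
    simp only [neg_mul, integral_neg] at this
    linarith
  obtain ⟨D, hDdef⟩ : ∃ D : EuclideanSpace ℝ (Fin d) → ℝ, D = fun x => w (x - h) - w x := ⟨_, rfl⟩
  obtain ⟨DG, hDG⟩ : ∃ DG : EuclideanSpace ℝ (Fin d) → EuclideanSpace ℝ (Fin d),
    DG = fun x => v (x - h) - v x := ⟨_, rfl⟩
  have hD : HasWeakGradient volume D DG := by
    rw [hDdef, hDG]; exact (hw.comp_sub_right h).sub hw
  -- The equation is tested with the second difference `D (· + h) - D`. Moving the translation onto
  -- `v` turns the left side into `‖DG‖²`, while the right side is at most `‖F‖ ‖h‖ ‖DG‖` by the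
  -- first-order estimate for `D`. One factor `‖DG‖` then cancels.
  have hD2 := (hD.comp_sub_right (-h)).sub hD
  have hDGm : MemLp DG 2 volume := hD.2.1
  have e1 : ∫ x, ⟪DG x, DG x⟫ = ∫ x, F x * (D (x - -h) - D x) := by
    rw [← hweak' _ _ hD2]
    simp_rw [fun x => inner_sub_right (𝕜 := ℝ) (v x) (DG (x - -h)) (DG x)]
    rw [integral_sub (hv.integrable_inner_two (hDGm.comp_sub_right (-h)))
      (hv.integrable_inner_two hDGm)]
    have : ∫ x, ⟪v x, DG (x - -h)⟫ = ∫ x, ⟪v (x - h), DG x⟫ := by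
      rw [← integral_sub_right_eq_self (fun x => ⟪v x, DG (x - -h)⟫) h]
      simp
    rw [this, ← integral_sub ((hv.comp_sub_right h).integrable_inner_two hDGm)
      (hv.integrable_inner_two hDGm)]
    simp only [← inner_sub_left, hDG]
  have e2 : ∫ x, ⟪DG x, DG x⟫ = (eLpNorm DG 2 volume).toReal ^ 2 := by
    rw [integral_inner_eq_inner_toLp hDGm hDGm, real_inner_self_eq_norm_sq, Lp.norm_toLp]
  have e3 := abs_integral_mul_le hF hD2.1
  have e4 := hD.eLpNorm_comp_sub_sub_le (-h)
  have hfin : ‖-h‖ₑ * eLpNorm DG 2 volume ≠ ⊤ := ENNReal.mul_ne_top enorm_ne_top hDGm.2.ne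
  have e5 := ENNReal.toReal_mono hfin e4
  rw [ENNReal.toReal_mul, enorm_neg] at e5
  have e6 : (eLpNorm DG 2 volume).toReal ^ 2 ≤
      (eLpNorm F 2 volume).toReal * (‖h‖ₑ.toReal * (eLpNorm DG 2 volume).toReal) := by
    rw [← e2, e1]
    refine (le_abs_self _).trans (e3.trans ?_)
    gcongr
  have e7 : (eLpNorm DG 2 volume).toReal ≤ (eLpNorm F 2 volume).toReal * ‖h‖ₑ.toReal := by
    rcases (ENNReal.toReal_nonneg (a := eLpNorm DG 2 volume)).eq_or_lt with h0 | h0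
    · rw [← h0]; positivity
    · nlinarith
  rw [← hDG, ← ENNReal.toReal_le_toReal hDGm.2.ne (ENNReal.mul_ne_top hF.2.ne enorm_ne_top),
    ENNReal.toReal_mul]
  exact e7

end Translation

/-! ### The DiPerna–Lions commutator -/

section Commutator

variable {d : ℕ} {m m' F : EuclideanSpace ℝ (Fin d) → ℝ}
  {v : EuclideanSpace ℝ (Fin d) → EuclideanSpace ℝ (Fin d)}

/-- The DiPerna–Lions commutator `div (m v) * η - ⟨v, ∇(m * η)⟩`. -/
def mollifierCommutator (n : ℕ) (m : EuclideanSpace ℝ (Fin d) → ℝ)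
    (v : EuclideanSpace ℝ (Fin d) → EuclideanSpace ℝ (Fin d)) (x : EuclideanSpace ℝ (Fin d)) : ℝ :=
  ∫ y, m y * ⟪gradient (mollifier n) (x - y), v y - v x⟫

lemma commutator_eq_integral_sub (n : ℕ) (x : EuclideanSpace ℝ (Fin d)) :
    mollifierCommutator n m v x = ∫ z, m (x - z) * ⟪gradient (mollifier n) z, v (x - z) - v x⟫ := by
  rw [mollifierCommutator, ← integral_sub_left_eq_self _ volume x]
  simp

lemma integrable_flux_integrand (n : ℕ) (hm : MemLp m 2 volume) (hv : MemLp v 2 volume)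
    (x : EuclideanSpace ℝ (Fin d)) :
    Integrable fun y => m y * ⟪gradient (mollifier n) (x - y), v y⟫ := by
  have h1 : Integrable fun y => m y • v y := memLp_one_iff_integrable.1 (hv.smul hm)
  have hc : Continuous fun y : EuclideanSpace ℝ (Fin d) => gradient (mollifier n) (x - y) :=
    (continuous_gradient_mollifier n).comp (continuous_const.sub continuous_id)
  obtain ⟨C, hC⟩ := (continuous_gradient_mollifier
    (E := EuclideanSpace ℝ (Fin d)) n).bounded_above_of_compact_support
    (hasCompactSupport_mollifier n).gradient
  refine (h1.norm.const_mul C).mono' ?_ (Eventually.of_forall fun y => ?_)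
  · exact hm.1.mul (hc.aestronglyMeasurable.inner hv.1)
  · rw [norm_mul, norm_smul]
    calc ‖m y‖ * ‖⟪gradient (mollifier n) (x - y), v y⟫‖ ≤ ‖m y‖ * (C * ‖v y‖) := by
          gcongr
          exact (norm_inner_le_norm _ _).trans (by gcongr; exact hC _)
      _ = C * (‖m y‖ * ‖v y‖) := by ring

lemma integrable_mul_inner_gradient_mollifier (n : ℕ) (hm : LocallyIntegrable m)
    (x a : EuclideanSpace ℝ (Fin d)) :
    Integrable fun y => m y * ⟪gradient (mollifier n) (x - y), a⟫ := by
  refine ((integrable_gradient_mollify_integrand n hm x).inner_const a).congr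
    (Eventually.of_forall fun y => ?_)
  simp only [real_inner_smul_left]

lemma integral_mul_inner_gradient_mollifier (n : ℕ) (hm : LocallyIntegrable m)
    (x a : EuclideanSpace ℝ (Fin d)) :
    ∫ y, m y * ⟪gradient (mollifier n) (x - y), a⟫ = ⟪a, gradient (mollify n m) x⟫ := by
  rw [gradient_mollify n hm, ← integral_inner (integrable_gradient_mollify_integrand n hm x)]
  simp_rw [real_inner_smul_right, real_inner_comm a]

lemma commutator_eq_sub (n : ℕ) (hm : MemLp m 2 volume) (hv : MemLp v 2 volume)
    (x : EuclideanSpace ℝ (Fin d)) :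
    mollifierCommutator n m v x = (∫ y, m y * ⟪gradient (mollifier n) (x - y), v y⟫) -
      ⟪v x, gradient (mollify n m) x⟫ := by
  have hml := hm.locallyIntegrable one_le_two
  rw [mollifierCommutator, ← integral_mul_inner_gradient_mollifier n hml x,
    ← integral_sub (integrable_flux_integrand n hm hv x)
      (integrable_mul_inner_gradient_mollifier n hml x (v x))]
  simp_rw [inner_sub_right, mul_sub]

lemma aestronglyMeasurable_commutator (n : ℕ) (hm : MemLp m 2 volume) (hv : MemLp v 2 volume) :
    AEStronglyMeasurable (mollifierCommutator n m v) volume := by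
  have h : AEStronglyMeasurable (fun q : EuclideanSpace ℝ (Fin d) × EuclideanSpace ℝ (Fin d) =>
      m q.2 * ⟪gradient (mollifier n) (q.1 - q.2), v q.2 - v q.1⟫) (volume.prod volume) :=
    hm.1.comp_snd.mul ((((continuous_gradient_mollifier n).comp
      (by fun_prop)).aestronglyMeasurable).inner (hv.1.comp_snd.sub hv.1.comp_fst))
  exact h.integral_prod_right'

lemma commutator_sub (n : ℕ) (hm : MemLp m 2 volume) (hm' : MemLp m' 2 volume)
    (hv : MemLp v 2 volume) (x : EuclideanSpace ℝ (Fin d)) :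
    mollifierCommutator n (fun y => m y - m' y) v x = mollifierCommutator n m v x - mollifierCommutator n m' v x := by
  have hi : ∀ k : EuclideanSpace ℝ (Fin d) → ℝ, MemLp k 2 volume →
      Integrable fun y => k y * ⟪gradient (mollifier n) (x - y), v y - v x⟫ := by
    intro k hk
    refine ((integrable_flux_integrand n hk hv x).sub (integrable_mul_inner_gradient_mollifier n
      (hk.locallyIntegrable one_le_two) x (v x))).congr (Eventually.of_forall fun y => ?_)
    simp [inner_sub_right, mul_sub]
  simp only [mollifierCommutator, sub_mul]
  exact integral_sub (hi m hm) (hi m' hm')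

/-- The `L¹` norm of the gradient of the base mollifier. -/
def mollifierConst (d : ℕ) : ℝ :=
  ∫ z : EuclideanSpace ℝ (Fin d), ‖gradient (mollifierBase (EuclideanSpace ℝ (Fin d))) z‖

lemma mollifierConst_nonneg (d : ℕ) : 0 ≤ mollifierConst d := integral_nonneg fun _ => norm_nonneg _

/-- The commutator estimate. -/
lemma eLpNorm_commutator_le (n : ℕ) (hm : MemLp m 2 volume) (hv : MemLp v 2 volume) {M : ℝ≥0∞}
    (hM : ∀ z, eLpNorm (fun x => v (x - z) - v x) 2 volume ≤ M * ‖z‖ₑ) :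
    eLpNorm (mollifierCommutator n m v) 1 volume ≤
      ENNReal.ofReal (mollifierConst d) * M * eLpNorm m 2 volume := by
  have hn : (0 : ℝ) < (n : ℝ) + 1 := by positivity
  rw [eLpNorm_one_eq_lintegral_enorm]
  have hmeas : AEMeasurable (Function.uncurry fun x z : EuclideanSpace ℝ (Fin d) =>
      ‖gradient (mollifier n) z‖ₑ * (‖m (x - z)‖ₑ * ‖v (x - z) - v x‖ₑ))
      (volume.prod volume) := by
    have a1 := (continuous_gradient_mollifier (E := EuclideanSpace ℝ (Fin d))
      n).aestronglyMeasurable (μ := volume)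
    exact a1.comp_snd.enorm.mul ((aestronglyMeasurable_comp_sub hm.1).enorm.mul
      ((aestronglyMeasurable_comp_sub hv.1).sub hv.1.comp_fst).enorm)
  calc ∫⁻ x, ‖mollifierCommutator n m v x‖ₑ
      ≤ ∫⁻ x, ∫⁻ z, ‖gradient (mollifier n) z‖ₑ * (‖m (x - z)‖ₑ * ‖v (x - z) - v x‖ₑ) := by
        refine lintegral_mono fun x => ?_
        rw [commutator_eq_integral_sub]
        refine (enorm_integral_le_lintegral_enorm _).trans (lintegral_mono fun z => ?_)
        rw [enorm_mul, mul_left_comm]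
        gcongr
        simp only [enorm_eq_nnnorm]
        exact_mod_cast nnnorm_inner_le_nnnorm (𝕜 := ℝ) _ _
    _ = ∫⁻ z, ∫⁻ x, ‖gradient (mollifier n) z‖ₑ * (‖m (x - z)‖ₑ * ‖v (x - z) - v x‖ₑ) :=
        lintegral_lintegral_swap hmeas
    -- On the support of the mollifier gradient the increment of `v` is at most `M / (n + 1)` in
    -- `L²`. The `L¹` norm of that gradient grows like `n + 1`, so the final bound does not depend
    -- on `n`.
    _ ≤ ∫⁻ z, ‖gradient (mollifier n) z‖ₑ *
          (ENNReal.ofReal (1 / ((n : ℝ) + 1)) * (M * eLpNorm m 2 volume)) := by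
        refine lintegral_mono fun z => ?_
        rw [lintegral_const_mul' _ _ enorm_ne_top]
        by_cases hz : gradient (mollifier n) z = 0
        · simp [hz]
        have hz' : ‖z‖ ≤ 1 / ((n : ℝ) + 1) := by
          have := tsupport_mollifier_subset n (support_gradient_subset _ hz)
          rwa [mem_closedBall_zero_iff] at this
        gcongr
        have hmz := hm.comp_sub_right z
        have hvz := (hv.comp_sub_right z).sub hv
        have hh := eLpNorm_smul_le_mul_eLpNorm (p := 2) (q := 2) (r := 1) hvz.1 hmz.1
        rw [eLpNorm_one_eq_lintegral_enorm] at hh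
        simp only [Pi.smul_apply', enorm_smul, Pi.sub_apply] at hh
        refine hh.trans ?_
        rw [eLpNorm_comp_sub_right m 2 z hm.1]
        calc eLpNorm m 2 volume * eLpNorm (fun x => v (x - z) - v x) 2 volume
            ≤ eLpNorm m 2 volume * (M * ENNReal.ofReal (1 / ((n : ℝ) + 1))) := by
              gcongr
              refine (hM z).trans ?_
              gcongr
              rw [← ofReal_norm]
              exact ENNReal.ofReal_le_ofReal hz'
          _ = _ := by ring
    _ = ENNReal.ofReal (mollifierConst d) * M * eLpNorm m 2 volume := by
        rw [lintegral_mul_const _ (continuous_gradient_mollifier n).enorm.measurable]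
        have h1 : ∫⁻ z : EuclideanSpace ℝ (Fin d), ‖gradient (mollifier n) z‖ₑ =
            ENNReal.ofReal (((n : ℝ) + 1) * mollifierConst d) := by
          rw [mollifierConst, ← integral_norm_gradient_mollifier,
            ofReal_integral_norm_eq_lintegral_enorm (integrable_gradient_mollifier n)]
        rw [h1, ← mul_assoc, ← ENNReal.ofReal_mul (mul_nonneg hn.le (mollifierConst_nonneg d)),
          mul_assoc (ENNReal.ofReal (mollifierConst d))]
        congr 2
        field_simp

lemma gradient_mollifier_const_sub (n : ℕ) (x y : EuclideanSpace ℝ (Fin d)) :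
    gradient (fun y : EuclideanSpace ℝ (Fin d) => mollifier n (x - y)) y =
      -gradient (mollifier n) (x - y) := by
  simp only [gradient]
  have := ((contDiff_mollifier n).differentiable (by simp)).differentiableAt
    (x := x - y) |>.hasFDerivAt.comp y ((hasFDerivAt_id y).const_sub x)
  have e := this.fderiv
  change fderiv ℝ (fun y : EuclideanSpace ℝ (Fin d) => mollifier n (x - y)) y = _ at e
  rw [e]
  simp

/-- The commutator with a smooth density. -/
lemma commutator_eq_of_isTestFunction (n : ℕ) (hm : IsTestFunction m) (hv : MemLp v 2 volume)
    (hF : MemLp F 2 volume)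
    (hweak : ∀ ψ, IsTestFunction ψ → ∫ x, ⟪v x, gradient ψ x⟫ = ∫ x, F x * ψ x)
    (x : EuclideanSpace ℝ (Fin d)) :
    mollifierCommutator n m v x = mollify n (fun y => ⟪v y, gradient m y⟫ - F y * m y) x -
      ⟪v x, mollify n (gradient m) x⟫ := by
  rw [commutator_eq_sub n (hm.memLp volume 2) hv,
    gradient_mollify_of_contDiff n hm.contDiff_one hm.2]
  refine congrArg (· - ⟪v x, mollify n (gradient m) x⟫) ?_
  have hη : ContDiff ℝ (⊤ : ℕ∞) fun y : EuclideanSpace ℝ (Fin d) => mollifier n (x - y) :=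
    (contDiff_mollifier n).comp (contDiff_const.sub contDiff_id)
  -- The equation for `v` is tested with `m` times the mollifier centred at `x`. Its gradient splits
  -- into the flux term and a term free of derivatives of the mollifier.
  have hψ := hm.mul hη
  have h1 := hweak _ hψ
  have hg : ∀ y, ⟪v y, gradient (fun y => m y * mollifier n (x - y)) y⟫ =
      mollifier n (x - y) * ⟪v y, gradient m y⟫ -
        m y * ⟪gradient (mollifier n) (x - y), v y⟫ := by
    intro y
    rw [gradient_mul' (hm.differentiableAt y) (hη.differentiable (by simp) y), gradient_mollifier_const_sub,
      inner_add_right, real_inner_smul_right, real_inner_smul_right, inner_neg_right,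
      real_inner_comm (v y)]
    ring
  have i0 : Integrable fun y => ⟪v y, gradient m y⟫ :=
    hv.integrable_inner_two (hm.memLp_gradient volume 2)
  have i1 : Integrable fun y => mollifier n (x - y) * ⟪v y, gradient m y⟫ :=
    integrable_mollify_integrand n i0.locallyIntegrable x
  have i3 : Integrable fun y => F y * m y := by
    simpa [mul_comm] using hF.integrable_inner_two (hm.memLp volume 2)
  have i4 : Integrable fun y => mollifier n (x - y) * (F y * m y) :=
    integrable_mollify_integrand n i3.locallyIntegrable x
  simp_rw [hg] at h1
  rw [integral_sub i1 (integrable_flux_integrand n (hm.memLp volume 2) hv x)] at h1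
  simp only [mollify, smul_eq_mul, mul_sub]
  rw [integral_sub i1 i4]
  have : ∫ y, F y * (m y * mollifier n (x - y)) = ∫ y, mollifier n (x - y) * (F y * m y) := by
    congr 1; ext y; ring
  linarith

lemma eLpNorm_one_inner_le {α E : Type*} [MeasurableSpace α] [NormedAddCommGroup E]
    [InnerProductSpace ℝ E] {μ : Measure α} {a b : α → E} (ha : AEStronglyMeasurable a μ)
    (hb : AEStronglyMeasurable b μ) :
    eLpNorm (fun x => ⟪a x, b x⟫) 1 μ ≤ eLpNorm a 2 μ * eLpNorm b 2 μ := by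
  have := eLpNorm_le_eLpNorm_mul_eLpNorm_of_nnnorm (p := 2) (q := 2) (r := 1) ha hb
    (fun x y => ⟪x, y⟫) 1 (Eventually.of_forall fun x => by
      simpa using nnnorm_inner_le_nnnorm (𝕜 := ℝ) (a x) (b x))
  simpa using this

lemma eLpNorm_one_mul_le {α : Type*} [MeasurableSpace α] {μ : Measure α} {a b : α → ℝ}
    (ha : AEStronglyMeasurable a μ) (hb : AEStronglyMeasurable b μ) :
    eLpNorm (fun x => a x * b x) 1 μ ≤ eLpNorm a 2 μ * eLpNorm b 2 μ := by
  simpa [mul_comm] using eLpNorm_one_inner_le ha hb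

lemma tendsto_commutator_of_isTestFunction (hm : IsTestFunction m) (hv : MemLp v 2 volume)
    (hF : MemLp F 2 volume)
    (hweak : ∀ ψ, IsTestFunction ψ → ∫ x, ⟪v x, gradient ψ x⟫ = ∫ x, F x * ψ x) :
    Tendsto (fun n => eLpNorm (fun x => mollifierCommutator n m v x + F x * m x) 1 volume)
      atTop (𝓝 0) := by
  have hgm := hm.memLp_gradient volume 2
  obtain ⟨b, hb⟩ : ∃ b : EuclideanSpace ℝ (Fin d) → ℝ,
    b = fun y => ⟪v y, gradient m y⟫ - F y * m y := ⟨_, rfl⟩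
  have i0 : Integrable fun y => ⟪v y, gradient m y⟫ := hv.integrable_inner_two hgm
  have i3 : Integrable fun y => F y * m y := by
    simpa [mul_comm] using hF.integrable_inner_two (hm.memLp volume 2)
  have hbi : MemLp b 1 volume := by
    rw [hb]
    exact memLp_one_iff_integrable.2 (i0.sub i3)
  have t1 : Tendsto (fun n => eLpNorm (fun x => mollify n b x - b x) 1 volume) atTop (𝓝 0) :=
    tendsto_eLpNorm_mollify_sub le_rfl (by norm_num) hbi
  have t2 : Tendsto (fun n => eLpNorm (fun x => mollify n (gradient m) x - gradient m x) 2 volume)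
      atTop (𝓝 0) := tendsto_eLpNorm_mollify_sub one_le_two (by norm_num) hgm
  have t3 : Tendsto (fun n => eLpNorm v 2 volume *
      eLpNorm (fun x => mollify n (gradient m) x - gradient m x) 2 volume) atTop (𝓝 0) := by
    simpa using ENNReal.Tendsto.const_mul t2 (Or.inr hv.2.ne)
  have t4 : Tendsto (fun n => eLpNorm (fun x => mollify n b x - b x) 1 volume +
      eLpNorm v 2 volume * eLpNorm (fun x => mollify n (gradient m) x - gradient m x) 2 volume)
      atTop (𝓝 0) := by
    simpa using t1.add t3
  refine tendsto_of_tendsto_of_tendsto_of_le_of_le tendsto_const_nhds t4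
    (fun _ => zero_le) fun n => ?_
  have hmn : AEStronglyMeasurable (fun x => mollify n (gradient m) x - gradient m x) volume :=
    (memLp_mollify n one_le_two (by norm_num) hgm).1.sub hgm.1
  have hbn : AEStronglyMeasurable (fun x => mollify n b x - b x) volume :=
    (memLp_mollify n le_rfl (by norm_num) hbi).1.sub hbi.1
  have e : (fun x => mollifierCommutator n m v x + F x * m x) = (fun x => mollify n b x - b x) -
      (fun x => ⟪v x, mollify n (gradient m) x - gradient m x⟫) := by
    ext x
    rw [commutator_eq_of_isTestFunction n hm hv hF hweak, ← hb]
    simp only [Pi.sub_apply, inner_sub_right]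
    have : b x = ⟪v x, gradient m x⟫ - F x * m x := by rw [hb]
    linarith
  rw [e]
  exact (eLpNorm_sub_le hbn (hv.1.inner hmn) le_rfl).trans
    (add_le_add le_rfl (eLpNorm_one_inner_le hv.1 hmn))

/-- Convergence of the commutator. -/
theorem tendsto_commutator (hm : MemLp m 2 volume) (hv : MemLp v 2 volume)
    (hF : MemLp F 2 volume)
    (hweak : ∀ ψ, IsTestFunction ψ → ∫ x, ⟪v x, gradient ψ x⟫ = ∫ x, F x * ψ x) {M : ℝ≥0∞}
    (hMtop : M ≠ ⊤) (hM : ∀ z, eLpNorm (fun x => v (x - z) - v x) 2 volume ≤ M * ‖z‖ₑ) :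
    Tendsto (fun n => eLpNorm (fun x => mollifierCommutator n m v x + F x * m x) 1 volume)
      atTop (𝓝 0) := by
  rw [ENNReal.tendsto_nhds_zero]
  intro ε hε
  -- The expected limit is `m div v = -F m`. The constant `K` bounds the map sending `m` to
  -- commutator plus `F m`, from `L²` to `L¹` and uniformly in `n`, so it is enough to treat test
  -- functions and approximate `m` by them.
  set K := ENNReal.ofReal (mollifierConst d) * M + eLpNorm F 2 volume with hK
  have hKtop : K ≠ ⊤ := ENNReal.add_ne_top.2 ⟨ENNReal.mul_ne_top ENNReal.ofReal_ne_top hMtop, hF.2.ne⟩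
  obtain ⟨δ, hδ0, hδ⟩ : ∃ δ : ℝ, 0 < δ ∧ K * ENNReal.ofReal δ ≤ ε / 2 := by
    have h1 : Tendsto (fun δ : ℝ => K * ENNReal.ofReal δ) (𝓝[>] 0) (𝓝 0) := by
      have := (ENNReal.continuous_ofReal.tendsto (0 : ℝ)).mono_left
        (nhdsWithin_le_nhds (s := Ioi (0 : ℝ)))
      rw [ENNReal.ofReal_zero] at this
      simpa using ENNReal.Tendsto.const_mul this (Or.inr hKtop)
    obtain ⟨δ, h2, h3⟩ := ((ENNReal.tendsto_nhds_zero.1 h1 (ε / 2)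
      (ENNReal.half_pos hε.ne')).and self_mem_nhdsWithin).exists
    exact ⟨δ, h3, h2⟩
  obtain ⟨m', hm'c, hm's, hm'⟩ := hm.exist_eLpNorm_sub_le (by norm_num) one_le_two hδ0
  have htest : IsTestFunction m' := ⟨hm's, hm'c⟩
  have hm'2 := htest.memLp volume 2
  filter_upwards [ENNReal.tendsto_nhds_zero.1 (tendsto_commutator_of_isTestFunction htest hv hF
    hweak) (ε / 2) (ENNReal.half_pos hε.ne')] with n hn
  have hsub : MemLp (fun x => m x - m' x) 2 volume := hm.sub hm'2
  have e : (fun x => mollifierCommutator n m v x + F x * m x) =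
      (fun x => mollifierCommutator n m' v x + F x * m' x) +
        (mollifierCommutator n (fun y => m y - m' y) v + fun x => F x * (m x - m' x)) := by
    ext x
    simp only [Pi.add_apply]
    rw [commutator_sub n hm hm'2 hv]
    ring
  have a1 := aestronglyMeasurable_commutator n hm'2 hv
  have a2 := aestronglyMeasurable_commutator n hsub hv
  rw [e]
  calc _ ≤ eLpNorm (fun x => mollifierCommutator n m' v x + F x * m' x) 1 volume +
        eLpNorm (mollifierCommutator n (fun y => m y - m' y) v + fun x => F x * (m x - m' x)) 1 volume :=
        eLpNorm_add_le (a1.add (hF.1.mul hm'2.1)) (a2.add (hF.1.mul hsub.1)) le_rfl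
    _ ≤ ε / 2 + K * ENNReal.ofReal δ := by
        gcongr
        refine (eLpNorm_add_le a2 (hF.1.mul hsub.1) le_rfl).trans ?_
        rw [hK, add_mul]
        gcongr
        · exact (eLpNorm_commutator_le n hsub hv hM).trans (by gcongr; exact hm')
        · exact (eLpNorm_one_mul_le hF.1 hsub.1).trans (by gcongr; exact hm')
    _ ≤ ε / 2 + ε / 2 := by gcongr
    _ = ε := ENNReal.add_halves ε

end Commutator

/-! ### Localisation: from the weighted equation to Lebesgue measure -/

section Localisation

variable {d : ℕ} {V : EuclideanSpace ℝ (Fin d) → ℝ}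

lemma hasWeakGradient_volume_of_contDiff {f : EuclideanSpace ℝ (Fin d) → ℝ}
    (hf : ContDiff ℝ 1 f) (hc : HasCompactSupport f) : HasWeakGradient volume f (gradient f) := by
  have h1 : MemLp f 2 volume := hf.continuous.memLp_of_hasCompactSupport hc
  have h2 : MemLp (gradient f) 2 volume :=
    (continuous_gradient hf).memLp_of_hasCompactSupport hc.gradient
  refine ⟨h1, h2, fun n => mollify n f,
    fun n => ⟨contDiff_mollify n hf.continuous.locallyIntegrable, hasCompactSupport_mollify n hc⟩,
    tendsto_eLpNorm_mollify_sub one_le_two (by norm_num) h1, ?_⟩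
  have t := tendsto_eLpNorm_mollify_sub one_le_two (by norm_num) h2
  refine t.congr fun n => ?_
  congr 1
  ext1 x
  rw [gradient_mollify_of_contDiff n hf hc]

lemma HasWeakGradient.integral_inner_eq {v : EuclideanSpace ℝ (Fin d) → EuclideanSpace ℝ (Fin d)}
    {F k : EuclideanSpace ℝ (Fin d) → ℝ} {K : EuclideanSpace ℝ (Fin d) → EuclideanSpace ℝ (Fin d)}
    {μ : Measure (EuclideanSpace ℝ (Fin d))} [IsFiniteMeasureOnCompacts μ]
    (hk : HasWeakGradient μ k K) (hv : MemLp v 2 μ) (hF : MemLp F 2 μ)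
    (hweak : ∀ ψ, IsTestFunction ψ → ∫ x, ⟪v x, gradient ψ x⟫ ∂μ = ∫ x, F x * ψ x ∂μ) :
    ∫ x, ⟪v x, K x⟫ ∂μ = ∫ x, F x * k x ∂μ := by
  have := hk.integral_add_integral_eq_zero (a := fun x => -F x) (A := v) hF.neg hv
    (fun ψ hψ => by rw [hweak ψ hψ]; simp [integral_neg])
  simp only [neg_mul, integral_neg] at this
  linarith

/-- The density of the target is continuous and positive, so `θ / √p` is bounded on the compact
support of `θ`. Its bound compares the two `L²` norms, with a constant independent of the function
measured. -/
lemma exists_eLpNorm_volume_le (hV : ContDiff ℝ 1 V)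
    (hint : Integrable (fun x => Real.exp (-V x)) volume) {θ : EuclideanSpace ℝ (Fin d) → ℝ}
    (hθ : Continuous θ) (hc : HasCompactSupport θ) :
    ∃ C : ℝ≥0, ∀ {F F' : Type} [NormedAddCommGroup F] [NormedAddCommGroup F']
      (f : EuclideanSpace ℝ (Fin d) → F) (h : EuclideanSpace ℝ (Fin d) → F'),
      (∀ x, ‖h x‖ ≤ ‖θ x‖ * ‖f x‖) → eLpNorm h 2 volume ≤ C * eLpNorm f 2 (target V) := by
  have hp := (contDiff_targetDensity hV).continuous
  have hpos := targetDensity_pos hint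
  have hcont : Continuous fun x => θ x / √(targetDensity V x) :=
    hθ.div hp.sqrt fun x => (Real.sqrt_pos.2 (hpos x)).ne'
  obtain ⟨c, hcb⟩ := hcont.bounded_above_of_compact_support (hc.mul_right)
  have hc0 : 0 ≤ c := (norm_nonneg _).trans (hcb 0)
  refine ⟨c.toNNReal, fun f h hle => ?_⟩
  rw [← ENNReal.pow_le_pow_left_iff (two_ne_zero), mul_pow, eLpNorm_two_sq, eLpNorm_two_sq,
    lintegral_target, ← lintegral_const_mul' _ _ (by finiteness)]
  refine lintegral_mono fun x => ?_
  have h1 : ‖h x‖ ^ 2 ≤ c ^ 2 * (targetDensity V x * ‖f x‖ ^ 2) := by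
    have hs := Real.sqrt_pos.2 (hpos x)
    have h2 := hcb x
    rw [norm_div, Real.norm_of_nonneg hs.le, div_le_iff₀ hs] at h2
    calc ‖h x‖ ^ 2 ≤ ((c * √(targetDensity V x)) * ‖f x‖) ^ 2 := by
          gcongr
          exact (hle x).trans (by gcongr)
      _ = _ := by rw [mul_pow, mul_pow, Real.sq_sqrt (hpos x).le]; ring
  have h3 := ENNReal.ofReal_le_ofReal h1
  rw [ENNReal.ofReal_mul (by positivity), ENNReal.ofReal_mul (hpos x).le,
    ENNReal.ofReal_pow (norm_nonneg _), ENNReal.ofReal_pow (norm_nonneg _), ENNReal.ofReal_pow hc0,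
    ofReal_norm, ofReal_norm] at h3
  exact h3

lemma memLp_volume_of_norm_le (hV : ContDiff ℝ 1 V)
    (hint : Integrable (fun x => Real.exp (-V x)) volume) {θ : EuclideanSpace ℝ (Fin d) → ℝ}
    (hθ : Continuous θ) (hc : HasCompactSupport θ) {F F' : Type} [NormedAddCommGroup F]
    [NormedAddCommGroup F'] {f : EuclideanSpace ℝ (Fin d) → F} {h : EuclideanSpace ℝ (Fin d) → F'}
    (hf : MemLp f 2 (target V)) (hm : AEStronglyMeasurable h volume)
    (hle : ∀ x, ‖h x‖ ≤ ‖θ x‖ * ‖f x‖) : MemLp h 2 volume := by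
  obtain ⟨C, hC⟩ := exists_eLpNorm_volume_le hV hint hθ hc
  exact ⟨hm, (hC f h hle).trans_lt (ENNReal.mul_lt_top ENNReal.coe_lt_top hf.2)⟩

lemma aestronglyMeasurable_volume_of_target (hint : Integrable (fun x => Real.exp (-V x)) volume)
    {F : Type*} [TopologicalSpace F] {f : EuclideanSpace ℝ (Fin d) → F}
    (hf : AEStronglyMeasurable f (target V)) : AEStronglyMeasurable f volume :=
  hf.mono_ac (absolutelyContinuous_target hint)

/-- The gradient of `χ u`, where `v` is the gradient of `u`. -/
def localGradient (χ u : EuclideanSpace ℝ (Fin d) → ℝ)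
    (v : EuclideanSpace ℝ (Fin d) → EuclideanSpace ℝ (Fin d)) (x : EuclideanSpace ℝ (Fin d)) :
    EuclideanSpace ℝ (Fin d) := χ x • v x + u x • gradient χ x

/-- Minus the Laplacian of `χ u`, where `v` is the gradient of `u` and `g` the image of `u` under
the Langevin generator. -/
def localSource (V χ u : EuclideanSpace ℝ (Fin d) → ℝ)
    (v : EuclideanSpace ℝ (Fin d) → EuclideanSpace ℝ (Fin d)) (g : EuclideanSpace ℝ (Fin d) → ℝ)
    (x : EuclideanSpace ℝ (Fin d)) : ℝ :=
  (χ x * g x - ⟪v x, χ x • gradient V x + (2 : ℝ) • gradient χ x⟫) -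
    u x * Laplacian.laplacian χ x

variable {χ u g : EuclideanSpace ℝ (Fin d) → ℝ}
  {v : EuclideanSpace ℝ (Fin d) → EuclideanSpace ℝ (Fin d)}

/-- The constant depends only on the cutoff and `V`. It serves both for approximating sequences and
for time slices of the flow, where uniformity is essential. -/
lemma exists_eLpNorm_localGradient_le (hV : ContDiff ℝ 1 V)
    (hint : Integrable (fun x => Real.exp (-V x)) volume) (hχ : IsTestFunction χ) :
    ∃ C : ℝ≥0, ∀ u v, MemLp u 2 (target V) → MemLp v 2 (target V) →
      eLpNorm (localGradient χ u v) 2 volume ≤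
        C * (eLpNorm u 2 (target V) + eLpNorm v 2 (target V)) := by
  obtain ⟨C₁, h₁⟩ := exists_eLpNorm_volume_le hV hint hχ.1.continuous hχ.2
  obtain ⟨C₂, h₂⟩ := exists_eLpNorm_volume_le hV hint hχ.continuous_gradient.norm hχ.2.gradient.norm
  refine ⟨C₁ + C₂, fun u v hu hv => ?_⟩
  have mu := aestronglyMeasurable_volume_of_target hint hu.1
  have mv := aestronglyMeasurable_volume_of_target hint hv.1
  have := eLpNorm_add_le (hχ.1.continuous.aestronglyMeasurable.smul mv)
    (mu.smul hχ.continuous_gradient.aestronglyMeasurable) one_le_two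
  refine this.trans ((add_le_add (h₁ v (fun x => χ x • v x) fun x => by rw [norm_smul])
    (h₂ u (fun x => u x • gradient χ x) fun x => by rw [norm_smul, norm_norm, mul_comm])).trans ?_)
  push_cast
  rw [mul_add, add_mul, add_mul, add_comm]
  gcongr
  · exact le_add_self
  · exact le_self_add

lemma memLp_localGradient (hV : ContDiff ℝ 1 V)
    (hint : Integrable (fun x => Real.exp (-V x)) volume) (hχ : IsTestFunction χ)
    (hu : MemLp u 2 (target V)) (hv : MemLp v 2 (target V)) :
    MemLp (localGradient χ u v) 2 volume := by
  obtain ⟨C, hC⟩ := exists_eLpNorm_localGradient_le hV hint hχ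
  have mu := aestronglyMeasurable_volume_of_target hint hu.1
  have mv := aestronglyMeasurable_volume_of_target hint hv.1
  exact ⟨(hχ.1.continuous.aestronglyMeasurable.smul mv).add
    (mu.smul hχ.continuous_gradient.aestronglyMeasurable), (hC u v hu hv).trans_lt
    (ENNReal.mul_lt_top ENNReal.coe_lt_top (ENNReal.add_lt_top.2 ⟨hu.2, hv.2⟩))⟩

lemma memLp_mul_volume (hV : ContDiff ℝ 1 V)
    (hint : Integrable (fun x => Real.exp (-V x)) volume) {θ : EuclideanSpace ℝ (Fin d) → ℝ}
    (hθ : Continuous θ) (hc : HasCompactSupport θ) (hu : MemLp u 2 (target V)) :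
    MemLp (fun x => θ x * u x) 2 volume :=
  memLp_volume_of_norm_le hV hint hθ hc hu (hθ.aestronglyMeasurable.mul
    (aestronglyMeasurable_volume_of_target hint hu.1)) fun x => by rw [norm_mul]

lemma continuous_localDrift (hV : ContDiff ℝ 1 V) (hχ : IsTestFunction χ) :
    Continuous fun x => χ x • gradient V x + (2 : ℝ) • gradient χ x :=
  (hχ.1.continuous.smul (continuous_gradient hV)).add (hχ.continuous_gradient.const_smul (2 : ℝ) : Continuous fun x => (2 : ℝ) • gradient χ x)

lemma hasCompactSupport_localDrift (hχ : IsTestFunction χ) :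
    HasCompactSupport fun x => χ x • gradient V x + (2 : ℝ) • gradient χ x :=
  (hχ.2.smul_right (f' := gradient V)).add (hχ.2.gradient.smul_left (f := fun _ => (2 : ℝ)))

lemma exists_eLpNorm_localSource_le (hV : ContDiff ℝ 1 V)
    (hint : Integrable (fun x => Real.exp (-V x)) volume) (hχ : IsTestFunction χ) :
    ∃ C : ℝ≥0, ∀ u v g, MemLp u 2 (target V) → MemLp v 2 (target V) → MemLp g 2 (target V) →
      MemLp (localSource V χ u v g) 2 volume ∧ eLpNorm (localSource V χ u v g) 2 volume ≤
        C * (eLpNorm u 2 (target V) + eLpNorm v 2 (target V) + eLpNorm g 2 (target V)) := by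
  have hD := continuous_localDrift hV hχ
  have hDc := hasCompactSupport_localDrift (V := V) hχ
  have hL := continuous_laplacian hχ.contDiff_two
  obtain ⟨C₁, h₁⟩ := exists_eLpNorm_volume_le hV hint hχ.1.continuous hχ.2
  obtain ⟨C₂, h₂⟩ := exists_eLpNorm_volume_le hV hint hD.norm hDc.norm
  obtain ⟨C₃, h₃⟩ := exists_eLpNorm_volume_le hV hint hL hχ.2.laplacian
  refine ⟨C₁ + C₂ + C₃, fun u v g hu hv hg => ?_⟩
  have mu := aestronglyMeasurable_volume_of_target hint hu.1
  have mv := aestronglyMeasurable_volume_of_target hint hv.1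
  have mg := aestronglyMeasurable_volume_of_target hint hg.1
  have m1 := hχ.1.continuous.aestronglyMeasurable.mul mg
  have m2 := mv.inner (𝕜 := ℝ) hD.aestronglyMeasurable
  have m3 := mu.mul hL.aestronglyMeasurable (μ := volume)
  have b : eLpNorm (localSource V χ u v g) 2 volume ≤
      (C₁ + C₂ + C₃ : ℝ≥0) *
        (eLpNorm u 2 (target V) + eLpNorm v 2 (target V) + eLpNorm g 2 (target V)) := by
    refine (eLpNorm_sub_le (m1.sub m2) m3 one_le_two).trans
      ((add_le_add_left (eLpNorm_sub_le m1 m2 one_le_two) _).trans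
      ((add_le_add (add_le_add (h₁ g (fun x => χ x * g x) fun x => by rw [norm_mul])
      (h₂ v (fun x => ⟪v x, χ x • gradient V x + (2 : ℝ) • gradient χ x⟫) fun x => by
        rw [norm_norm, mul_comm]; exact norm_inner_le_norm _ _))
      (h₃ u (fun x => u x * Laplacian.laplacian χ x) fun x => by rw [norm_mul, mul_comm])).trans ?_))
    push_cast
    set a := eLpNorm u 2 (target V)
    set b := eLpNorm v 2 (target V)
    set c := eLpNorm g 2 (target V)
    calc (C₁ : ℝ≥0∞) * c + C₂ * b + C₃ * a
        ≤ (C₁ * c + C₂ * b + C₃ * a) +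
          (C₁ * a + C₁ * b + C₂ * a + C₂ * c + C₃ * b + C₃ * c) := le_self_add
      _ = _ := by ring
  exact ⟨⟨(m1.sub m2).sub m3, b.trans_lt (ENNReal.mul_lt_top ENNReal.coe_lt_top
    (ENNReal.add_lt_top.2 ⟨ENNReal.add_lt_top.2 ⟨hu.2, hv.2⟩, hg.2⟩))⟩, b⟩

section

variable [IsProbabilityMeasure (target V)]

lemma HasWeakGradient.localize (hV : ContDiff ℝ 1 V)
    (hint : Integrable (fun x => Real.exp (-V x)) volume) (hχ : IsTestFunction χ)
    (h : HasWeakGradient (target V) u v) :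
    HasWeakGradient volume (fun x => χ x * u x) (localGradient χ u v) := by
  obtain ⟨hu, hv, ψ, hψ, h3, h4⟩ := h
  obtain ⟨C₁, h₁⟩ := exists_eLpNorm_volume_le hV hint hχ.1.continuous hχ.2
  obtain ⟨C, hC⟩ := exists_eLpNorm_localGradient_le hV hint hχ
  refine ⟨memLp_mul_volume hV hint hχ.1.continuous hχ.2 hu,
    memLp_localGradient hV hint hχ hu hv, fun n x => χ x * ψ n x, fun n => hχ.mul (hψ n).1, ?_, ?_⟩
  · have t : Tendsto (fun n => (C₁ : ℝ≥0∞) * eLpNorm (fun x => ψ n x - u x) 2 (target V)) atTop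
        (𝓝 0) := by
      simpa using ENNReal.Tendsto.const_mul h3 (Or.inr ENNReal.coe_ne_top)
    exact tendsto_of_tendsto_of_tendsto_of_le_of_le tendsto_const_nhds t (fun _ => zero_le)
      fun n => h₁ _ _ fun x => by rw [← mul_sub, norm_mul]
  · have t : Tendsto (fun n => (C : ℝ≥0∞) * (eLpNorm (fun x => ψ n x - u x) 2 (target V) +
        eLpNorm (fun x => gradient (ψ n) x - v x) 2 (target V))) atTop (𝓝 0) := by
      simpa using ENNReal.Tendsto.const_mul (h3.add h4) (Or.inr (ENNReal.coe_ne_top (r := C)))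
    refine tendsto_of_tendsto_of_tendsto_of_le_of_le tendsto_const_nhds t (fun _ => zero_le)
      fun n => ?_
    refine le_trans (le_of_eq ?_) (hC (fun x => ψ n x - u x) (fun x => gradient (ψ n) x - v x)
      (((hψ n).memLp _ 2).sub hu) (((hψ n).memLp_gradient _ 2).sub hv))
    congr 1
    ext1 x
    rw [gradient_mul' (hχ.differentiableAt x) ((hψ n).differentiableAt x)]
    simp only [localGradient, smul_sub, sub_smul]
    abel

lemma integral_mul_inner_gradient_eq {ξ ψ : EuclideanSpace ℝ (Fin d) → ℝ} (hχ : IsTestFunction χ)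
    (hξ : IsTestFunction ξ) (hψ : IsTestFunction ψ) :
    (∫ x, ξ x * ⟪gradient χ x, gradient ψ x⟫) + ∫ x, ψ x * ⟪gradient χ x, gradient ξ x⟫ =
      -∫ x, ξ x * ψ x * Laplacian.laplacian χ x := by
  have green := integral_inner_gradient_eq_neg_integral_mul_laplacian
    (f := fun x => ξ x * ψ x) (hξ.contDiff_one.mul hψ.contDiff_one) hχ.contDiff_two hχ.2
  have e1 : ∀ x, ⟪gradient (fun x => ξ x * ψ x) x, gradient χ x⟫ =
      ξ x * ⟪gradient χ x, gradient ψ x⟫ + ψ x * ⟪gradient χ x, gradient ξ x⟫ := by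
    intro x
    rw [gradient_mul' (hξ.differentiableAt x) (hψ.differentiableAt x), inner_add_left,
      real_inner_smul_left, real_inner_smul_left, real_inner_comm,
      real_inner_comm (gradient χ x) (gradient ξ x)]
  simp_rw [e1] at green
  have i1 : Integrable fun x => ξ x * ⟪gradient χ x, gradient ψ x⟫ :=
    (hξ.1.continuous.mul (hχ.continuous_gradient.inner
      hψ.continuous_gradient)).integrable_of_hasCompactSupport hξ.2.mul_right
  have i2 : Integrable fun x => ψ x * ⟪gradient χ x, gradient ξ x⟫ :=
    (hψ.1.continuous.mul (hχ.continuous_gradient.inner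
      hξ.continuous_gradient)).integrable_of_hasCompactSupport hψ.2.mul_right
  rwa [integral_add i1 i2] at green

/-- Integration by parts of `u` against the field `ψ ∇χ`, whose divergence is the bracket. Dividing
by the density turns the Lebesgue integrals into `π`-integrals, to which density of test functions
in `H¹(π)` applies. -/
lemma HasWeakGradient.integral_mul_inner_gradient (hV : ContDiff ℝ 1 V)
    (hint : Integrable (fun x => Real.exp (-V x)) volume) (hχ : IsTestFunction χ)
    (h : HasWeakGradient (target V) u v) {ψ : EuclideanSpace ℝ (Fin d) → ℝ}
    (hψ : IsTestFunction ψ) :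
    (∫ x, u x * (⟪gradient χ x, gradient ψ x⟫ + Laplacian.laplacian χ x * ψ x)) +
      ∫ x, ψ x * ⟪gradient χ x, v x⟫ = 0 := by
  have hp := (contDiff_targetDensity hV).continuous
  have hpos := targetDensity_pos hint
  have hL := continuous_laplacian hχ.contDiff_two
  have ca : Continuous fun x =>
      (⟪gradient χ x, gradient ψ x⟫ + Laplacian.laplacian χ x * ψ x) / targetDensity V x :=
    ((hχ.continuous_gradient.inner hψ.continuous_gradient).add (hL.mul hψ.1.continuous)).div hp
      fun x => (hpos x).ne'
  have cA : Continuous fun x => (ψ x / targetDensity V x) • gradient χ x :=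
    (hψ.1.continuous.div hp fun x => (hpos x).ne').smul hχ.continuous_gradient
  have sa : HasCompactSupport fun x =>
      (⟪gradient χ x, gradient ψ x⟫ + Laplacian.laplacian χ x * ψ x) / targetDensity V x := by
    refine HasCompactSupport.mono' hψ.2 fun x hx => ?_
    by_contra hx'
    have h2 : gradient ψ x = 0 := by
      by_contra h
      exact hx' (support_gradient_subset ψ h)
    have h3 : ψ x = 0 := image_eq_zero_of_notMem_tsupport hx'
    rw [Function.mem_support] at hx
    exact hx (by rw [h2, h3, inner_zero_right, mul_zero, add_zero, zero_div])
  have sA : HasCompactSupport fun x => (ψ x / targetDensity V x) • gradient χ x :=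
    hχ.2.gradient.smul_left (f := fun x => ψ x / targetDensity V x)
  have htest : ∀ ξ, IsTestFunction ξ → ∫ x, (⟪gradient χ x, gradient ψ x⟫ +
      Laplacian.laplacian χ x * ψ x) / targetDensity V x * ξ x ∂(target V) +
      ∫ x, ⟪(ψ x / targetDensity V x) • gradient χ x, gradient ξ x⟫ ∂(target V) = 0 := by
    intro ξ hξ
    rw [integral_target, integral_target]
    have green := integral_mul_inner_gradient_eq hχ hξ hψ
    have i1 : Integrable fun x => ξ x * ⟪gradient χ x, gradient ψ x⟫ :=
      (hξ.1.continuous.mul (hχ.continuous_gradient.inner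
        hψ.continuous_gradient)).integrable_of_hasCompactSupport hξ.2.mul_right
    have i3 : Integrable fun x => ξ x * ψ x * Laplacian.laplacian χ x :=
      ((hξ.1.continuous.mul hψ.1.continuous).mul hL).integrable_of_hasCompactSupport
        hξ.2.mul_right.mul_right
    have e2 : ∫ x, targetDensity V x • ((⟪gradient χ x, gradient ψ x⟫ +
        Laplacian.laplacian χ x * ψ x) / targetDensity V x * ξ x) =
        (∫ x, ξ x * ⟪gradient χ x, gradient ψ x⟫) + ∫ x, ξ x * ψ x * Laplacian.laplacian χ x := by
      rw [← integral_add i1 i3]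
      congr 1
      ext x
      simp only [smul_eq_mul]
      field_simp [(hpos x).ne']
    have e3 : ∫ x, targetDensity V x • ⟪(ψ x / targetDensity V x) • gradient χ x, gradient ξ x⟫ =
        ∫ x, ψ x * ⟪gradient χ x, gradient ξ x⟫ := by
      congr 1
      ext x
      simp only [smul_eq_mul, real_inner_smul_left]
      field_simp [(hpos x).ne']
    rw [e2, e3]
    linarith
  have key := h.integral_add_integral_eq_zero (ca.memLp_of_hasCompactSupport sa)
    (cA.memLp_of_hasCompactSupport sA) htest
  rw [integral_target, integral_target] at key
  rw [← key]
  congr 2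
  · ext x
    simp only [smul_eq_mul]
    field_simp [(hpos x).ne']
  · ext x
    simp only [smul_eq_mul, real_inner_smul_left]
    field_simp [(hpos x).ne']

/-- The localised equation. -/
theorem integral_inner_localGradient (hV : ContDiff ℝ 1 V)
    (hint : Integrable (fun x => Real.exp (-V x)) volume) (hχ : IsTestFunction χ)
    (h : HasWeakGradient (target V) u v) (hg : MemLp g 2 (target V))
    (hweak : ∀ ψ, IsTestFunction ψ →
      ∫ x, ⟪v x, gradient ψ x⟫ ∂(target V) = ∫ x, g x * ψ x ∂(target V))
    {ψ : EuclideanSpace ℝ (Fin d) → ℝ} (hψ : IsTestFunction ψ) :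
    ∫ x, ⟪localGradient χ u v x, gradient ψ x⟫ = ∫ x, localSource V χ u v g x * ψ x := by
  have hp := contDiff_targetDensity hV
  have hpos := targetDensity_pos hint
  have hL := continuous_laplacian hχ.contDiff_two
  have mu := aestronglyMeasurable_volume_of_target hint h.1.1
  have mv := aestronglyMeasurable_volume_of_target hint h.2.1.1
  -- Testing with `χ ψ / p` removes the weight: `p ∇k = χ ∇ψ + ψ (χ ∇V + ∇χ)`. This function is only
  -- `C¹`.
  obtain ⟨k, hk⟩ : ∃ k : EuclideanSpace ℝ (Fin d) → ℝ,
    k = fun x => χ x * (ψ x / targetDensity V x) := ⟨_, rfl⟩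
  have hψp : ContDiff ℝ 1 fun x => ψ x / targetDensity V x :=
    hψ.contDiff_one.div hp fun x => (hpos x).ne'
  have hk1 : ContDiff ℝ 1 k := hk ▸ hχ.contDiff_one.mul hψp
  have hkc : HasCompactSupport k := hk ▸ hχ.2.mul_right
  have hgp : ∀ x, gradient (fun x => ψ x / targetDensity V x) x =
      (targetDensity V x)⁻¹ • gradient ψ x + (ψ x / targetDensity V x) • gradient V x := by
    intro x
    have h1 : gradient ψ x = gradient (fun x => (ψ x / targetDensity V x) * targetDensity V x) x := by
      congr 1
      ext y
      field_simp [(hpos y).ne']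
    rw [gradient_mul' (hψp.differentiable one_ne_zero x) (hp.differentiable one_ne_zero x),
      gradient_targetDensity hV] at h1
    rw [h1, smul_add, smul_neg, smul_neg, smul_smul, smul_smul, smul_smul,
      inv_mul_cancel₀ (hpos x).ne', one_smul]
    have : (targetDensity V x)⁻¹ * (ψ x / targetDensity V x) * targetDensity V x =
      ψ x / targetDensity V x := by field_simp [(hpos x).ne']
    rw [this]
    abel
  have hgk : ∀ x, targetDensity V x • gradient k x =
      χ x • gradient ψ x + ψ x • (χ x • gradient V x + gradient χ x) := by
    intro x
    rw [hk, gradient_mul' (hχ.differentiableAt x) (hψp.differentiable one_ne_zero x), hgp]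
    simp only [smul_add, smul_smul]
    have e1 : targetDensity V x * (χ x * (targetDensity V x)⁻¹) = χ x := by
      field_simp [(hpos x).ne']
    have e2 : targetDensity V x * (χ x * (ψ x / targetDensity V x)) = ψ x * χ x := by
      field_simp [(hpos x).ne']
    have e3 : targetDensity V x * (ψ x / targetDensity V x) = ψ x := by
      field_simp [(hpos x).ne']
    rw [e1, e2, e3]
    abel
  have key := (hasWeakGradient_of_contDiff hk1 hkc (μ := target V)).integral_inner_eq h.2.1 hg hweak
  rw [integral_target, integral_target] at key
  have key1 : ∫ x, ⟪v x, χ x • gradient ψ x + ψ x • (χ x • gradient V x + gradient χ x)⟫ =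
      ∫ x, ψ x * (χ x * g x) := by
    convert key using 2
    · ext x
      rw [smul_eq_mul, ← real_inner_smul_right, hgk]
    · ext x
      rw [hk, smul_eq_mul]
      field_simp [(hpos x).ne']
  have key2 := h.integral_mul_inner_gradient hV hint hχ hψ
  have hψ2 := hψ.memLp volume 2
  have hψg := hψ.memLp_gradient volume 2
  have l1 : MemLp (fun x => χ x • v x) 2 volume :=
    memLp_volume_of_norm_le hV hint hχ.1.continuous hχ.2 h.2.1
      (hχ.1.continuous.aestronglyMeasurable.smul mv) fun x => by rw [norm_smul]
  have i1 : Integrable fun x => ⟪v x, χ x • gradient ψ x⟫ := by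
    refine (l1.integrable_inner_two hψg).congr (Eventually.of_forall fun x => ?_)
    simp only [real_inner_smul_left, real_inner_smul_right]
  have l2 : MemLp (fun x => ψ x * ⟪v x, χ x • gradient V x⟫) 1 volume := by
    have c1 : Continuous fun x => χ x • gradient V x :=
      hχ.1.continuous.smul (continuous_gradient hV)
    have := memLp_volume_of_norm_le hV hint c1.norm (hχ.2.smul_right (f' := gradient V)).norm
      (h := fun x => ⟪v x, χ x • gradient V x⟫) h.2.1 (mv.inner c1.aestronglyMeasurable)
      fun x => by rw [norm_norm, mul_comm]; exact norm_inner_le_norm _ _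
    refine memLp_one_iff_integrable.2 ?_
    simpa [mul_comm] using hψ2.integrable_inner_two this
  have l3 : MemLp (fun x => ⟪gradient χ x, v x⟫) 2 volume :=
    memLp_volume_of_norm_le hV hint hχ.continuous_gradient.norm hχ.2.gradient.norm h.2.1
      (hχ.continuous_gradient.aestronglyMeasurable.inner mv)
      fun x => by rw [norm_norm]; exact norm_inner_le_norm _ _
  have i3 : Integrable fun x => ψ x * ⟪gradient χ x, v x⟫ := by
    simpa [mul_comm] using hψ2.integrable_inner_two l3
  have l4 : MemLp (fun x => u x • gradient χ x) 2 volume :=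
    memLp_volume_of_norm_le hV hint hχ.continuous_gradient.norm hχ.2.gradient.norm h.1
      (mu.smul hχ.continuous_gradient.aestronglyMeasurable)
      fun x => by rw [norm_smul, norm_norm, mul_comm]
  have i4 : Integrable fun x => ⟪u x • gradient χ x, gradient ψ x⟫ := l4.integrable_inner_two hψg
  have l5 : MemLp (fun x => Laplacian.laplacian χ x * u x) 2 volume :=
    memLp_mul_volume hV hint hL hχ.2.laplacian h.1
  have i5 : Integrable fun x => Laplacian.laplacian χ x * u x * ψ x := by
    simpa [mul_comm] using l5.integrable_inner_two hψ2
  have l6 : MemLp (fun x => χ x * g x) 2 volume :=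
    memLp_mul_volume hV hint hχ.1.continuous hχ.2 hg
  have i6 : Integrable fun x => ψ x * (χ x * g x) := by
    simpa [mul_comm] using l6.integrable_inner_two hψ2
  have i2 := memLp_one_iff_integrable.1 l2
  -- `k1` is the tested equation and `k2` moves the derivative off `u`. Each contributes one copy of
  -- `∫ ψ ⟨∇χ, v⟩`, which explains the factor `2` in the local source.
  have k1 : (∫ x, ⟪v x, χ x • gradient ψ x⟫) + ((∫ x, ψ x * ⟪v x, χ x • gradient V x⟫) +
      ∫ x, ψ x * ⟪gradient χ x, v x⟫) = ∫ x, ψ x * (χ x * g x) := by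
    have s := integral_add i1 (i2.add i3)
    simp only [Pi.add_apply] at s
    rw [integral_add i2 i3] at s
    rw [← key1, ← s]
    congr 1
    ext x
    simp only [inner_add_right, real_inner_smul_right,
      real_inner_comm (v x) (gradient χ x)]
    ring
  have k2 : ((∫ x, ⟪u x • gradient χ x, gradient ψ x⟫) +
      ∫ x, Laplacian.laplacian χ x * u x * ψ x) + ∫ x, ψ x * ⟪gradient χ x, v x⟫ = 0 := by
    rw [← integral_add i4 i5, ← key2]
    refine congrArg (· + ∫ x, ψ x * ⟪gradient χ x, v x⟫) (integral_congr_ae (.of_forall fun x => ?_))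
    simp only [real_inner_smul_left]
    ring
  have k3 : ∫ x, ⟪localGradient χ u v x, gradient ψ x⟫ =
      (∫ x, ⟪v x, χ x • gradient ψ x⟫) + ∫ x, ⟪u x • gradient χ x, gradient ψ x⟫ := by
    rw [← integral_add i1 i4]
    congr 1
    ext x
    simp only [localGradient, inner_add_left, real_inner_smul_left, real_inner_smul_right]
  have k4 : ∫ x, localSource V χ u v g x * ψ x = ((∫ x, ψ x * (χ x * g x)) -
      ((∫ x, ψ x * ⟪v x, χ x • gradient V x⟫) + ((∫ x, ψ x * ⟪gradient χ x, v x⟫) +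
      ∫ x, ψ x * ⟪gradient χ x, v x⟫))) - ∫ x, Laplacian.laplacian χ x * u x * ψ x := by
    have s1 := integral_add i2 (i3.add i3)
    have s2 := integral_sub i6 (i2.add (i3.add i3))
    have s3 := integral_sub (i6.sub (i2.add (i3.add i3))) i5
    simp only [Pi.add_apply, Pi.sub_apply] at s1 s2 s3
    rw [integral_add i3 i3] at s1
    rw [s1] at s2
    rw [s2] at s3
    rw [← s3]
    congr 1
    ext x
    simp only [localSource, inner_add_right, real_inner_smul_right,
      real_inner_comm (v x) (gradient χ x)]
    ring
  rw [k3, k4]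
  linarith

end

end Localisation

/-- Nonlinearities `β` admissible in the chain rule: `β` is `C¹`, and `β'` as well as
`r ↦ r β' r` are tame. -/
structure IsRenormalization (β β' : ℝ → ℝ) (K : ℝ≥0) : Prop where
  hasDerivAt : ∀ r, HasDerivAt β (β' r) r
  continuous_deriv : Continuous β'
  bound : ∀ r, ‖β' r‖ ≤ K
  lipschitz : LipschitzWith K fun r => r * β' r

lemma IsRenormalization.contDiff {β β' : ℝ → ℝ} {K : ℝ≥0} (h : IsRenormalization β β' K) :
    ContDiff ℝ 1 β := by
  rw [contDiff_one_iff_deriv]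
  refine ⟨fun r => (h.hasDerivAt r).differentiableAt, ?_⟩
  rw [show deriv β = β' from funext fun r => (h.hasDerivAt r).deriv]
  exact h.continuous_deriv

lemma IsRenormalization.lipschitzWith {β β' : ℝ → ℝ} {K : ℝ≥0} (h : IsRenormalization β β' K) :
    LipschitzWith K β := by
  refine lipschitzWith_of_nnnorm_deriv_le (fun r => (h.hasDerivAt r).differentiableAt) fun r => ?_
  rw [(h.hasDerivAt r).deriv]
  exact_mod_cast h.bound r

lemma LipschitzWith.norm_le_norm_zero_add {B : ℝ → ℝ} {K : ℝ≥0} (h : LipschitzWith K B) (r : ℝ) :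
    ‖B r‖ ≤ ‖B 0‖ + K * ‖r‖ := by
  have h1 := h.norm_sub_le r 0
  rw [sub_zero] at h1
  calc ‖B r‖ = ‖B 0 + (B r - B 0)‖ := by congr 1; ring
    _ ≤ _ := (norm_add_le _ _).trans (by gcongr)

/-! ### Nonlinear functions of a density at a fixed time -/

section Static

variable {d : ℕ}

/-- `p β(m / p)`, the density of `β` of a density `m / p`. -/
def perspective (p : EuclideanSpace ℝ (Fin d) → ℝ) (B : ℝ → ℝ) (m : EuclideanSpace ℝ (Fin d) → ℝ)
    (x : EuclideanSpace ℝ (Fin d)) : ℝ := p x * B (m x / p x)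

variable {p m m' : EuclideanSpace ℝ (Fin d) → ℝ} {B : ℝ → ℝ} {K : ℝ≥0} {F : Type}
  [NormedAddCommGroup F] [NormedSpace ℝ F] {θ : EuclideanSpace ℝ (Fin d) → F}

/-- The factor `p` cancels the quotient by `p`, so `L¹` or `L²` convergence of `m` passes to the
perspective without a lower bound on `p`. -/
lemma norm_perspective_sub_le (hpos : ∀ x, 0 < p x) (hB : LipschitzWith K B)
    (x : EuclideanSpace ℝ (Fin d)) :
    ‖perspective p B m x - perspective p B m' x‖ ≤ K * ‖m x - m' x‖ := by
  rw [perspective, perspective, ← mul_sub, norm_mul, Real.norm_of_nonneg (hpos x).le]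
  calc p x * ‖B (m x / p x) - B (m' x / p x)‖ ≤ p x * (K * ‖m x / p x - m' x / p x‖) := by
        gcongr
        · exact (hpos x).le
        · exact hB.norm_sub_le _ _
    _ = K * ‖m x - m' x‖ := by
        rw [← sub_div, norm_div, Real.norm_of_nonneg (hpos x).le]
        field_simp [(hpos x).ne']

lemma norm_perspective_le (hpos : ∀ x, 0 < p x) (hB : LipschitzWith K B)
    (x : EuclideanSpace ℝ (Fin d)) :
    ‖perspective p B m x‖ ≤ p x * ‖B 0‖ + K * ‖m x‖ := by
  rw [perspective, norm_mul, Real.norm_of_nonneg (hpos x).le]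
  calc p x * ‖B (m x / p x)‖ ≤ p x * (‖B 0‖ + K * ‖m x / p x‖) := by
        gcongr
        · exact (hpos x).le
        · exact hB.norm_le_norm_zero_add _
    _ = p x * ‖B 0‖ + K * ‖m x‖ := by
        rw [norm_div, Real.norm_of_nonneg (hpos x).le]
        field_simp [(hpos x).ne']

lemma aestronglyMeasurable_perspective (hp : Continuous p) (hpos : ∀ x, 0 < p x)
    (hB : Continuous B) (hm : AEStronglyMeasurable m volume) :
    AEStronglyMeasurable (perspective p B m) volume :=
  hp.aestronglyMeasurable.mul (hB.comp_aestronglyMeasurable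
    (hm.mul (hp.inv₀ fun x => (hpos x).ne').aestronglyMeasurable))

/-- The localised composition is bounded on `L²`. -/
lemma exists_eLpNorm_perspective_smul_le (hp : Continuous p) (hpos : ∀ x, 0 < p x)
    (hB : LipschitzWith K B) (hθ : Continuous θ) (hc : HasCompactSupport θ) :
    ∃ C : ℝ≥0, ∀ m, MemLp m 2 volume → MemLp (fun x => perspective p B m x • θ x) 2 volume ∧
      eLpNorm (fun x => perspective p B m x • θ x) 2 volume ≤ C * (1 + eLpNorm m 2 volume) := by
  obtain ⟨c, hcb⟩ := hθ.bounded_above_of_compact_support hc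
  have hc0 : 0 ≤ c := (norm_nonneg _).trans (hcb 0)
  have h1 : MemLp (fun x => (p x * ‖B 0‖) • ‖θ x‖) 2 volume :=
    ((hp.mul continuous_const).smul hθ.norm).memLp_of_hasCompactSupport
      (hc.norm.smul_left (f := fun x => p x * ‖B 0‖))
  obtain ⟨N, hN⟩ : ∃ N : ℝ≥0, N = eLpNorm (fun x => (p x * ‖B 0‖) • ‖θ x‖) 2 volume :=
    ⟨_, ENNReal.coe_toNNReal h1.2.ne⟩
  refine ⟨N + K * c.toNNReal, fun m hm => ?_⟩
  have hmeas : AEStronglyMeasurable (fun x => perspective p B m x • θ x) volume :=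
    (aestronglyMeasurable_perspective hp hpos hB.continuous hm.1).smul hθ.aestronglyMeasurable
  have h2 : MemLp (fun x => (K * c : ℝ) * ‖m x‖) 2 volume := hm.norm.const_mul _
  have e2 : eLpNorm (fun x => (K * c : ℝ) * ‖m x‖) 2 volume = K * c.toNNReal * eLpNorm m 2 volume := by
    have := eLpNorm_const_smul (K * c : ℝ) (fun x => ‖m x‖) 2 (volume : Measure (EuclideanSpace ℝ (Fin d)))
    rw [eLpNorm_norm] at this
    refine this.trans ?_
    congr 1
    rw [Real.enorm_of_nonneg (by positivity), ENNReal.ofReal_mul (by positivity),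
      ENNReal.ofReal_coe_nnreal]
    rfl
  have hb : eLpNorm (fun x => perspective p B m x • θ x) 2 volume ≤
      (N + K * c.toNNReal : ℝ≥0) * (1 + eLpNorm m 2 volume) := by
    calc _ ≤ eLpNorm ((fun x => (p x * ‖B 0‖) • ‖θ x‖) + fun x => (K * c : ℝ) * ‖m x‖) 2 volume := by
          refine eLpNorm_mono_real fun x => ?_
          simp only [Pi.add_apply, smul_eq_mul]
          rw [norm_smul]
          calc ‖perspective p B m x‖ * ‖θ x‖ ≤ (p x * ‖B 0‖ + K * ‖m x‖) * ‖θ x‖ := by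
                gcongr
                exact norm_perspective_le hpos hB x
            _ ≤ p x * ‖B 0‖ * ‖θ x‖ + K * ‖m x‖ * c := by
                rw [add_mul]
                gcongr
                exact hcb x
            _ = _ := by ring
      _ ≤ N + K * c.toNNReal * eLpNorm m 2 volume := by
          refine (eLpNorm_add_le h1.1 h2.1 one_le_two).trans ?_
          rw [e2, hN]
      _ ≤ (N + K * c.toNNReal * eLpNorm m 2 volume) + (K * c.toNNReal + N * eLpNorm m 2 volume) :=
          le_self_add
      _ = _ := by push_cast; ring
  exact ⟨⟨hmeas, hb.trans_lt (ENNReal.mul_lt_top ENNReal.coe_lt_top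
    (ENNReal.add_lt_top.2 ⟨ENNReal.one_lt_top, hm.2⟩))⟩, hb⟩

lemma tendsto_eLpNorm_perspective_smul_sub (hpos : ∀ x, 0 < p x)
    (hB : LipschitzWith K B) (hθ : Continuous θ) (hc : HasCompactSupport θ)
    {mn : ℕ → EuclideanSpace ℝ (Fin d) → ℝ}
    (h : Tendsto (fun n => eLpNorm (fun x => mn n x - m x) 2 volume) atTop (𝓝 0)) :
    Tendsto (fun n => eLpNorm (fun x => perspective p B (mn n) x • θ x -
      perspective p B m x • θ x) 2 volume) atTop (𝓝 0) := by
  obtain ⟨c, hcb⟩ := hθ.bounded_above_of_compact_support hc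
  have hc0 : 0 ≤ c := (norm_nonneg _).trans (hcb 0)
  have t : Tendsto (fun n => ENNReal.ofReal (K * c) * eLpNorm (fun x => mn n x - m x) 2 volume)
      atTop (𝓝 0) := by
    simpa using ENNReal.Tendsto.const_mul h (Or.inr (ENNReal.ofReal_ne_top (r := K * c)))
  refine tendsto_of_tendsto_of_tendsto_of_le_of_le tendsto_const_nhds t (fun _ => zero_le)
    fun n => eLpNorm_le_mul_eLpNorm_of_ae_le_mul (Eventually.of_forall fun x => ?_) 2
  rw [← sub_smul, norm_smul]
  calc ‖perspective p B (mn n) x - perspective p B m x‖ * ‖θ x‖ ≤ (K * ‖mn n x - m x‖) * c := by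
        gcongr
        · exact norm_perspective_sub_le hpos hB x
        · exact hcb x
    _ = K * c * ‖mn n x - m x‖ := by ring

/-- Dominated convergence for a bounded continuous function of an `L²`-convergent sequence. -/
lemma tendsto_integral_comp_mul {b : ℝ → ℝ} (hb : Continuous b) {M : ℝ} (hM : ∀ r, ‖b r‖ ≤ M)
    (hp : Continuous p) (hpos : ∀ x, 0 < p x)
    {mn : ℕ → EuclideanSpace ℝ (Fin d) → ℝ} (hmn : ∀ n, MemLp (mn n) 2 volume)
    (hm : MemLp m 2 volume)
    (h : Tendsto (fun n => eLpNorm (fun x => mn n x - m x) 2 volume) atTop (𝓝 0))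
    {k : EuclideanSpace ℝ (Fin d) → ℝ} (hk : Integrable k) :
    Tendsto (fun n => ∫ x, b (mn n x / p x) * k x) atTop (𝓝 (∫ x, b (m x / p x) * k x)) := by
  -- `b` is only bounded and continuous, so convergence is checked along subsequences that converge
  -- almost everywhere.
  refine tendsto_of_subseq_tendsto fun ns hns => ?_
  have hmeas : TendstoInMeasure volume (fun n => mn (ns n)) atTop m :=
    tendstoInMeasure_of_tendsto_eLpNorm (two_ne_zero) (fun n => (hmn _).1) hm.1 (h.comp hns)
  obtain ⟨ms, _, hms⟩ := hmeas.exists_seq_tendsto_ae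
  refine ⟨ms, tendsto_integral_of_dominated_convergence (fun x => M * ‖k x‖) (fun n => ?_)
    (hk.norm.const_mul M) (fun n => Eventually.of_forall fun x => ?_) ?_⟩
  · exact (hb.comp_aestronglyMeasurable ((hmn _).1.mul
      (hp.inv₀ fun x => (hpos x).ne').aestronglyMeasurable)).mul hk.1
  · rw [norm_mul]
    gcongr
    exact hM _
  · filter_upwards [hms] with x hx
    exact ((hb.tendsto _).comp (hx.div_const (p x))).mul_const _

variable {β β' : ℝ → ℝ} {χ w G : EuclideanSpace ℝ (Fin d) → ℝ}
  {v : EuclideanSpace ℝ (Fin d) → EuclideanSpace ℝ (Fin d)}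

/-- Integration by parts in the chain rule. -/
lemma integral_chain_rule (hβ : IsRenormalization β β' K) (hp : ContDiff ℝ 1 p)
    (hpos : ∀ x, 0 < p x) (hχ : IsTestFunction χ) (hv : MemLp v 2 volume) (hG : MemLp G 2 volume)
    (hweak : ∀ ψ, IsTestFunction ψ → ∫ x, ⟪v x, gradient ψ x⟫ = ∫ x, G x * ψ x)
    (hm : ContDiff ℝ 1 m) (hm2 : MemLp m 2 volume) :
    ∫ x, χ x * β' (m x / p x) * ⟪v x, gradient m x⟫ =
      (∫ x, ⟪G x, perspective p β m x • χ x⟫) -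
        (∫ x, ⟪v x, perspective p β m x • (p x)⁻¹ • gradient (fun x => χ x * p x) x⟫) +
        ∫ x, ⟪v x, perspective p (fun r => r * β' r) m x • (χ x / p x) • gradient p x⟫ := by
  have hχp : ContDiff ℝ 1 fun x => χ x * p x := hχ.contDiff_one.mul hp
  have hq : ContDiff ℝ 1 fun x => m x / p x := hm.div hp fun x => (hpos x).ne'
  have hβq : ContDiff ℝ 1 fun x => β (m x / p x) := hβ.contDiff.comp hq
  have hk : ContDiff ℝ 1 fun x => (χ x * p x) * β (m x / p x) := hχp.mul hβq
  have hkc : HasCompactSupport fun x => (χ x * p x) * β (m x / p x) := hχ.2.mul_right.mul_right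
  have ip : Continuous fun x => (p x)⁻¹ := hp.continuous.inv₀ fun x => (hpos x).ne'
  have c2 : Continuous fun x => (p x)⁻¹ • gradient (fun x => χ x * p x) x :=
    ip.smul (continuous_gradient hχp)
  have s2 : HasCompactSupport fun x => (p x)⁻¹ • gradient (fun x => χ x * p x) x :=
    HasCompactSupport.smul_left (f := fun x => (p x)⁻¹) (HasCompactSupport.gradient hχ.2.mul_right)
  have c3 : Continuous fun x => (χ x / p x) • gradient p x :=
    (hχ.1.continuous.div hp.continuous fun x => (hpos x).ne').smul (continuous_gradient hp)
  have s3 : HasCompactSupport fun x => (χ x / p x) • gradient p x := by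
    refine HasCompactSupport.smul_right (f := fun x => χ x / p x) (f' := gradient p) ?_
    simp_rw [div_eq_mul_inv]
    exact hχ.2.mul_right
  obtain ⟨_, h2⟩ := exists_eLpNorm_perspective_smul_le hp.continuous hpos hβ.lipschitzWith c2 s2
  obtain ⟨_, h3⟩ := exists_eLpNorm_perspective_smul_le hp.continuous hpos hβ.lipschitz c3 s3
  have hkL := hasWeakGradient_volume_of_contDiff hk hkc
  -- The equation for `v` is tested with `k = χ p β(m / p)`. Writing `p ∇(m / p) = ∇m - (m / p) ∇p`
  -- isolates the wanted term, and the remaining terms contain no derivative of `m`.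
  have key := hkL.integral_inner_eq hv hG hweak
  have i1 := hv.integrable_inner_two hkL.2.1
  have i2 := hv.integrable_inner_two (h2 m hm2).1
  have i3 := hv.integrable_inner_two (h3 m hm2).1
  have e1 : ∫ x, ⟪G x, perspective p β m x • χ x⟫ =
      ∫ x, G x * ((χ x * p x) * β (m x / p x)) := by
    congr 1
    ext x
    simp only [perspective, smul_eq_mul, RCLike.inner_apply, conj_trivial]
    ring
  have s := integral_add (i1.sub i2) i3
  simp only [Pi.sub_apply] at s
  rw [integral_sub i1 i2, key, ← e1] at s
  rw [← s]
  congr 1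
  ext x
  have d1 : gradient m x = (m x / p x) • gradient p x + p x • gradient (fun x => m x / p x) x := by
    rw [← gradient_mul' (hq.differentiable one_ne_zero x) (hp.differentiable one_ne_zero x)]
    congr 1
    ext y
    field_simp [(hpos y).ne']
  have d2 := gradient_mul' (hχp.differentiable one_ne_zero x) (hβq.differentiable one_ne_zero x)
  have d3 := gradient_comp' (hq.differentiable one_ne_zero x) (hβ.hasDerivAt (m x / p x))
  rw [d2, d3, d1, ← real_inner_smul_right, ← inner_sub_right, ← inner_add_right]
  congr 1
  simp only [perspective, smul_add, smul_smul]
  have a1 : p x * β (m x / p x) * (p x)⁻¹ = β (m x / p x) := by field_simp [(hpos x).ne']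
  have a2 : p x * (m x / p x * β' (m x / p x)) * (χ x / p x) =
      χ x * β' (m x / p x) * (m x / p x) := by field_simp [(hpos x).ne']
  rw [a1, a2, show χ x * p x * β' (m x / p x) = χ x * β' (m x / p x) * p x by ring]
  abel

end Static

/-! ### The mollified flux: uniform bound and limit -/

section Flux

variable {d : ℕ}

lemma toReal_le_of_le_mul_one_add {a e : ℝ≥0∞} {C : ℝ≥0} (h : a ≤ C * (1 + e)) (he : e ≠ ⊤) :
    a.toReal ≤ C * (1 + e.toReal) := by
  have h1 := ENNReal.toReal_mono (by finiteness) h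
  rwa [ENNReal.toReal_mul, ENNReal.toReal_add ENNReal.one_ne_top he, ENNReal.coe_toReal,
    ENNReal.toReal_one] at h1

/-- The time derivative at scale `n` of `∫ χ β(m / p) p` when `∂_t m = div (m v)`. -/
def renormFlux (p : EuclideanSpace ℝ (Fin d) → ℝ) (β' : ℝ → ℝ) (χ m : EuclideanSpace ℝ (Fin d) → ℝ)
    (v : EuclideanSpace ℝ (Fin d) → EuclideanSpace ℝ (Fin d)) (n : ℕ) : ℝ :=
  ∫ x, (χ x * β' (mollify n m x / p x)) * ∫ y, m y * ⟪gradient (mollifier n) (x - y), v y⟫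

/-- The limit of `renormFlux` when the scale tends to `0`. -/
def renormFluxLimit (p : EuclideanSpace ℝ (Fin d) → ℝ) (β β' : ℝ → ℝ)
    (χ m : EuclideanSpace ℝ (Fin d) → ℝ) (v : EuclideanSpace ℝ (Fin d) → EuclideanSpace ℝ (Fin d))
    (G : EuclideanSpace ℝ (Fin d) → ℝ) : ℝ :=
  ((∫ x, ⟪G x, perspective p β m x • χ x⟫) -
    (∫ x, ⟪v x, perspective p β m x • (p x)⁻¹ • gradient (fun x => χ x * p x) x⟫) +
    ∫ x, ⟪v x, perspective p (fun r => r * β' r) m x • (χ x / p x) • gradient p x⟫) -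
    ∫ x, β' (m x / p x) * (χ x * (G x * m x))

variable {p χ : EuclideanSpace ℝ (Fin d) → ℝ} {β β' : ℝ → ℝ} {K : ℝ≥0}

/-- The flux is a transport term, handled by the chain rule for the smooth density `mollify n m`,
plus the commutator. That `v` is a gradient with divergence `-G` in `L²` supplies the translation
estimate. The bound is uniform in `n` so that it can dominate in time later. -/
theorem exists_renormFlux_le_and_tendsto (hβ : IsRenormalization β β' K) (hp : ContDiff ℝ 1 p)
    (hpos : ∀ x, 0 < p x) (hχ : IsTestFunction χ) :
    ∃ C : ℝ, 0 ≤ C ∧ ∀ (m w G : EuclideanSpace ℝ (Fin d) → ℝ)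
      (v : EuclideanSpace ℝ (Fin d) → EuclideanSpace ℝ (Fin d)), MemLp m 2 volume →
      HasWeakGradient volume w v → MemLp G 2 volume →
      (∀ ψ, IsTestFunction ψ → ∫ x, ⟪v x, gradient ψ x⟫ = ∫ x, G x * ψ x) →
      (∀ n, |renormFlux p β' χ m v n| ≤ C * ((1 + (eLpNorm m 2 volume).toReal) *
        ((eLpNorm v 2 volume).toReal + (eLpNorm G 2 volume).toReal))) ∧
      Tendsto (renormFlux p β' χ m v) atTop (𝓝 (renormFluxLimit p β β' χ m v G)) := by
  have hχp : ContDiff ℝ 1 fun x => χ x * p x := hχ.contDiff_one.mul hp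
  have ip : Continuous fun x => (p x)⁻¹ := hp.continuous.inv₀ fun x => (hpos x).ne'
  have c2 : Continuous fun x => (p x)⁻¹ • gradient (fun x => χ x * p x) x :=
    ip.smul (continuous_gradient hχp)
  have s2 : HasCompactSupport fun x => (p x)⁻¹ • gradient (fun x => χ x * p x) x :=
    HasCompactSupport.smul_left (f := fun x => (p x)⁻¹) (HasCompactSupport.gradient hχ.2.mul_right)
  have c3 : Continuous fun x => (χ x / p x) • gradient p x :=
    (hχ.1.continuous.div hp.continuous fun x => (hpos x).ne').smul (continuous_gradient hp)
  have s3 : HasCompactSupport fun x => (χ x / p x) • gradient p x := by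
    refine HasCompactSupport.smul_right (f := fun x => χ x / p x) (f' := gradient p) ?_
    simp_rw [div_eq_mul_inv]
    exact hχ.2.mul_right
  obtain ⟨C₁, h1⟩ := exists_eLpNorm_perspective_smul_le hp.continuous hpos hβ.lipschitzWith
    hχ.1.continuous hχ.2
  obtain ⟨C₂, h2⟩ := exists_eLpNorm_perspective_smul_le hp.continuous hpos hβ.lipschitzWith c2 s2
  obtain ⟨C₃, h3⟩ := exists_eLpNorm_perspective_smul_le hp.continuous hpos hβ.lipschitz c3 s3
  obtain ⟨c, hcb⟩ := hχ.1.continuous.bounded_above_of_compact_support hχ.2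
  have hc0 : 0 ≤ c := (norm_nonneg _).trans (hcb 0)
  refine ⟨C₁ + C₂ + C₃ + c * K * mollifierConst d, by
    have := mollifierConst_nonneg d; positivity, fun m w G v hm hw hG hweak => ?_⟩
  have hv := hw.2.1
  have hM := hw.eLpNorm_gradient_comp_sub_sub_le hG hweak
  have hml := hm.locallyIntegrable one_le_two
  have hmn : ∀ n, MemLp (mollify n m) 2 volume := fun n => memLp_mollify n one_le_two (by norm_num) hm
  have hmC : ∀ n, ContDiff ℝ 1 (mollify n m) := fun n => contDiff_infty.1 (contDiff_mollify n hml) 1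
  have hcomm : ∀ n, Integrable (mollifierCommutator n m v) := fun n =>
    memLp_one_iff_integrable.1 ⟨aestronglyMeasurable_commutator n hm hv,
      (eLpNorm_commutator_le n hm hv hM).trans_lt (ENNReal.mul_lt_top
        (ENNReal.mul_lt_top ENNReal.ofReal_lt_top hG.2) hm.2)⟩
  have hφ : ∀ n, AEStronglyMeasurable (fun x => χ x * β' (mollify n m x / p x)) volume := fun n =>
    (hχ.1.continuous.mul (hβ.continuous_deriv.comp
      ((hmC n).continuous.div hp.continuous fun x => (hpos x).ne'))).aestronglyMeasurable
  have hφb : ∀ n x, ‖χ x * β' (mollify n m x / p x)‖ ≤ c * K := fun n x => by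
    rw [norm_mul]
    gcongr
    · exact hcb x
    · exact hβ.bound _
  have i1 : ∀ n, Integrable fun x => (χ x * β' (mollify n m x / p x)) * mollifierCommutator n m v x :=
    fun n => (hcomm n).bdd_mul (hφ n) (Eventually.of_forall (hφb n))
  have i2 : ∀ n, Integrable fun x => (χ x * β' (mollify n m x / p x)) * ⟪v x, gradient (mollify n m) x⟫ := by
    intro n
    have hcont : Continuous fun x => (χ x * β' (mollify n m x / p x)) • gradient (mollify n m) x :=
      (hχ.1.continuous.mul (hβ.continuous_deriv.comp
      ((hmC n).continuous.div hp.continuous fun x => (hpos x).ne'))).smul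
        (continuous_gradient (hmC n))
    have hs : HasCompactSupport fun x =>
        (χ x * β' (mollify n m x / p x)) • gradient (mollify n m) x :=
      HasCompactSupport.smul_right (f := fun x => χ x * β' (mollify n m x / p x)) hχ.2.mul_right
    refine (hv.integrable_inner_two (hcont.memLp_of_hasCompactSupport hs)).congr
      (Eventually.of_forall fun x => ?_)
    simp only [real_inner_smul_right]
  -- The divergence of the mollified flux is the commutator plus `⟨v, ∇(mollify n m)⟩`;
  -- `integral_chain_rule` rewrites the second part without derivatives of the density.
  have hsplit : ∀ n, renormFlux p β' χ m v n =
      ((∫ x, ⟪G x, perspective p β (mollify n m) x • χ x⟫) -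
        (∫ x, ⟪v x, perspective p β (mollify n m) x • (p x)⁻¹ • gradient (fun x => χ x * p x) x⟫) +
        ∫ x, ⟪v x, perspective p (fun r => r * β' r) (mollify n m) x •
          (χ x / p x) • gradient p x⟫) +
      ∫ x, (χ x * β' (mollify n m x / p x)) * mollifierCommutator n m v x := by
    intro n
    rw [← integral_chain_rule hβ hp hpos hχ hv hG hweak (hmC n) (hmn n), ← integral_add (i2 n) (i1 n),
      renormFlux]
    congr 1
    ext x
    rw [commutator_eq_sub n hm hv x]
    ring
  constructor
  · intro n
    have hle : eLpNorm (mollify n m) 2 volume ≤ eLpNorm m 2 volume :=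
      eLpNorm_mollify_le n one_le_two (by norm_num) hm
    have hb : ∀ {C : ℝ≥0} {F : Type} [NormedAddCommGroup F] {f : EuclideanSpace ℝ (Fin d) → F},
        eLpNorm f 2 volume ≤ C * (1 + eLpNorm (mollify n m) 2 volume) →
        (eLpNorm f 2 volume).toReal ≤ C * (1 + (eLpNorm m 2 volume).toReal) := by
      intro C F _ f h
      exact toReal_le_of_le_mul_one_add
        (h.trans (mul_le_mul_right (add_le_add le_rfl hle) _)) hm.2.ne
    have b1 := (abs_integral_inner_le hG (h1 _ (hmn n)).1).trans
      (mul_le_mul_of_nonneg_left (hb (h1 _ (hmn n)).2) ENNReal.toReal_nonneg)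
    have b2 := (abs_integral_inner_le hv (h2 _ (hmn n)).1).trans
      (mul_le_mul_of_nonneg_left (hb (h2 _ (hmn n)).2) ENNReal.toReal_nonneg)
    have b3 := (abs_integral_inner_le hv (h3 _ (hmn n)).1).trans
      (mul_le_mul_of_nonneg_left (hb (h3 _ (hmn n)).2) ENNReal.toReal_nonneg)
    have b4 : |∫ x, (χ x * β' (mollify n m x / p x)) * mollifierCommutator n m v x| ≤
        c * K * (mollifierConst d * (eLpNorm G 2 volume).toReal * (eLpNorm m 2 volume).toReal) := by
      calc |∫ x, (χ x * β' (mollify n m x / p x)) * mollifierCommutator n m v x|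
          ≤ ∫ x, c * K * ‖mollifierCommutator n m v x‖ := by
            rw [← Real.norm_eq_abs]
            refine norm_integral_le_of_norm_le ((hcomm n).norm.const_mul _)
              (Eventually.of_forall fun x => ?_)
            rw [norm_mul]
            gcongr
            exact hφb n x
        _ = c * K * (eLpNorm (mollifierCommutator n m v) 1 volume).toReal := by
            rw [integral_const_mul, eLpNorm_one_eq_lintegral_enorm,
              integral_norm_eq_lintegral_enorm (hcomm n).1]
        _ ≤ _ := by
            gcongr
            have := ENNReal.toReal_mono (by finiteness [hG.2.ne, hm.2.ne])
              (eLpNorm_commutator_le n hm hv hM)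
            rwa [ENNReal.toReal_mul, ENNReal.toReal_mul,
              ENNReal.toReal_ofReal (mollifierConst_nonneg d)] at this
    rw [hsplit]
    have hM0 : 0 ≤ (eLpNorm m 2 volume).toReal := ENNReal.toReal_nonneg
    have hA0 : 0 ≤ (eLpNorm v 2 volume).toReal := ENNReal.toReal_nonneg
    have hD0 : 0 ≤ (eLpNorm G 2 volume).toReal := ENNReal.toReal_nonneg
    generalize (eLpNorm m 2 volume).toReal = M at b1 b2 b3 b4 hM0 ⊢
    generalize (eLpNorm v 2 volume).toReal = A at b1 b2 b3 b4 hA0 ⊢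
    generalize (eLpNorm G 2 volume).toReal = D at b1 b2 b3 b4 hD0 ⊢
    have hc := mollifierConst_nonneg d
    refine (abs_add_le _ _).trans ((add_le_add ((abs_add_le _ _).trans
      (add_le_add ((abs_sub _ _).trans (add_le_add b1 b2)) b3)) b4).trans ?_)
    have q1 : 0 ≤ (C₁ : ℝ) * (1 + M) * A := by positivity
    have q2 : 0 ≤ (C₂ : ℝ) * (1 + M) * D := by positivity
    have q3 : 0 ≤ (C₃ : ℝ) * (1 + M) * D := by positivity
    have q4 : 0 ≤ c * K * mollifierConst d * ((1 + M) * A) := by positivity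
    have q5 : 0 ≤ c * K * mollifierConst d * D := by positivity
    nlinarith
  · have tm := tendsto_eLpNorm_mollify_sub one_le_two (by norm_num) hm
    have t1 := tendsto_integral_inner_of_eLpNorm (l := atTop) (a := fun _ => G) (fun _ => hG) hG
      (fun n => (h1 _ (hmn n)).1) (h1 m hm).1 (by simp)
      (tendsto_eLpNorm_perspective_smul_sub hpos hβ.lipschitzWith hχ.1.continuous hχ.2 tm)
    have t2 := tendsto_integral_inner_of_eLpNorm (l := atTop) (a := fun _ => v) (fun _ => hv) hv
      (fun n => (h2 _ (hmn n)).1) (h2 m hm).1 (by simp)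
      (tendsto_eLpNorm_perspective_smul_sub hpos hβ.lipschitzWith c2 s2 tm)
    have t3 := tendsto_integral_inner_of_eLpNorm (l := atTop) (a := fun _ => v) (fun _ => hv) hv
      (fun n => (h3 _ (hmn n)).1) (h3 m hm).1 (by simp)
      (tendsto_eLpNorm_perspective_smul_sub hpos hβ.lipschitz c3 s3 tm)
    have iGm : Integrable fun x => G x * m x := by
      simpa [mul_comm] using hG.integrable_inner_two hm
    have ik : Integrable fun x => χ x * (G x * m x) :=
      iGm.bdd_mul hχ.1.continuous.aestronglyMeasurable (Eventually.of_forall hcb)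
    have t4 := tendsto_integral_comp_mul hβ.continuous_deriv hβ.bound hp.continuous hpos hmn hm tm ik
    -- Only the sum of commutator and `G m` tends to zero in `L¹`. The subtracted product with `G m`
    -- has a weight varying with `n`, and `t4` supplies its limit.
    have t5 : Tendsto (fun n => ∫ x, (χ x * β' (mollify n m x / p x)) *
        (mollifierCommutator n m v x + G x * m x)) atTop (𝓝 0) := by
      have tc := tendsto_commutator hm hv hG hweak hG.2.ne hM
      have tc' : Tendsto (fun n => c * K * (eLpNorm (fun x =>
          mollifierCommutator n m v x + G x * m x) 1 volume).toReal) atTop (𝓝 0) := by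
        have := (ENNReal.tendsto_toReal ENNReal.zero_ne_top).comp tc
        simpa using this.const_mul (c * K)
      refine squeeze_zero_norm (fun n => ?_) tc'
      have ii : Integrable fun x => mollifierCommutator n m v x + G x * m x := (hcomm n).add iGm
      calc ‖∫ x, (χ x * β' (mollify n m x / p x)) * (mollifierCommutator n m v x + G x * m x)‖
          ≤ ∫ x, c * K * ‖mollifierCommutator n m v x + G x * m x‖ := by
            refine norm_integral_le_of_norm_le (ii.norm.const_mul _)
              (Eventually.of_forall fun x => ?_)
            rw [norm_mul]
            gcongr
            exact hφb n x
        _ = _ := by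
            rw [integral_const_mul, eLpNorm_one_eq_lintegral_enorm,
              integral_norm_eq_lintegral_enorm ii.1]
    have t6 := ((t1.sub t2).add t3).add (t5.sub t4)
    rw [zero_sub, ← sub_eq_add_neg] at t6
    refine t6.congr fun n => ?_
    rw [hsplit]
    congr 1
    have ik' : Integrable fun x => β' (mollify n m x / p x) * (χ x * (G x * m x)) :=
      ik.bdd_mul (hβ.continuous_deriv.comp ((hmC n).continuous.div hp.continuous
        fun x => (hpos x).ne')).aestronglyMeasurable (Eventually.of_forall fun x => hβ.bound _)
    have is : Integrable fun x => (χ x * β' (mollify n m x / p x)) *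
        (mollifierCommutator n m v x + G x * m x) :=
      ((hcomm n).add iGm).bdd_mul (hφ n) (Eventually.of_forall (hφb n))
    rw [← integral_sub is ik']
    congr 1
    ext x
    ring

end Flux

/-! ### The flux for densities with respect to the target -/

section StaticLocal

variable {d : ℕ} {V χ : EuclideanSpace ℝ (Fin d) → ℝ} {β β' : ℝ → ℝ} {K : ℝ≥0}

lemma cutoff_eventuallyEq_one {n : ℕ} {x : EuclideanSpace ℝ (Fin d)} (hx : ‖x‖ < (n : ℝ) + 1) :
    cutoff n =ᶠ[𝓝 x] fun _ => (1 : ℝ) := by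
  filter_upwards [(isOpen_lt continuous_norm continuous_const).mem_nhds hx] with y hy
  exact cutoff_eq_one (le_of_lt hy)

lemma gradient_cutoff_eq_zero {n : ℕ} {x : EuclideanSpace ℝ (Fin d)} (hx : ‖x‖ < (n : ℝ) + 1) :
    gradient (cutoff n) x = 0 := by
  rw [gradient, (cutoff_eventuallyEq_one hx).fderiv_eq]
  simp

lemma laplacian_cutoff_eq_zero {n : ℕ} {x : EuclideanSpace ℝ (Fin d)} (hx : ‖x‖ < (n : ℝ) + 1) :
    Laplacian.laplacian (cutoff n : EuclideanSpace ℝ (Fin d) → ℝ) x = 0 := by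
  rw [(InnerProductSpace.laplacian_congr_nhds (cutoff_eventuallyEq_one hx)).eq_of_nhds]
  rw [InnerProductSpace.laplacian_eq_iteratedFDeriv_stdOrthonormalBasis]
  simp [iteratedFDeriv_const_of_ne]

/-- All mollifiers have support radius at most `1`, so the flux sees only the unit neighbourhood of
the support of `χ`. This permits replacing global data by localised data without changing the flux.
-/
lemma renormFlux_congr (p : EuclideanSpace ℝ (Fin d) → ℝ) {m m' : EuclideanSpace ℝ (Fin d) → ℝ}
    {v v' : EuclideanSpace ℝ (Fin d) → EuclideanSpace ℝ (Fin d)}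
    (h : ∀ x y, χ x ≠ 0 → ‖x - y‖ ≤ 1 → m y = m' y ∧ v y = v' y) (n : ℕ) :
    renormFlux p β' χ m v n = renormFlux p β' χ m' v' n := by
  rw [renormFlux, renormFlux]
  congr 1
  ext x
  by_cases hx : χ x = 0
  · simp [hx]
  have hr : ∀ z : EuclideanSpace ℝ (Fin d), z ∈ tsupport (mollifier n) → ‖z‖ ≤ 1 := fun z hz => by
    have := tsupport_mollifier_subset n hz
    rw [mem_closedBall_zero_iff] at this
    exact this.trans (mollifier_radius_le_one n)
  have e1 : mollify n m x = mollify n m' x := by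
    rw [mollify, mollify]
    congr 1
    ext y
    by_cases hy : mollifier n (x - y) = 0
    · simp [hy]
    · rw [(h x y hx (hr _ (subset_tsupport _ hy))).1]
  have e2 : ∫ y, m y * ⟪gradient (mollifier n) (x - y), v y⟫ =
      ∫ y, m' y * ⟪gradient (mollifier n) (x - y), v' y⟫ := by
    congr 1
    ext y
    by_cases hy : gradient (mollifier n) (x - y) = 0
    · simp [hy]
    · obtain ⟨h1, h2⟩ := h x y hx (hr _ (support_gradient_subset _ hy))
      rw [h1, h2]
  rw [e1, e2]

/-- The limit of the flux in terms of the densities with respect to the target. -/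
lemma renormFluxLimit_eq (hV : ContDiff ℝ 1 V)
    (hint : Integrable (fun x => Real.exp (-V x)) volume) (hβ : IsRenormalization β β' K)
    (hχ : IsTestFunction χ) {m G ρ g : EuclideanSpace ℝ (Fin d) → ℝ}
    {w v : EuclideanSpace ℝ (Fin d) → EuclideanSpace ℝ (Fin d)}
    (hm : MemLp m 2 volume) (hw : MemLp w 2 volume) (hG : MemLp G 2 volume)
    (h : ∀ x ∈ tsupport χ, m x = targetDensity V x * ρ x ∧ w x = v x ∧
      G x = g x - ⟪v x, gradient V x⟫) :
    renormFluxLimit (targetDensity V) β β' χ m w G =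
      ∫ x, (χ x * (g x * (β (ρ x) - ρ x * β' (ρ x))) - β (ρ x) * ⟪v x, gradient χ x⟫)
        ∂(target V) := by
  have hp := contDiff_targetDensity hV
  have hpos := targetDensity_pos hint
  have hχp : ContDiff ℝ 1 fun x => χ x * targetDensity V x := hχ.contDiff_one.mul hp
  have ip : Continuous fun x => (targetDensity V x)⁻¹ := hp.continuous.inv₀ fun x => (hpos x).ne'
  have c2 : Continuous fun x =>
      (targetDensity V x)⁻¹ • gradient (fun x => χ x * targetDensity V x) x :=
    ip.smul (continuous_gradient hχp)
  have s2 : HasCompactSupport fun x =>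
      (targetDensity V x)⁻¹ • gradient (fun x => χ x * targetDensity V x) x :=
    HasCompactSupport.smul_left (f := fun x => (targetDensity V x)⁻¹)
      (HasCompactSupport.gradient hχ.2.mul_right)
  have c3 : Continuous fun x => (χ x / targetDensity V x) • gradient (targetDensity V) x :=
    (hχ.1.continuous.div hp.continuous fun x => (hpos x).ne').smul (continuous_gradient hp)
  have s3 : HasCompactSupport fun x => (χ x / targetDensity V x) • gradient (targetDensity V) x := by
    refine HasCompactSupport.smul_right (f := fun x => χ x / targetDensity V x)
      (f' := gradient (targetDensity V)) ?_
    simp_rw [div_eq_mul_inv]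
    exact hχ.2.mul_right
  obtain ⟨_, h1⟩ := exists_eLpNorm_perspective_smul_le hp.continuous hpos hβ.lipschitzWith
    hχ.1.continuous hχ.2
  obtain ⟨_, h2⟩ := exists_eLpNorm_perspective_smul_le hp.continuous hpos hβ.lipschitzWith c2 s2
  obtain ⟨_, h3⟩ := exists_eLpNorm_perspective_smul_le hp.continuous hpos hβ.lipschitz c3 s3
  obtain ⟨c, hcb⟩ := hχ.1.continuous.bounded_above_of_compact_support hχ.2
  have i1 := hG.integrable_inner_two (h1 m hm).1
  have i2 := hw.integrable_inner_two (h2 m hm).1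
  have i3 := hw.integrable_inner_two (h3 m hm).1
  have iGm : Integrable fun x => G x * m x := by
    simpa [mul_comm] using hG.integrable_inner_two hm
  have i4 : Integrable fun x => β' (m x / targetDensity V x) * (χ x * (G x * m x)) :=
    (iGm.bdd_mul hχ.1.continuous.aestronglyMeasurable (Eventually.of_forall hcb)).bdd_mul
      (hβ.continuous_deriv.comp_aestronglyMeasurable (hm.1.mul ip.aestronglyMeasurable))
      (Eventually.of_forall fun x => hβ.bound _)
  have s := integral_sub ((i1.sub i2).add i3) i4
  have s' := integral_add (i1.sub i2) i3
  simp only [Pi.add_apply, Pi.sub_apply] at s s'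
  rw [s', integral_sub i1 i2] at s
  rw [renormFluxLimit, ← s, integral_target]
  congr 1
  ext x
  by_cases hx : x ∈ tsupport χ
  · obtain ⟨e1, e2, e3⟩ := h x hx
    have hq : m x / targetDensity V x = ρ x := by rw [e1]; field_simp [(hpos x).ne']
    have hd := gradient_mul' (hχ.differentiableAt x) (hp.differentiable one_ne_zero x)
    rw [hd, gradient_targetDensity hV]
    simp only [perspective, hq, e2, e3, smul_eq_mul, RCLike.inner_apply, conj_trivial, inner_add_right,
      real_inner_smul_right, inner_neg_right, smul_add, smul_neg]
    rw [e1]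
    field_simp [(hpos x).ne']
    ring
  · have h0 : χ x = 0 := image_eq_zero_of_notMem_tsupport hx
    have h1 : gradient χ x = 0 := by
      by_contra h
      exact hx (support_gradient_subset χ h)
    have hd := gradient_mul' (hχ.differentiableAt x) (hp.differentiable one_ne_zero x)
    rw [hd, h0, h1]
    simp

/-- The chain rule at positive scale, and its limit, for densities with respect to the target. -/
theorem exists_renormFlux_target_le_and_tendsto [IsProbabilityMeasure (target V)]
    (hV : ContDiff ℝ 1 V) (hint : Integrable (fun x => Real.exp (-V x)) volume)
    (hβ : IsRenormalization β β' K) (hχ : IsTestFunction χ) :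
    ∃ C : ℝ, 0 ≤ C ∧ ∀ (ρ u g : EuclideanSpace ℝ (Fin d) → ℝ)
      (v : EuclideanSpace ℝ (Fin d) → EuclideanSpace ℝ (Fin d)), MemLp ρ 2 (target V) →
      HasWeakGradient (target V) u v → MemLp g 2 (target V) →
      (∀ ψ, IsTestFunction ψ →
        ∫ x, ⟪v x, gradient ψ x⟫ ∂(target V) = ∫ x, g x * ψ x ∂(target V)) →
      (∀ n, |renormFlux (targetDensity V) β' χ (fun x => targetDensity V x * ρ x) v n| ≤
        C * ((1 + (eLpNorm ρ 2 (target V)).toReal) * ((eLpNorm u 2 (target V)).toReal +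
          (eLpNorm v 2 (target V)).toReal + (eLpNorm g 2 (target V)).toReal))) ∧
      Tendsto (renormFlux (targetDensity V) β' χ (fun x => targetDensity V x * ρ x) v) atTop
        (𝓝 (∫ x, (χ x * (g x * (β (ρ x) - ρ x * β' (ρ x))) - β (ρ x) * ⟪v x, gradient χ x⟫)
          ∂(target V))) := by
  have hp := contDiff_targetDensity hV
  have hpos := targetDensity_pos hint
  obtain ⟨C, hC0, hC⟩ := exists_renormFlux_le_and_tendsto hβ hp hpos hχ
  obtain ⟨r, hr⟩ := hχ.2.isBounded.subset_closedBall (0 : EuclideanSpace ℝ (Fin d))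
  -- With this `N` the unit neighbourhood of the support of `χ` lies in the open ball of radius `N +
  -- 1`, where the cutoff is identically one and its derivatives vanish.
  obtain ⟨N, hN⟩ := exists_nat_ge (r + 1)
  have hcut := isTestFunction_cutoff (d := d) N
  have hnear : ∀ x y, x ∈ tsupport χ → ‖x - y‖ ≤ 1 → ‖y‖ < (N : ℝ) + 1 := by
    intro x y hx hxy
    have h1 := hr hx
    rw [mem_closedBall_zero_iff] at h1
    have h2 : ‖y‖ ≤ ‖x‖ + ‖x - y‖ := by
      calc ‖y‖ = ‖x - (x - y)‖ := by congr 1; abel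
        _ ≤ _ := norm_sub_le _ _
    linarith
  have hθc : Continuous fun x => cutoff N x * targetDensity V x := hcut.1.continuous.mul hp.continuous
  have hθs : HasCompactSupport fun x => cutoff N x * targetDensity V x := hcut.2.mul_right
  obtain ⟨C₁, h₁⟩ := exists_eLpNorm_volume_le hV hint hθc hθs
  obtain ⟨C₂, h₂⟩ := exists_eLpNorm_localGradient_le hV hint hcut
  obtain ⟨C₃, h₃⟩ := exists_eLpNorm_localSource_le hV hint hcut
  refine ⟨C * ((1 + C₁) * (C₂ + C₃)), by positivity, fun ρ u g v hρ hu hg hweak => ?_⟩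
  have hm : MemLp (fun x => cutoff N x * targetDensity V x * ρ x) 2 volume :=
    memLp_mul_volume hV hint hθc hθs hρ
  have hw := hu.localize hV hint hcut
  have hG := (h₃ u v g hu.1 hu.2.1 hg).1
  obtain ⟨hb, ht⟩ := hC _ _ _ _ hm hw hG
    (fun ψ hψ => integral_inner_localGradient hV hint hcut hu hg hweak hψ)
  have hcongr : ∀ n, renormFlux (targetDensity V) β' χ (fun x => targetDensity V x * ρ x) v n =
      renormFlux (targetDensity V) β' χ (fun x => cutoff N x * targetDensity V x * ρ x)
        (localGradient (cutoff N) u v) n := by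
    refine renormFlux_congr _ fun x y hx hxy => ?_
    have hy := hnear x y (subset_tsupport _ hx) hxy
    rw [localGradient, cutoff_eq_one hy.le, gradient_cutoff_eq_zero hy]
    simp
  constructor
  · intro n
    rw [hcongr]
    refine (hb n).trans ?_
    rw [mul_assoc C]
    refine mul_le_mul_of_nonneg_left ?_ hC0
    have a1 := ENNReal.toReal_mono (by finiteness [hρ.2.ne])
      (h₁ ρ (fun x => cutoff N x * targetDensity V x * ρ x) fun x => by rw [norm_mul])
    have a2 := ENNReal.toReal_mono (by finiteness [hu.1.2.ne, hu.2.1.2.ne]) (h₂ u v hu.1 hu.2.1)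
    have a3 := ENNReal.toReal_mono (by finiteness [hu.1.2.ne, hu.2.1.2.ne, hg.2.ne])
      (h₃ u v g hu.1 hu.2.1 hg).2
    rw [ENNReal.toReal_mul, ENNReal.coe_toReal] at a1 a2 a3
    rw [ENNReal.toReal_add hu.1.2.ne hu.2.1.2.ne] at a2
    rw [ENNReal.toReal_add (by finiteness [hu.1.2.ne, hu.2.1.2.ne]) hg.2.ne,
      ENNReal.toReal_add hu.1.2.ne hu.2.1.2.ne] at a3
    have n1 : 0 ≤ (eLpNorm ρ 2 (target V)).toReal := ENNReal.toReal_nonneg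
    have n2 : 0 ≤ (eLpNorm u 2 (target V)).toReal := ENNReal.toReal_nonneg
    have n3 : 0 ≤ (eLpNorm v 2 (target V)).toReal := ENNReal.toReal_nonneg
    have n4 : 0 ≤ (eLpNorm g 2 (target V)).toReal := ENNReal.toReal_nonneg
    rw [mul_mul_mul_comm]
    gcongr
    · have : 0 ≤ (C₁ : ℝ) := C₁.2
      nlinarith
    · have : 0 ≤ (C₂ : ℝ) * (eLpNorm g 2 (target V)).toReal := by positivity
      linarith
  · rw [funext hcongr]
    rw [renormFluxLimit_eq hV hint hβ hχ hm hw.2.1 hG (ρ := ρ) (g := g) (v := v)] at ht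
    · exact ht
    · intro x hx
      have hy := hnear x x hx (by simp)
      rw [localGradient, localSource, cutoff_eq_one hy.le, gradient_cutoff_eq_zero hy,
        laplacian_cutoff_eq_zero hy]
      simp

end StaticLocal

/-! ### Chain rule in time and joint measurability -/

section RealVariable

lemma LipschitzWith.comp_absolutelyContinuousOnInterval {B f : ℝ → ℝ} {K : ℝ≥0}
    (hB : LipschitzWith K B) {a b : ℝ} (hf : AbsolutelyContinuousOnInterval f a b) :
    AbsolutelyContinuousOnInterval (fun t => B (f t)) a b := by
  rw [absolutelyContinuousOnInterval_iff] at hf ⊢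
  intro ε hε
  obtain ⟨δ, hδ, h⟩ := hf (ε / (K + 1)) (by positivity)
  refine ⟨δ, hδ, fun E h1 h2 => ?_⟩
  calc ∑ i ∈ Finset.range E.1, dist (B (f (E.2 i).1)) (B (f (E.2 i).2))
      ≤ ∑ i ∈ Finset.range E.1, K * dist (f (E.2 i).1) (f (E.2 i).2) :=
        Finset.sum_le_sum fun i _ => hB.dist_le_mul _ _
    _ = K * ∑ i ∈ Finset.range E.1, dist (f (E.2 i).1) (f (E.2 i).2) := by rw [Finset.mul_sum]
    _ ≤ K * (ε / (K + 1)) := by gcongr; exact (h E h1 h2).le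
    _ < (K + 1) * (ε / (K + 1)) := by gcongr; linarith
    _ = ε := by field_simp

/-- The chain rule for primitives of integrable functions. -/
lemma sub_eq_integral_deriv_comp_mul {h A β β' : ℝ → ℝ} {K : ℝ≥0} {a b : ℝ} (hab : a ≤ b)
    (hA : IntervalIntegrable A volume a b) (hh : ∀ t ∈ Icc a b, h t = h a + ∫ s in a..t, A s)
    (hL : LipschitzWith K β) (hβ : ∀ r, HasDerivAt β (β' r) r) :
    β (h b) - β (h a) = ∫ s in a..b, β' (h s) * A s := by
  have hac := hA.absolutelyContinuousOnInterval_intervalIntegral (c := a) left_mem_uIcc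
  have hB : LipschitzWith K fun r => β (h a + r) := by
    refine LipschitzWith.of_dist_le_mul fun x y => ?_
    simpa using hL.dist_le_mul (h a + x) (h a + y)
  -- A Lipschitz function of a primitive is absolutely continuous, hence the integral of its
  -- derivative. At Lebesgue points of `A` that derivative comes from the ordinary chain rule.
  have key := (hB.comp_absolutelyContinuousOnInterval hac).integral_deriv_eq_sub
  simp only [intervalIntegral.integral_same, add_zero] at key
  rw [← hh b (right_mem_Icc.2 hab)] at key
  rw [← key]
  refine intervalIntegral.integral_congr_ae ?_
  filter_upwards [hA.ae_hasDerivAt_integral] with s hs hs'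
  have hmem : s ∈ Icc a b := by
    rw [uIoc_of_le hab] at hs'
    exact Ioc_subset_Icc_self hs'
  have h1 := (hs (by rwa [uIcc_of_le hab]) a left_mem_uIcc).const_add (h a)
  have h2 := (hβ (h a + ∫ s in a..s, A s)).comp s h1
  rw [hh s hmem]
  exact h2.deriv

/-- A function which is measurable in the first variable and continuous in the second one agrees
with a jointly measurable function. -/
lemma exists_stronglyMeasurable_uncurry {E : Type*} [TopologicalSpace E]
    [Nonempty E] [TopologicalSpace.MetrizableSpace E] [SecondCountableTopology E] [MeasurableSpace E]
    [OpensMeasurableSpace E] {ν : Measure ℝ} {f : ℝ → E → ℝ}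
    (hm : ∀ x, AEStronglyMeasurable (fun s => f s x) ν) (hc : ∀ᵐ s ∂ν, Continuous (f s)) :
    ∃ g : ℝ → E → ℝ, StronglyMeasurable (Function.uncurry g) ∧ ∀ᵐ s ∂ν, g s = f s := by
  choose F hF hfF using hm
  -- A single null set serves all points of a countable dense set. Off that set the sections are
  -- continuous, so every other point is reached by a limit.
  have hall : ∀ᵐ s ∂ν, Continuous (f s) ∧ ∀ k, f s (TopologicalSpace.denseSeq E k) =
      F (TopologicalSpace.denseSeq E k) s :=
    hc.and (ae_all_iff.2 fun k => hfF _)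
  obtain ⟨N, hN, hNm, hN0⟩ := exists_measurable_superset_of_null (ae_iff.1 hall)
  have hgood : ∀ s, s ∉ N → Continuous (f s) ∧ ∀ k, f s (TopologicalSpace.denseSeq E k) =
      F (TopologicalSpace.denseSeq E k) s := by
    intro s hs
    by_contra h
    exact hs (hN h)
  obtain ⟨g, hg⟩ : ∃ g : ℝ → E → ℝ, g = fun s x => Nᶜ.indicator (fun s => f s x) s := ⟨_, rfl⟩
  have hgs : ∀ s, Continuous (g s) := by
    intro s
    by_cases hs : s ∈ N
    · have : g s = fun _ => 0 := by
        rw [hg]; ext x; exact indicator_of_notMem (by simpa using hs) _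
      rw [this]
      exact continuous_const
    · have : g s = f s := by
        rw [hg]; ext x; exact indicator_of_mem (by simpa using hs) _
      rw [this]
      exact (hgood s hs).1
  have hgd : ∀ k, StronglyMeasurable fun s => g s (TopologicalSpace.denseSeq E k) := by
    intro k
    have : (fun s => g s (TopologicalSpace.denseSeq E k)) =
        Nᶜ.indicator (F (TopologicalSpace.denseSeq E k)) := by
      rw [hg]
      ext s
      by_cases hs : s ∈ N
      · simp [hs]
      · simp only [indicator, mem_compl_iff, hs, not_false_eq_true, if_true]
        exact (hgood s hs).2 k
    rw [this]
    exact (hF _).indicator hNm.compl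
  have hgx : ∀ x, StronglyMeasurable fun s => g s x := by
    intro x
    obtain ⟨z, hz, hzx⟩ := mem_closure_iff_seq_limit.1 (TopologicalSpace.denseRange_denseSeq E x)
    choose k hk using hz
    refine stronglyMeasurable_of_tendsto atTop (fun n => hgd (k n)) (tendsto_pi_nhds.2 fun s => ?_)
    have := ((hgs s).tendsto x).comp hzx
    refine this.congr fun n => ?_
    simp only [Function.comp, hk]
  have hswap : StronglyMeasurable (Function.uncurry fun x s => g s x) :=
    stronglyMeasurable_uncurry_of_continuous_of_stronglyMeasurable hgs hgx
  refine ⟨g, hswap.comp_measurable measurable_swap, ?_⟩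
  have : ∀ᵐ s ∂ν, s ∉ N := measure_eq_zero_iff_ae_notMem.1 hN0
  filter_upwards [this] with s hs
  rw [hg]
  ext x
  exact indicator_of_mem (by simpa using hs) _

lemma continuousOn_of_eq_sub_integral {F A : ℝ → ℝ} {T : ℝ} (hT : 0 ≤ T)
    (hA : IntervalIntegrable A volume 0 T) (h : ∀ t, 0 ≤ t → F t = F 0 - ∫ s in (0 : ℝ)..t, A s) :
    ContinuousOn F (Icc 0 T) := by
  have hc := intervalIntegral.continuousOn_primitive_interval' hA left_mem_uIcc
  rw [uIcc_of_le hT] at hc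
  exact (continuousOn_const.sub hc).congr fun t ht => h t ht.1

end RealVariable

/-! ### Measurability of the norm of a weakly measurable curve -/

section Norm

variable {H : Type*} [NormedAddCommGroup H] [InnerProductSpace ℝ H]

/-- Parseval writes the squared norm as a limit of sums of squared coefficients. The curve of
densities is not assumed measurable as a map into `L²`; only its coefficients are accessible. -/
lemma aestronglyMeasurable_norm_of_inner {α : Type*} [MeasurableSpace α] {ν : Measure α}
    (b : HilbertBasis ℕ ℝ H) {f : α → H}
    (h : ∀ i, AEStronglyMeasurable (fun s => ⟪b i, f s⟫) ν) :
    AEStronglyMeasurable (fun s => ‖f s‖) ν := by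
  have h1 : ∀ s, Tendsto (fun n => ∑ i ∈ Finset.range n, ⟪b i, f s⟫ * ⟪b i, f s⟫) atTop
      (𝓝 (‖f s‖ ^ 2)) := by
    intro s
    have := (b.hasSum_inner_mul_inner (f s) (f s)).tendsto_sum_nat
    rw [real_inner_self_eq_norm_sq] at this
    refine this.congr fun n => Finset.sum_congr rfl fun i _ => ?_
    rw [real_inner_comm]
  have h2 : AEStronglyMeasurable (fun s => ‖f s‖ ^ 2) ν := by
    refine aestronglyMeasurable_of_tendsto_ae atTop (fun n => ?_) (Eventually.of_forall h1)
    refine Finset.aestronglyMeasurable_fun_sum _ fun i _ => (h i).mul (h i)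
  refine (Real.continuous_sqrt.comp_aestronglyMeasurable h2).congr (Eventually.of_forall fun s => ?_)
  simp [Real.sqrt_sq (norm_nonneg _)]

end Norm

/-! ### From the weak solution to the elliptic equation at almost every time -/

section Flow

variable {d : ℕ} {V : EuclideanSpace ℝ (Fin d) → ℝ}

/-- A weak solution of the flow together with its density `ρ`, potential `u` and velocity `v`, where
the elliptic equation for `u` and the resulting bounds are recorded. -/
structure IsRegularFlow (V : EuclideanSpace ℝ (Fin d) → ℝ) [IsFiniteMeasure (target V)]
    (μ : ℝ → Measure (EuclideanSpace ℝ (Fin d))) (ρ u : ℝ → Lp ℝ 2 (target V))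
    (v : ℝ → Lp (EuclideanSpace ℝ (Fin d)) 2 (target V)) (C : ℝ) : Prop where
  prob : ∀ t, 0 ≤ t → IsProbabilityMeasure (μ t)
  ac : ∀ t, 0 ≤ t → μ t ≪ target V
  integrableOn : ∀ T, IntegrableOn (fun s => (1 + ‖ρ s‖) ^ 2) (Ioc 0 T)
  density : ∀ᵐ s ∂(volume.restrict (Ioi (0 : ℝ))),
    ∀ᵐ x ∂(target V), ρ s x = ((μ s).rnDeriv (target V) x).toReal
  triple : ∀ᵐ s ∂(volume.restrict (Ioi (0 : ℝ))),
    IsLangevinTriple V (u s) (v s) (ρ s - Lp.const 2 (target V) (1 : ℝ))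
  bound : ∀ᵐ s ∂(volume.restrict (Ioi (0 : ℝ))),
    ‖u s‖ + ‖v s‖ + ‖ρ s - Lp.const 2 (target V) (1 : ℝ)‖ ≤ C * (1 + ‖ρ s‖)
  intervalIntegrable : ∀ ψ, IsTestFunction ψ → ∀ t : ℝ, 0 ≤ t →
    IntervalIntegrable (fun s => ∫ x, ⟪gradient ψ x, v s x⟫ ∂(μ s)) volume 0 t
  weak : ∀ ψ, IsTestFunction ψ → ∀ t : ℝ, 0 ≤ t →
    (∫ x, ψ x ∂(μ t)) =
      (∫ x, ψ x ∂(μ 0)) - ∫ s in (0 : ℝ)..t, (∫ x, ⟪gradient ψ x, v s x⟫ ∂(μ s))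

lemma integral_eq_integral_density_mul {α : Type*} [MeasurableSpace α] {μ ν : Measure α}
    [SigmaFinite μ] [SigmaFinite ν] (h : μ ≪ ν) {ρ : α → ℝ}
    (hρ : ∀ᵐ x ∂ν, ρ x = (μ.rnDeriv ν x).toReal) (f : α → ℝ) :
    ∫ x, f x ∂μ = ∫ x, ρ x * f x ∂ν := by
  rw [← integral_rnDeriv_smul h]
  refine integral_congr_ae ?_
  filter_upwards [hρ] with x hx
  rw [hx, smul_eq_mul]

variable [IsProbabilityMeasure (target V)]

lemma norm_Lp_const_one : ‖Lp.const 2 (target V) (1 : ℝ)‖ = 1 := by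
  rw [Lp.norm_const']
  · simp
  · norm_num
  · norm_num

variable {lam : ℕ → ℝ} {φ : HilbertBasis ℕ ℝ (Lp ℝ 2 (target V))}

/-- The kernel omits the zero mode, so constants are invisible to it. This replaces the density by
its mean-zero part. -/
lemma IsSpectralKernelImage.sub_one (hV : ContDiff ℝ 1 V) (h : HasDiscreteSpectrum V lam φ)
    {C : ℝ≥0} (hP : PoincareInequality (target V) C) {f u : Lp ℝ 2 (target V)}
    (hu : IsSpectralKernelImage lam φ f u) :
    IsSpectralKernelImage lam φ (f - Lp.const 2 (target V) (1 : ℝ)) u := by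
  unfold IsSpectralKernelImage at hu ⊢
  simp_rw [inner_sub_right, h.inner_one_eq_zero hV hP, sub_zero]
  exact hu

lemma IsSpectralKernelImage.inner_one (hV : ContDiff ℝ 1 V) (h : HasDiscreteSpectrum V lam φ)
    {C : ℝ≥0} (hP : PoincareInequality (target V) C) {f u : Lp ℝ 2 (target V)}
    (hu : IsSpectralKernelImage lam φ f u) :
    ⟪Lp.const 2 (target V) (1 : ℝ), u⟫ = 0 := by
  have h1 := HasSum.mapL (innerSL ℝ (Lp.const 2 (target V) (1 : ℝ))) hu
  have h2 : ∀ i, innerSL ℝ (Lp.const 2 (target V) (1 : ℝ))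
      (((lam (i + 1))⁻¹ * ⟪φ (i + 1), f⟫) • φ (i + 1)) = 0 := by
    intro i
    rw [innerSL_apply_apply, real_inner_smul_right,
      real_inner_comm (φ (i + 1)), h.inner_one_eq_zero hV hP, mul_zero]
  simp_rw [h2] at h1
  exact h1.unique hasSum_zero

/-- Poincaré and the energy identity give `‖u‖² ≤ C ‖v‖² ≤ C ‖g‖ ‖u‖`; one factor cancels, and the
bound on `v` follows. -/
lemma PoincareInequality.norm_le {C : ℝ≥0} (hP : PoincareInequality (target V) C)
    {u g : Lp ℝ 2 (target V)} {v : Lp (EuclideanSpace ℝ (Fin d)) 2 (target V)}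
    (h : IsLangevinTriple V u v g) (hu : ⟪Lp.const 2 (target V) (1 : ℝ), u⟫ = 0) :
    ‖u‖ ≤ C * ‖g‖ ∧ ‖v‖ ≤ (1 + C) * ‖g‖ := by
  have h1 := hP.norm_sub_mean_le h.1
  rw [hu, zero_smul, sub_zero] at h1
  have h2 : ‖u‖ ^ 2 ≤ C * ‖v‖ ^ 2 := by
    rw [← ofReal_norm, ← ofReal_norm, ← ENNReal.ofReal_pow (norm_nonneg _),
      ← ENNReal.ofReal_pow (norm_nonneg _), ← ENNReal.ofReal_coe_nnreal,
      ← ENNReal.ofReal_mul C.coe_nonneg] at h1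
    exact (ENNReal.ofReal_le_ofReal_iff (by positivity)).1 h1
  have h3 := h.norm_sq_le
  have hC : (0 : ℝ) ≤ C := C.2
  have hu0 := norm_nonneg u
  have hg0 := norm_nonneg g
  have h4 : ‖u‖ ≤ C * ‖g‖ := by
    by_contra! hlt
    have hpos : 0 < ‖u‖ := lt_of_le_of_lt (by positivity) hlt
    have : ‖u‖ ^ 2 ≤ C * (‖g‖ * ‖u‖) := h2.trans (by gcongr)
    nlinarith
  refine ⟨h4, ?_⟩
  refine abs_le_of_sq_le_sq' ?_ (by positivity) |>.2
  calc ‖v‖ ^ 2 ≤ ‖g‖ * (C * ‖g‖) := h3.trans (by gcongr)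
    _ ≤ ((1 + C) * ‖g‖) ^ 2 := by nlinarith [mul_nonneg hC (sq_nonneg ‖g‖), sq_nonneg (C * ‖g‖), sq_nonneg ‖g‖]

/-- Mass conservation gives the density mean one, so inversion of the generator applies to `ρ - 1`.
The constant is `C + (1 + C) + 1`, from the bounds on `u`, `v` and `ρ - 1`. The Poincaré constant is
used only qualitatively, for integrability in time. -/
lemma IsLAWGDFlow.exists_isRegularFlow (hV : ContDiff ℝ 1 V)
    (hint : Integrable (fun x => Real.exp (-V x)) volume) (h : HasDiscreteSpectrum V lam φ)
    {C : ℝ≥0} (hP : PoincareInequality (target V) C)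
    {μ : ℝ → Measure (EuclideanSpace ℝ (Fin d))} (hμ : IsLAWGDFlow V lam φ μ) :
    ∃ ρ u v, IsRegularFlow V μ ρ u v (2 + 2 * C) := by
  obtain ⟨ρ, u, v, hρ, hslice, hweak⟩ := hμ.weak
  have hprob := hμ.prob
  have hac : ∀ t, 0 ≤ t → μ t ≪ target V := fun t ht =>
    (hμ.ac t ht).trans (absolutelyContinuous_target hint)
  have hmean : ∀ᵐ s ∂(volume.restrict (Ioi (0 : ℝ))),
      ⟪Lp.const 2 (target V) (1 : ℝ), ρ s⟫ = 1 := by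
    filter_upwards [hslice, ae_restrict_mem measurableSet_Ioi] with s hs hs0
    have := hprob s (le_of_lt hs0)
    have e := integral_eq_integral_density_mul (hac s (le_of_lt hs0)) hs.1 (fun _ => 1)
    rw [inner_const_one]
    simpa using e.symm
  have htriple : ∀ᵐ s ∂(volume.restrict (Ioi (0 : ℝ))),
      IsLangevinTriple V (u s) (v s) (ρ s - Lp.const 2 (target V) (1 : ℝ)) := by
    filter_upwards [hslice, hmean] with s hs hm
    refine IsLangevin.isLangevinTriple hV ?_ hs.2.2
    refine (h.isSpectralKernelImage_iff hV hP ?_ ?_).1 (hs.2.1.sub_one hV h hP)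
    · rw [← inner_const_one, hs.2.1.inner_one hV h hP]
    · rw [← inner_const_one, inner_sub_right, hm, real_inner_self_eq_norm_sq, norm_Lp_const_one]
      norm_num
  have hbound : ∀ᵐ s ∂(volume.restrict (Ioi (0 : ℝ))),
      ‖u s‖ + ‖v s‖ + ‖ρ s - Lp.const 2 (target V) (1 : ℝ)‖ ≤ (2 + 2 * C) * (1 + ‖ρ s‖) := by
    filter_upwards [hslice, htriple] with s hs ht
    obtain ⟨h1, h2⟩ := hP.norm_le ht (hs.2.1.inner_one hV h hP)
    have h3 : ‖ρ s - Lp.const 2 (target V) (1 : ℝ)‖ ≤ 1 + ‖ρ s‖ := by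
      refine (norm_sub_le _ _).trans ?_
      rw [norm_Lp_const_one, add_comm]
    have hC : (0 : ℝ) ≤ C := C.2
    nlinarith
  refine ⟨ρ, u, v, hprob, hac, fun T => ?_, hslice.mono fun s hs => hs.1, htriple, hbound,
    fun ψ hψ t ht => (hweak ψ hψ t ht).1, fun ψ hψ t ht => (hweak ψ hψ t ht).2⟩
  rcases lt_or_ge T 0 with hT | hT
  · rw [Ioc_eq_empty (by linarith)]
    exact integrableOn_empty
  have hsub : volume.restrict (Ioc 0 T) ≤ volume.restrict (Ioi (0 : ℝ)) :=
    Measure.restrict_mono Ioc_subset_Ioi_self le_rfl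
  have hψm : ∀ ψ, IsTestFunction ψ →
      AEStronglyMeasurable (fun s => ∫ x, ψ x ∂(μ s)) (volume.restrict (Ioc 0 T)) := by
    intro ψ hψ
    have hc := continuousOn_of_eq_sub_integral hT (hweak ψ hψ T hT).1
      (fun t ht => (hweak ψ hψ t ht).2)
    exact (hc.mono Ioc_subset_Icc_self).aestronglyMeasurable measurableSet_Ioc
  -- Each eigenfunction is an `L²` limit of test functions, and integrals of test functions against
  -- `μ s` are continuous in `s` by the weak equation.
  have hin : ∀ i, AEStronglyMeasurable (fun s => ⟪φ i, ρ s⟫) (volume.restrict (Ioc 0 T)) := by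
    intro i
    obtain ⟨G, hG⟩ := (h.eigen i).1
    obtain ⟨h1, -, ψ, hψ, h3, -⟩ := mem_sobolevGraph_iff.1 hG
    refine aestronglyMeasurable_of_tendsto_ae atTop (fun n => hψm (ψ n) (hψ n)) ?_
    filter_upwards [ae_mono hsub hslice, ae_restrict_mem measurableSet_Ioc] with s hs hs0
    have := hprob s hs0.1.le
    rw [inner_Lp_real]
    have t := tendsto_integral_mul_of_eLpNorm (l := atTop) (fun n => (hψ n).memLp (target V) 2) h1
      (f := fun _ => ρ s) (fun _ => Lp.memLp (ρ s)) (Lp.memLp (ρ s)) h3 (by simp)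
    refine t.congr fun n => ?_
    rw [integral_eq_integral_density_mul (hac s hs0.1.le) hs.1]
    simp_rw [mul_comm]
  have hn := aestronglyMeasurable_norm_of_inner φ hin
  have hsq : IntegrableOn (fun s => ‖ρ s‖ ^ 2) (Ioc 0 T) := by
    refine ⟨hn.pow 2, ?_⟩
    rw [HasFiniteIntegral]
    refine lt_of_le_of_lt (lintegral_mono fun s => ?_) (hρ T)
    rw [enorm_pow, enorm_norm]
  have h2 : Integrable (fun s => 2 * (1 + ‖ρ s‖ ^ 2)) (volume.restrict (Ioc 0 T)) :=
    ((integrable_const 1).add hsq).const_mul 2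
  refine h2.mono' ((aestronglyMeasurable_const.add hn).pow 2) (Eventually.of_forall fun s => ?_)
  rw [Real.norm_of_nonneg (by positivity)]
  nlinarith [sq_nonneg (1 - ‖ρ s‖)]

end Flow

/-! ### Time evolution of the mollified density -/

section TimeEvolution

variable {d : ℕ} {V : EuclideanSpace ℝ (Fin d) → ℝ}

lemma isTestFunction_mollifier_const_sub (n : ℕ) (x : EuclideanSpace ℝ (Fin d)) :
    IsTestFunction fun y => mollifier n (x - y) :=
  ⟨(contDiff_mollifier n).comp (contDiff_const.sub contDiff_id),
    (hasCompactSupport_mollifier n).comp_homeomorph (Homeomorph.subLeft x)⟩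

/-- The mollified density of a measure. -/
def mollifyMeasure (n : ℕ) (ν : Measure (EuclideanSpace ℝ (Fin d))) (x : EuclideanSpace ℝ (Fin d)) :
    ℝ := ∫ y, mollifier n (x - y) ∂ν

/-- The mollified divergence of the flux `v • ν`. -/
def mollifyFlux (n : ℕ) (ν : Measure (EuclideanSpace ℝ (Fin d)))
    (v : EuclideanSpace ℝ (Fin d) → EuclideanSpace ℝ (Fin d)) (x : EuclideanSpace ℝ (Fin d)) : ℝ :=
  ∫ y, ⟪gradient (mollifier n) (x - y), v y⟫ ∂ν

lemma continuous_mollifyMeasure (n : ℕ) (ν : Measure (EuclideanSpace ℝ (Fin d)))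
    [IsFiniteMeasure ν] : Continuous (mollifyMeasure n ν) := by
  have hc : Continuous (mollifier n : EuclideanSpace ℝ (Fin d) → ℝ) :=
    (contDiff_mollifier n).continuous
  obtain ⟨C, hC⟩ := hc.bounded_above_of_compact_support (hasCompactSupport_mollifier n)
  refine continuous_of_dominated (bound := fun _ => C)
    (fun x => (hc.comp (continuous_const.sub continuous_id)).aestronglyMeasurable)
    (fun x => Eventually.of_forall fun y => hC _) (integrable_const C)
    (Eventually.of_forall fun y => hc.comp (continuous_id.sub continuous_const))

variable {ν : Measure (EuclideanSpace ℝ (Fin d))} {ρ : EuclideanSpace ℝ (Fin d) → ℝ}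
  {v : EuclideanSpace ℝ (Fin d) → EuclideanSpace ℝ (Fin d)}

lemma mollifyMeasure_eq_mollify [SigmaFinite ν] [SigmaFinite (target V)] (n : ℕ)
    (hν : ν ≪ target V) (hρ : ∀ᵐ x ∂(target V), ρ x = (ν.rnDeriv (target V) x).toReal) :
    mollifyMeasure n ν = mollify n fun x => targetDensity V x * ρ x := by
  ext x
  rw [mollifyMeasure, integral_eq_integral_density_mul hν hρ, integral_target, mollify]
  congr 1
  ext y
  simp only [smul_eq_mul]
  ring

lemma mollifyFlux_eq [SigmaFinite ν] [SigmaFinite (target V)] (n : ℕ)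
    (hν : ν ≪ target V) (hρ : ∀ᵐ x ∂(target V), ρ x = (ν.rnDeriv (target V) x).toReal)
    (x : EuclideanSpace ℝ (Fin d)) :
    mollifyFlux n ν v x =
      ∫ y, targetDensity V y * ρ y * ⟪gradient (mollifier n) (x - y), v y⟫ := by
  rw [mollifyFlux, integral_eq_integral_density_mul hν hρ, integral_target]
  congr 1
  ext y
  simp only [smul_eq_mul]
  ring

lemma mollifyFlux_eq_target [SigmaFinite ν] [SigmaFinite (target V)] (n : ℕ)
    (hν : ν ≪ target V) (hρ : ∀ᵐ x ∂(target V), ρ x = (ν.rnDeriv (target V) x).toReal)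
    (x : EuclideanSpace ℝ (Fin d)) :
    mollifyFlux n ν v x = ∫ y, ⟪gradient (mollifier n) (x - y), ρ y • v y⟫ ∂(target V) := by
  rw [mollifyFlux, integral_eq_integral_density_mul hν hρ]
  simp_rw [real_inner_smul_right]

/-- A bound for the gradient of the mollifier. -/
lemma exists_norm_gradient_mollifier_le (d n : ℕ) : ∃ C : ℝ, 0 ≤ C ∧
    ∀ z : EuclideanSpace ℝ (Fin d), ‖gradient (mollifier n) z‖ ≤ C := by
  obtain ⟨C, hC⟩ := (continuous_gradient_mollifier
    (E := EuclideanSpace ℝ (Fin d)) n).bounded_above_of_compact_support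
    (hasCompactSupport_mollifier n).gradient
  exact ⟨C, (norm_nonneg _).trans (hC 0), hC⟩

lemma integrable_smul_of_memLp_two {α F : Type*} [MeasurableSpace α] {ν : Measure α}
    [NormedAddCommGroup F] [NormedSpace ℝ F] {f : α → ℝ} {g : α → F} (hf : MemLp f 2 ν)
    (hg : MemLp g 2 ν) : Integrable (fun y => f y • g y) ν := by
  have h : MemLp (f • g) 1 ν := hg.smul hf
  exact memLp_one_iff_integrable.1 h

lemma continuous_mollifyFlux [SigmaFinite ν] [SigmaFinite (target V)] (n : ℕ)
    (hν : ν ≪ target V) (hρ : ∀ᵐ x ∂(target V), ρ x = (ν.rnDeriv (target V) x).toReal)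
    (hρ2 : MemLp ρ 2 (target V)) (hv : MemLp v 2 (target V)) : Continuous (mollifyFlux n ν v) := by
  rw [funext (mollifyFlux_eq_target (v := v) n hν hρ)]
  obtain ⟨C, hC0, hC⟩ := exists_norm_gradient_mollifier_le d n
  have hi := integrable_smul_of_memLp_two hρ2 hv
  have hc := continuous_gradient_mollifier (E := EuclideanSpace ℝ (Fin d)) n
  obtain ⟨w, hw⟩ : ∃ w, w = fun y => ρ y • v y := ⟨_, rfl⟩
  rw [← hw] at hi
  have hcx : ∀ x, Continuous fun y => gradient (mollifier n) (x - y) := fun x =>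
    hc.comp (continuous_const.sub continuous_id)
  have hcy : ∀ y, Continuous fun x => gradient (mollifier n) (x - y) := fun y =>
    hc.comp (continuous_id.sub continuous_const)
  have key : Continuous fun x => ∫ y, ⟪gradient (mollifier n) (x - y), w y⟫ ∂(target V) := by
    refine continuous_of_dominated (bound := fun y => C * ‖w y‖)
      (fun x => (hcx x).aestronglyMeasurable.inner hi.1)
      (fun x => Eventually.of_forall fun y => ?_) (hi.norm.const_mul C)
      (Eventually.of_forall fun y => (hcy y).inner continuous_const)
    exact (norm_inner_le_norm _ _).trans (by gcongr; exact hC _)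
  rw [hw] at key
  exact key

lemma abs_mollifyFlux_le [SigmaFinite ν] [SigmaFinite (target V)] {n : ℕ}
    (hν : ν ≪ target V) (hρ : ∀ᵐ x ∂(target V), ρ x = (ν.rnDeriv (target V) x).toReal)
    (hρ2 : MemLp ρ 2 (target V)) (hv : MemLp v 2 (target V)) {C : ℝ} (hC0 : 0 ≤ C)
    (hC : ∀ z : EuclideanSpace ℝ (Fin d), ‖gradient (mollifier n) z‖ ≤ C)
    (x : EuclideanSpace ℝ (Fin d)) :
    |mollifyFlux n ν v x| ≤
      C * ((eLpNorm ρ 2 (target V)).toReal * (eLpNorm v 2 (target V)).toReal) := by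
  rw [mollifyFlux_eq_target (v := v) n hν hρ, ← Real.norm_eq_abs]
  have hi := integrable_smul_of_memLp_two hρ2 hv
  have h1 : ∫ y, ‖ρ y • v y‖ ∂(target V) ≤
      (eLpNorm ρ 2 (target V)).toReal * (eLpNorm v 2 (target V)).toReal := by
    have := (le_abs_self _).trans (abs_integral_mul_le hρ2.norm hv.norm)
    rw [eLpNorm_norm, eLpNorm_norm] at this
    simpa only [norm_smul] using this
  calc ‖∫ y, ⟪gradient (mollifier n) (x - y), ρ y • v y⟫ ∂(target V)‖
      ≤ ∫ y, C * ‖ρ y • v y‖ ∂(target V) := by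
        refine norm_integral_le_of_norm_le (hi.norm.const_mul C) (Eventually.of_forall fun y => ?_)
        exact (norm_inner_le_norm _ _).trans (by gcongr; exact hC _)
    _ ≤ _ := by
        rw [integral_const_mul]
        gcongr

section

variable [IsProbabilityMeasure (target V)] {μ : ℝ → Measure (EuclideanSpace ℝ (Fin d))}
  {ρ u : ℝ → Lp ℝ 2 (target V)} {v : ℝ → Lp (EuclideanSpace ℝ (Fin d)) 2 (target V)} {C : ℝ}

/-- The weak equation tested with the mollifier reflected about `x`; the sign of the reflected
gradient turns the minus of the weak form into a plus. -/
lemma IsRegularFlow.mollify_evolution (h : IsRegularFlow V μ ρ u v C) (n : ℕ)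
    (x : EuclideanSpace ℝ (Fin d)) {t : ℝ} (ht : 0 ≤ t) :
    IntervalIntegrable (fun s => mollifyFlux n (μ s) (v s) x) volume 0 t ∧
    mollifyMeasure n (μ t) x =
      mollifyMeasure n (μ 0) x + ∫ s in (0 : ℝ)..t, mollifyFlux n (μ s) (v s) x := by
  have hψ := isTestFunction_mollifier_const_sub n x
  have h1 := h.intervalIntegrable _ hψ t ht
  have h2 := h.weak _ hψ t ht
  simp_rw [gradient_mollifier_const_sub, inner_neg_left, integral_neg] at h1 h2
  have h3 := h1.neg
  simp only [Pi.neg_def, neg_neg] at h3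
  refine ⟨h3, ?_⟩
  rw [intervalIntegral.integral_neg, sub_neg_eq_add] at h2
  exact h2

lemma IsRegularFlow.ae_of_Ioc (h : IsRegularFlow V μ ρ u v C) {a b : ℝ} (ha : 0 ≤ a) :
    ∀ᵐ s ∂(volume.restrict (Ioc a b)), 0 ≤ s ∧ IsProbabilityMeasure (μ s) ∧ μ s ≪ target V ∧
      (∀ᵐ x ∂(target V), ρ s x = ((μ s).rnDeriv (target V) x).toReal) ∧
      IsLangevinTriple V (u s) (v s) (ρ s - Lp.const 2 (target V) (1 : ℝ)) ∧
      ‖u s‖ + ‖v s‖ + ‖ρ s - Lp.const 2 (target V) (1 : ℝ)‖ ≤ C * (1 + ‖ρ s‖) := by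
  have hsub : volume.restrict (Ioc a b) ≤ volume.restrict (Ioi (0 : ℝ)) :=
    Measure.restrict_mono (fun s hs => ha.trans_lt hs.1) le_rfl
  filter_upwards [ae_mono hsub h.density, ae_mono hsub h.triple, ae_mono hsub h.bound,
    ae_restrict_mem measurableSet_Ioc] with s h1 h2 h3 hs
  have hs0 : 0 ≤ s := ha.trans hs.1.le
  exact ⟨hs0, h.prob s hs0, h.ac s hs0, h1, h2, h3⟩

lemma IsRegularFlow.integrableOn_Ioc (h : IsRegularFlow V μ ρ u v C) {a b : ℝ} (ha : 0 ≤ a) :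
    IntegrableOn (fun s => (1 + ‖ρ s‖) ^ 2) (Ioc a b) :=
  (h.integrableOn b).mono_set (Ioc_subset_Ioc_left ha)

variable {β β' : ℝ → ℝ} {K : ℝ≥0} {χ : EuclideanSpace ℝ (Fin d) → ℝ}

/-- The integrand of the mollified entropy balance is integrable in time and space. -/
lemma IsRegularFlow.integrable_mollified (hV : ContDiff ℝ 1 V)
    (hint : Integrable (fun x => Real.exp (-V x)) volume) (h : IsRegularFlow V μ ρ u v C)
    (hβ : IsRenormalization β β' K) (hχ : IsTestFunction χ) (n : ℕ) {a b : ℝ} (ha : 0 ≤ a)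
    (hab : a ≤ b) :
    Integrable (Function.uncurry fun s x =>
      (χ x * β' (mollifyMeasure n (μ s) x / targetDensity V x)) * mollifyFlux n (μ s) (v s) x)
      ((volume.restrict (Ioc a b)).prod volume) := by
  have hp := contDiff_targetDensity hV
  have hpos := targetDensity_pos hint
  have hgood := h.ae_of_Ioc (b := b) ha
  have hIcc : Ioc a b ⊆ Icc 0 b := fun s hs => ⟨ha.trans hs.1.le, hs.2⟩
  have hb : 0 ≤ b := ha.trans hab
  have hM1 : ∀ x, AEStronglyMeasurable (fun s => mollifyMeasure n (μ s) x)
      (volume.restrict (Ioc a b)) := by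
    intro x
    obtain ⟨h1, -⟩ := h.mollify_evolution n x hb
    have hc := continuousOn_of_eq_sub_integral (F := fun s => mollifyMeasure n (μ s) x) hb h1.neg
      (fun t ht => by
        simp only [Pi.neg_apply, intervalIntegral.integral_neg, sub_neg_eq_add]
        exact (h.mollify_evolution n x ht).2)
    exact (hc.mono hIcc).aestronglyMeasurable measurableSet_Ioc
  have hA1 : ∀ x, AEStronglyMeasurable (fun s => mollifyFlux n (μ s) (v s) x)
      (volume.restrict (Ioc a b)) := fun x =>
    ((h.mollify_evolution n x hb).1.1.mono_set (Ioc_subset_Ioc_left ha)).1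
  -- The weak equation gives measurability in time at each point, while mollification gives
  -- continuity in space. Together they yield the joint measurability required by Fubini.
  obtain ⟨gM, hgM, hgM'⟩ := exists_stronglyMeasurable_uncurry hM1 (by
    filter_upwards [hgood] with s hs
    have := hs.2.1
    exact continuous_mollifyMeasure n (μ s))
  obtain ⟨gA, hgA, hgA'⟩ := exists_stronglyMeasurable_uncurry hA1 (by
    filter_upwards [hgood] with s hs
    have := hs.2.1
    exact continuous_mollifyFlux n hs.2.2.1 hs.2.2.2.1 (Lp.memLp _) (Lp.memLp _))
  obtain ⟨c, hc0, hc⟩ := exists_norm_gradient_mollifier_le d n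
  have hbd : Integrable (fun z : ℝ × EuclideanSpace ℝ (Fin d) =>
      (1 + ‖ρ z.1‖) ^ 2 * (‖χ z.2‖ * (K * (c * C)))) ((volume.restrict (Ioc a b)).prod volume) :=
    (h.integrableOn_Ioc ha).mul_prod
      ((hχ.1.continuous.integrable_of_hasCompactSupport hχ.2).norm.mul_const _)
  have hq := (Measure.quasiMeasurePreserving_fst (μ := volume.restrict (Ioc a b))
    (ν := (volume : Measure (EuclideanSpace ℝ (Fin d)))))
  refine hbd.mono' ?_ ?_
  · refine AEStronglyMeasurable.congr (f := fun z => (χ z.2 * β' (Function.uncurry gM z /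
      targetDensity V z.2)) * Function.uncurry gA z) ?_ ?_
    · refine StronglyMeasurable.aestronglyMeasurable ?_
      refine ((hχ.1.continuous.stronglyMeasurable.comp_measurable measurable_snd).mul
        (hβ.continuous_deriv.comp_stronglyMeasurable ?_)).mul hgA
      simp_rw [div_eq_mul_inv]
      exact hgM.mul ((hp.continuous.inv₀ fun x => (hpos x).ne').stronglyMeasurable.comp_measurable
        measurable_snd)
    · filter_upwards [hq.ae hgM', hq.ae hgA'] with z h1 h2
      simp only [Function.uncurry, h1, h2]
  · filter_upwards [hq.ae hgood] with z hz
    obtain ⟨-, hprob, hac, hd, -, hbnd⟩ := hz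
    have h1 := abs_mollifyFlux_le hac hd (Lp.memLp _) (Lp.memLp (v z.1)) hc0 hc z.2
    rw [← Lp.norm_def, ← Lp.norm_def] at h1
    have hv : ‖v z.1‖ ≤ C * (1 + ‖ρ z.1‖) := by
      linarith [norm_nonneg (u z.1), norm_nonneg (ρ z.1 - Lp.const 2 (target V) (1 : ℝ))]
    have hr := norm_nonneg (ρ z.1)
    have h2 : ‖mollifyFlux n (μ z.1) (v z.1) z.2‖ ≤ c * C * (1 + ‖ρ z.1‖) ^ 2 := by
      rw [Real.norm_eq_abs]
      refine h1.trans ?_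
      rw [mul_assoc]
      refine mul_le_mul_of_nonneg_left ?_ hc0
      calc ‖ρ z.1‖ * ‖v z.1‖ ≤ (1 + ‖ρ z.1‖) * (C * (1 + ‖ρ z.1‖)) := by
            gcongr
            linarith
        _ = _ := by ring
    simp only [Function.uncurry]
    rw [norm_mul, norm_mul]
    calc ‖χ z.2‖ * ‖β' (mollifyMeasure n (μ z.1) z.2 / targetDensity V z.2)‖ *
          ‖mollifyFlux n (μ z.1) (v z.1) z.2‖ ≤ ‖χ z.2‖ * K * (c * C * (1 + ‖ρ z.1‖) ^ 2) := by
          gcongr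
          exact hβ.bound _
      _ = _ := by ring

/-- The entropy balance at positive scale. -/
lemma IsRegularFlow.mollified_balance (hV : ContDiff ℝ 1 V)
    (hint : Integrable (fun x => Real.exp (-V x)) volume) (h : IsRegularFlow V μ ρ u v C)
    (hβ : IsRenormalization β β' K) (hχ : IsTestFunction χ) (n : ℕ) {a b : ℝ} (ha : 0 ≤ a)
    (hab : a ≤ b) :
    AEStronglyMeasurable (fun s => renormFlux (targetDensity V) β' χ
      (fun x => targetDensity V x * ρ s x) (v s) n) (volume.restrict (Ioc a b)) ∧
    (∫ x, perspective (targetDensity V) β (mollifyMeasure n (μ b)) x * χ x) -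
      (∫ x, perspective (targetDensity V) β (mollifyMeasure n (μ a)) x * χ x) =
      ∫ s in Ioc a b, renormFlux (targetDensity V) β' χ
        (fun x => targetDensity V x * ρ s x) (v s) n := by
  have hp := contDiff_targetDensity hV
  have hpos := targetDensity_pos hint
  have hI := h.integrable_mollified hV hint hβ hχ n ha hab
  have hb : 0 ≤ b := ha.trans hab
  have hinner : ∀ᵐ s ∂(volume.restrict (Ioc a b)),
      ∫ x, (χ x * β' (mollifyMeasure n (μ s) x / targetDensity V x)) *
        mollifyFlux n (μ s) (v s) x =
      renormFlux (targetDensity V) β' χ (fun x => targetDensity V x * ρ s x) (v s) n := by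
    filter_upwards [h.ae_of_Ioc (b := b) ha] with s hs
    obtain ⟨-, hprob, hac, hd, -, -⟩ := hs
    rw [mollifyMeasure_eq_mollify n hac hd, renormFlux]
    simp_rw [mollifyFlux_eq (v := v s) n hac hd]
  -- At fixed `x` the mollified density is absolutely continuous in time, so the one-variable chain
  -- rule applies to its quotient by `p`. The balance then follows by integrating in `x` and
  -- exchanging the integrals.
  have hpt : ∀ x, perspective (targetDensity V) β (mollifyMeasure n (μ b)) x * χ x -
      perspective (targetDensity V) β (mollifyMeasure n (μ a)) x * χ x =
      ∫ s in Ioc a b, (χ x * β' (mollifyMeasure n (μ s) x / targetDensity V x)) *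
        mollifyFlux n (μ s) (v s) x := by
    intro x
    have hA := (h.mollify_evolution n x hb).1
    have hA' : IntervalIntegrable (fun s => mollifyFlux n (μ s) (v s) x / targetDensity V x)
        volume a b := by
      refine (hA.mono_set ?_).div_const _
      rw [uIcc_of_le hab, uIcc_of_le hb]
      exact Icc_subset_Icc_left ha
    have key := sub_eq_integral_deriv_comp_mul
      (h := fun s => mollifyMeasure n (μ s) x / targetDensity V x) hab hA' (fun t ht => by
        have ht0 : 0 ≤ t := ha.trans ht.1
        have e1 := (h.mollify_evolution n x ha)
        have e2 := (h.mollify_evolution n x ht0)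
        have e3 := intervalIntegral.integral_interval_sub_left e2.1 e1.1
        rw [intervalIntegral.integral_div, ← e3, e2.2, e1.2]
        ring) hβ.lipschitzWith hβ.hasDerivAt
    rw [intervalIntegral.integral_of_le hab] at key
    rw [perspective, perspective, ← sub_mul, ← mul_sub, key, mul_right_comm, ← integral_const_mul]
    congr 1
    ext s
    field_simp [(hpos x).ne']
  have hcont : ∀ t, 0 ≤ t → Integrable fun x =>
      perspective (targetDensity V) β (mollifyMeasure n (μ t)) x * χ x := by
    intro t ht
    have := h.prob t ht
    refine Continuous.integrable_of_hasCompactSupport ?_ hχ.2.mul_left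
    exact (hp.continuous.mul (hβ.contDiff.continuous.comp ((continuous_mollifyMeasure n (μ t)).div
      hp.continuous fun x => (hpos x).ne'))).mul hχ.1.continuous
  refine ⟨hI.1.integral_prod_right'.congr hinner, ?_⟩
  rw [← integral_sub (hcont b hb) (hcont a ha), integral_congr_ae (Eventually.of_forall hpt),
    ← integral_integral_swap hI]
  exact integral_congr_ae hinner

end

end TimeEvolution

/-! ### Removal of the mollification and of the cutoff -/

section Balance

variable {d : ℕ} {V : EuclideanSpace ℝ (Fin d) → ℝ}

lemma integrable_perspective_mul {p m χ : EuclideanSpace ℝ (Fin d) → ℝ} {B : ℝ → ℝ} {K : ℝ≥0}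
    (hp : Continuous p) (hpos : ∀ x, 0 < p x) (hB : LipschitzWith K B) (hχ : Continuous χ)
    (hc : HasCompactSupport χ) (hm : Integrable m) :
    Integrable fun x => perspective p B m x * χ x := by
  obtain ⟨c, hcb⟩ := hχ.bounded_above_of_compact_support hc
  have i1 : Integrable fun x => p x * ‖B 0‖ * ‖χ x‖ :=
    ((hp.mul continuous_const).mul hχ.norm).integrable_of_hasCompactSupport hc.norm.mul_left
  refine (i1.add (hm.norm.const_mul (K * c))).mono'
    ((aestronglyMeasurable_perspective hp hpos hB.continuous hm.1).mul hχ.aestronglyMeasurable)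
    (Eventually.of_forall fun x => ?_)
  simp only [Pi.add_apply]
  rw [norm_mul]
  calc ‖perspective p B m x‖ * ‖χ x‖ ≤ (p x * ‖B 0‖ + K * ‖m x‖) * ‖χ x‖ := by
        gcongr
        exact norm_perspective_le hpos hB x
    _ ≤ p x * ‖B 0‖ * ‖χ x‖ + K * ‖m x‖ * c := by
        rw [add_mul]
        gcongr
        exact hcb x
    _ = _ := by ring

/-- Used at the endpoints of a time interval, where the density is known only to be integrable;
square integrability holds at almost every time only. -/
lemma tendsto_integral_perspective_mollify_mul {p m χ : EuclideanSpace ℝ (Fin d) → ℝ}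
    {B : ℝ → ℝ} {K : ℝ≥0} (hp : Continuous p) (hpos : ∀ x, 0 < p x) (hB : LipschitzWith K B)
    (hχ : Continuous χ) (hc : HasCompactSupport χ) (hm : Integrable m) :
    Tendsto (fun n => ∫ x, perspective p B (mollify n m) x * χ x) atTop
      (𝓝 (∫ x, perspective p B m x * χ x)) := by
  obtain ⟨c, hcb⟩ := hχ.bounded_above_of_compact_support hc
  have hm1 := memLp_one_iff_integrable.2 hm
  have hn : ∀ n, Integrable (mollify n m) := fun n =>
    memLp_one_iff_integrable.1 (memLp_mollify n le_rfl ENNReal.one_ne_top hm1)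
  have ht := tendsto_eLpNorm_mollify_sub le_rfl ENNReal.one_ne_top hm1
  have ht' : Tendsto (fun n => K * c *
      (eLpNorm (fun x => mollify n m x - m x) 1 volume).toReal) atTop (𝓝 0) := by
    have := (ENNReal.tendsto_toReal ENNReal.zero_ne_top).comp ht
    simpa using this.const_mul (K * c : ℝ)
  rw [tendsto_iff_norm_sub_tendsto_zero]
  refine squeeze_zero (fun _ => norm_nonneg _) (fun n => ?_) ht'
  have hd : Integrable fun x => mollify n m x - m x := (hn n).sub hm
  rw [← integral_sub (integrable_perspective_mul hp hpos hB hχ hc (hn n))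
    (integrable_perspective_mul hp hpos hB hχ hc hm)]
  calc ‖∫ x, perspective p B (mollify n m) x * χ x - perspective p B m x * χ x‖
      ≤ ∫ x, K * c * ‖mollify n m x - m x‖ := by
        refine norm_integral_le_of_norm_le (hd.norm.const_mul _) (Eventually.of_forall fun x => ?_)
        rw [← sub_mul, norm_mul]
        calc ‖perspective p B (mollify n m) x - perspective p B m x‖ * ‖χ x‖
            ≤ (K * ‖mollify n m x - m x‖) * c := by
              gcongr
              · exact norm_perspective_sub_le hpos hB x
              · exact hcb x
          _ = _ := by ring
    _ = _ := by
        rw [integral_const_mul, eLpNorm_one_eq_lintegral_enorm,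
          integral_norm_eq_lintegral_enorm hd.1]

variable [IsProbabilityMeasure (target V)] {μ : ℝ → Measure (EuclideanSpace ℝ (Fin d))}
  {ρ u : ℝ → Lp ℝ 2 (target V)} {v : ℝ → Lp (EuclideanSpace ℝ (Fin d)) 2 (target V)} {C : ℝ}
  {β β' : ℝ → ℝ} {K : ℝ≥0} {χ : EuclideanSpace ℝ (Fin d) → ℝ}

/-- The localised entropy dissipation. -/
def localDissipation (V : EuclideanSpace ℝ (Fin d) → ℝ) [IsFiniteMeasure (target V)] (β β' : ℝ → ℝ)
    (χ : EuclideanSpace ℝ (Fin d) → ℝ) (ρ : Lp ℝ 2 (target V))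
    (v : Lp (EuclideanSpace ℝ (Fin d)) 2 (target V)) : ℝ :=
  ∫ x, (χ x * ((ρ - Lp.const 2 (target V) (1 : ℝ) : Lp ℝ 2 (target V)) x *
    (β (ρ x) - ρ x * β' (ρ x))) - β (ρ x) * ⟪v x, gradient χ x⟫) ∂(target V)

/-- The scale of mollification tends to zero under the time integral. The static estimate, quadratic
in `1 + ‖ρ s‖`, is an integrable majorant because the flow has square-integrable norm in time. -/
lemma IsRegularFlow.local_balance (hV : ContDiff ℝ 1 V)
    (hint : Integrable (fun x => Real.exp (-V x)) volume) (h : IsRegularFlow V μ ρ u v C)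
    (hβ : IsRenormalization β β' K) (hχ : IsTestFunction χ) {a b : ℝ} (ha : 0 ≤ a)
    (hab : a ≤ b) :
    AEStronglyMeasurable (fun s => localDissipation V β β' χ (ρ s) (v s))
      (volume.restrict (Ioc a b)) ∧
    (∫ x, χ x * β ((μ b).rnDeriv (target V) x).toReal ∂(target V)) -
      (∫ x, χ x * β ((μ a).rnDeriv (target V) x).toReal ∂(target V)) =
      ∫ s in Ioc a b, localDissipation V β β' χ (ρ s) (v s) := by
  have hp := contDiff_targetDensity hV
  have hpos := targetDensity_pos hint
  have hm := fun n => h.mollified_balance hV hint hβ hχ n ha hab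
  obtain ⟨C₀, hC₀, hstat⟩ := exists_renormFlux_target_le_and_tendsto hV hint hβ hχ
  have hslice : ∀ᵐ s ∂(volume.restrict (Ioc a b)),
      (∀ n, ‖renormFlux (targetDensity V) β' χ (fun x => targetDensity V x * ρ s x) (v s) n‖ ≤
        C₀ * C * (1 + ‖ρ s‖) ^ 2) ∧
      Tendsto (renormFlux (targetDensity V) β' χ (fun x => targetDensity V x * ρ s x) (v s)) atTop
        (𝓝 (localDissipation V β β' χ (ρ s) (v s))) := by
    filter_upwards [h.ae_of_Ioc (b := b) ha] with s hs
    obtain ⟨-, -, -, -, ht, hb⟩ := hs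
    obtain ⟨h1, h2⟩ := isLangevinTriple_iff.1 ht
    obtain ⟨h3, h4⟩ := hstat (ρ s) (u s) _ (v s) (Lp.memLp _) (mem_sobolevGraph_iff.1 h1)
      (Lp.memLp _) h2
    refine ⟨fun n => (h3 n).trans ?_, h4⟩
    rw [← Lp.norm_def, ← Lp.norm_def, ← Lp.norm_def, ← Lp.norm_def, mul_assoc C₀]
    refine mul_le_mul_of_nonneg_left ?_ hC₀
    calc (1 + ‖ρ s‖) * (‖u s‖ + ‖v s‖ + ‖ρ s - Lp.const 2 (target V) (1 : ℝ)‖)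
        ≤ (1 + ‖ρ s‖) * (C * (1 + ‖ρ s‖)) := by gcongr
      _ = _ := by ring
  have hlim : ∀ t, 0 ≤ t → Tendsto (fun n =>
      ∫ x, perspective (targetDensity V) β (mollifyMeasure n (μ t)) x * χ x) atTop
      (𝓝 (∫ x, χ x * β ((μ t).rnDeriv (target V) x).toReal ∂(target V))) := by
    intro t ht
    have := h.prob t ht
    have hi : Integrable fun x => targetDensity V x * ((μ t).rnDeriv (target V) x).toReal :=
      (integrable_target_iff hint _).1 Measure.integrable_toReal_rnDeriv
    have key := tendsto_integral_perspective_mollify_mul hp.continuous hpos hβ.lipschitzWith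
      hχ.1.continuous hχ.2 hi
    have e : ∫ x, perspective (targetDensity V) β (fun x => targetDensity V x *
        ((μ t).rnDeriv (target V) x).toReal) x * χ x =
        ∫ x, χ x * β ((μ t).rnDeriv (target V) x).toReal ∂(target V) := by
      rw [integral_target]
      congr 1
      ext x
      rw [perspective, mul_div_cancel_left₀ _ (hpos x).ne', smul_eq_mul]
      ring
    rw [e] at key
    refine key.congr fun n => ?_
    rw [mollifyMeasure_eq_mollify n (h.ac t ht) (Eventually.of_forall fun x => rfl)]
  refine ⟨aestronglyMeasurable_of_tendsto_ae atTop (fun n => (hm n).1)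
    (hslice.mono fun s hs => hs.2), ?_⟩
  have t1 := (hlim b (ha.trans hab)).sub (hlim a ha)
  have t2 := tendsto_integral_of_dominated_convergence (fun s => C₀ * C * (1 + ‖ρ s‖) ^ 2)
    (fun n => (hm n).1) ((h.integrableOn_Ioc (b := b) ha).const_mul (C₀ * C))
    (fun n => hslice.mono fun s hs => hs.1 n) (hslice.mono fun s hs => hs.2)
  refine tendsto_nhds_unique (t1.congr fun n => (hm n).2) t2

lemma Lp_two_norm_sq {F : Type*} [NormedAddCommGroup F] [InnerProductSpace ℝ F] {α : Type*}
    [MeasurableSpace α] {ν : Measure α} (f : Lp F 2 ν) :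
    Integrable (fun x => ‖f x‖ ^ 2) ν ∧ ∫ x, ‖f x‖ ^ 2 ∂ν = ‖f‖ ^ 2 := by
  refine ⟨(Lp.memLp f).integrable_norm_pow two_ne_zero, ?_⟩
  rw [← real_inner_self_eq_norm_sq, L2.inner_def]
  simp_rw [real_inner_self_eq_norm_sq]

/-- The entropy dissipation. -/
def dissipation (V : EuclideanSpace ℝ (Fin d) → ℝ) [IsFiniteMeasure (target V)] (β β' : ℝ → ℝ)
    (ρ : Lp ℝ 2 (target V)) : ℝ :=
  ∫ x, (ρ - Lp.const 2 (target V) (1 : ℝ) : Lp ℝ 2 (target V)) x *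
    (β (ρ x) - ρ x * β' (ρ x)) ∂(target V)

/-- Nothing is lost at infinity: `β(ρ)` grows at most linearly, so `β(ρ) v` is integrable, and the
cutoff gradients tend to zero uniformly. -/
lemma IsRegularFlow.balance (hV : ContDiff ℝ 1 V)
    (hint : Integrable (fun x => Real.exp (-V x)) volume) (h : IsRegularFlow V μ ρ u v C)
    (hC : 0 ≤ C) (hβ : IsRenormalization β β' K) {a b : ℝ} (ha : 0 ≤ a) (hab : a ≤ b) :
    IntegrableOn (fun s => dissipation V β β' (ρ s)) (Ioc a b) ∧
    (∫ x, β ((μ b).rnDeriv (target V) x).toReal ∂(target V)) -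
      (∫ x, β ((μ a).rnDeriv (target V) x).toReal ∂(target V)) =
      ∫ s in Ioc a b, dissipation V β β' (ρ s) := by
  obtain ⟨c, hc0, hc⟩ := exists_norm_gradient_cutoff_le d
  have hloc := fun n => h.local_balance hV hint hβ (isTestFunction_cutoff n) ha hab
  have hgrad : ∀ n (x : EuclideanSpace ℝ (Fin d)), ‖gradient (cutoff n) x‖ ≤ c := fun n x =>
    (hc n x).trans (div_le_self hc0 (by simp))
  have hgrad0 : ∀ x : EuclideanSpace ℝ (Fin d),
      Tendsto (fun n => gradient (cutoff n) x) atTop (𝓝 0) := fun x =>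
    squeeze_zero_norm (fun n => hc n x) (tendsto_const_div_atTop_nhds_zero_nat c |>.comp
      (tendsto_add_atTop_nat 1) |>.congr fun n => by simp)
  have hβL := hβ.lipschitzWith
  -- Constants of Young's inequality: with `B = ‖β 0‖`, the products `‖g‖ (B + 2 K ‖ρ‖)` and `c ‖v‖
  -- (B + K ‖ρ‖)` are replaced by sums of squares, and `C` bounds `‖g‖` and `‖v‖` by `1 + ‖ρ‖`.
  obtain ⟨L, hL⟩ : ∃ L : ℝ, L = (1 + c) * C ^ 2 + (2 + 2 * c) * β 0 ^ 2 + (8 + 2 * c) * K ^ 2 :=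
    ⟨_, rfl⟩
  have hslice : ∀ᵐ s ∂(volume.restrict (Ioc a b)),
      (∀ n, ‖localDissipation V β β' (cutoff n) (ρ s) (v s)‖ ≤ L * (1 + ‖ρ s‖) ^ 2) ∧
      Tendsto (fun n => localDissipation V β β' (cutoff n) (ρ s) (v s)) atTop
        (𝓝 (dissipation V β β' (ρ s))) := by
    filter_upwards [h.ae_of_Ioc (b := b) ha] with s hs
    obtain ⟨-, -, -, -, -, hb⟩ := hs
    obtain ⟨g, hg⟩ : ∃ g : Lp ℝ 2 (target V), g = ρ s - Lp.const 2 (target V) (1 : ℝ) := ⟨_, rfl⟩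
    simp only [localDissipation, dissipation, ← hg] at hb ⊢
    obtain ⟨W, hW⟩ : ∃ W : EuclideanSpace ℝ (Fin d) → ℝ, W = fun x => ‖g x‖ ^ 2 + c * ‖v s x‖ ^ 2 +
      (2 + 2 * c) * β 0 ^ 2 + (8 + 2 * c) * K ^ 2 * ‖ρ s x‖ ^ 2 := ⟨_, rfl⟩
    have j1 := (Lp_two_norm_sq g).1
    have j2 := (Lp_two_norm_sq (v s)).1.const_mul c
    have j3 : Integrable (fun _ => (2 + 2 * c) * β 0 ^ 2) (target V) := integrable_const _
    have j4 := (Lp_two_norm_sq (ρ s)).1.const_mul ((8 + 2 * c) * (K : ℝ) ^ 2)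
    have hWi : Integrable W (target V) := hW ▸ ((j1.add j2).add j3).add j4
    have hWv : ∫ x, W x ∂(target V) ≤ L * (1 + ‖ρ s‖) ^ 2 := by
      have e : ∫ x, W x ∂(target V) = ‖g‖ ^ 2 + c * ‖v s‖ ^ 2 + (2 + 2 * c) * β 0 ^ 2 +
          (8 + 2 * c) * K ^ 2 * ‖ρ s‖ ^ 2 := by
        have s1 := integral_add ((j1.add j2).add j3) j4
        have s2 := integral_add (j1.add j2) j3
        have s3 := integral_add j1 j2
        simp only [Pi.add_apply] at s1 s2 s3
        have k2 : ∫ x, c * ‖v s x‖ ^ 2 ∂(target V) = c * ‖v s‖ ^ 2 := by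
          rw [integral_const_mul, (Lp_two_norm_sq (v s)).2]
        have k3 : ∫ _, (2 + 2 * c) * β 0 ^ 2 ∂(target V) = (2 + 2 * c) * β 0 ^ 2 := by simp
        have k4 : ∫ x, (8 + 2 * c) * (K : ℝ) ^ 2 * ‖ρ s x‖ ^ 2 ∂(target V) =
            (8 + 2 * c) * K ^ 2 * ‖ρ s‖ ^ 2 := by
          rw [integral_const_mul, (Lp_two_norm_sq (ρ s)).2]
        rw [hW, s1, s2, s3, k2, k3, k4, (Lp_two_norm_sq g).2]
      have hr := norm_nonneg (ρ s)
      have q1 : ‖g‖ ≤ C * (1 + ‖ρ s‖) := by linarith [norm_nonneg (u s), norm_nonneg (v s)]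
      have q2 : ‖v s‖ ≤ C * (1 + ‖ρ s‖) := by linarith [norm_nonneg (u s), norm_nonneg g]
      have q3 : ‖g‖ ^ 2 ≤ C ^ 2 * (1 + ‖ρ s‖) ^ 2 := by
        rw [← mul_pow]; gcongr
      have q4 : c * ‖v s‖ ^ 2 ≤ c * (C ^ 2 * (1 + ‖ρ s‖) ^ 2) := by
        rw [← mul_pow]; gcongr
      have q5 : (2 + 2 * c) * β 0 ^ 2 * 1 ≤ (2 + 2 * c) * β 0 ^ 2 * (1 + ‖ρ s‖) ^ 2 := by
        gcongr
        nlinarith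
      have q6 : (8 + 2 * c) * (K : ℝ) ^ 2 * ‖ρ s‖ ^ 2 ≤
          (8 + 2 * c) * (K : ℝ) ^ 2 * (1 + ‖ρ s‖) ^ 2 := by
        gcongr
        linarith
      rw [e, hL]
      linarith
    have hbd : ∀ n x, ‖cutoff n x * (g x * (β (ρ s x) - ρ s x * β' (ρ s x))) -
        β (ρ s x) * ⟪v s x, gradient (cutoff n) x⟫‖ ≤ W x := by
      intro n x
      have b1 : ‖β (ρ s x)‖ ≤ ‖β 0‖ + K * ‖ρ s x‖ := hβL.norm_le_norm_zero_add _
      have b2 : ‖ρ s x * β' (ρ s x)‖ ≤ K * ‖ρ s x‖ := by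
        rw [norm_mul, mul_comm]
        gcongr
        exact hβ.bound _
      have b3 : ‖⟪v s x, gradient (cutoff n) x⟫‖ ≤ ‖v s x‖ * c :=
        (norm_inner_le_norm _ _).trans (by gcongr; exact hgrad n x)
      have b4 : ‖(cutoff n x : ℝ)‖ ≤ 1 := by
        rw [Real.norm_of_nonneg (cutoff_nonneg n x)]
        exact cutoff_le_one n x
      have e0 : ‖β 0‖ ^ 2 = β 0 ^ 2 := by rw [Real.norm_eq_abs, sq_abs]
      rw [hW]
      simp only
      rw [← e0]
      calc _ ≤ ‖cutoff n x * (g x * (β (ρ s x) - ρ s x * β' (ρ s x)))‖ +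
            ‖β (ρ s x) * ⟪v s x, gradient (cutoff n) x⟫‖ := norm_sub_le _ _
        _ ≤ 1 * (‖g x‖ * ((‖β 0‖ + K * ‖ρ s x‖) + K * ‖ρ s x‖)) +
            (‖β 0‖ + K * ‖ρ s x‖) * (‖v s x‖ * c) := by
            rw [norm_mul, norm_mul, norm_mul]
            gcongr
            exact (norm_sub_le _ _).trans (add_le_add b1 b2)
        _ ≤ _ := by
            generalize ‖g x‖ = G
            generalize ‖β 0‖ = B
            generalize ‖v s x‖ = w
            generalize ‖ρ s x‖ = r
            generalize (K : ℝ) = k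
            have r1 : G * (B + 2 * (k * r)) ≤ G ^ 2 + 2 * B ^ 2 + 8 * (k * r) ^ 2 := by
              nlinarith [sq_nonneg (G - (B + 2 * (k * r))), sq_nonneg (B - 2 * (k * r)),
                sq_nonneg G, sq_nonneg (B + 2 * (k * r))]
            have r2 : (B + k * r) * w ≤ w ^ 2 + 2 * B ^ 2 + 2 * (k * r) ^ 2 := by
              nlinarith [sq_nonneg (w - (B + k * r)), sq_nonneg (B - k * r), sq_nonneg w,
                sq_nonneg (B + k * r)]
            have r3 := mul_le_mul_of_nonneg_left r2 hc0
            nlinarith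
    have hmeas : ∀ n, AEStronglyMeasurable (fun x => cutoff n x *
        (g x * (β (ρ s x) - ρ s x * β' (ρ s x))) -
        β (ρ s x) * ⟪v s x, gradient (cutoff n) x⟫) (target V) := by
      intro n
      have m1 := (Lp.memLp (ρ s)).1
      have m2 := hβ.contDiff.continuous.comp_aestronglyMeasurable m1
      exact ((isTestFunction_cutoff n).1.continuous.aestronglyMeasurable.mul
        ((Lp.memLp g).1.mul (m2.sub (m1.mul (hβ.continuous_deriv.comp_aestronglyMeasurable m1))))).sub
        (m2.mul ((Lp.memLp (v s)).1.inner
          (isTestFunction_cutoff n).continuous_gradient.aestronglyMeasurable))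
    refine ⟨fun n => (norm_integral_le_of_norm_le hWi (Eventually.of_forall (hbd n))).trans hWv, ?_⟩
    refine tendsto_integral_of_dominated_convergence W hmeas hWi
      (fun n => Eventually.of_forall (hbd n)) (Eventually.of_forall fun x => ?_)
    have t1 := (tendsto_cutoff x).mul_const (g x * (β (ρ s x) - ρ s x * β' (ρ s x)))
    have t2 := ((tendsto_const_nhds (x := v s x)).inner (𝕜 := ℝ) (hgrad0 x)).const_mul (β (ρ s x))
    have t3 := t1.sub t2
    simpa using t3
  have hIL := (h.integrableOn_Ioc (b := b) ha).const_mul L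
  have hmeas := aestronglyMeasurable_of_tendsto_ae atTop (fun n => (hloc n).1)
    (hslice.mono fun s hs => hs.2)
  refine ⟨hIL.mono' hmeas (hslice.mono fun s hs =>
    le_of_tendsto' hs.2.norm fun n => hs.1 n), ?_⟩
  have hlim : ∀ t, 0 ≤ t → Tendsto (fun n =>
      ∫ x, cutoff n x * β ((μ t).rnDeriv (target V) x).toReal ∂(target V)) atTop
      (𝓝 (∫ x, β ((μ t).rnDeriv (target V) x).toReal ∂(target V))) := by
    intro t ht
    have := h.prob t ht
    have hi : Integrable (fun x => ((μ t).rnDeriv (target V) x).toReal) (target V) :=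
      Measure.integrable_toReal_rnDeriv
    have hm := hβ.contDiff.continuous.comp_aestronglyMeasurable hi.1
    refine tendsto_integral_of_dominated_convergence
      (fun x => ‖β 0‖ + K * ‖((μ t).rnDeriv (target V) x).toReal‖)
      (fun n => (isTestFunction_cutoff n).1.continuous.aestronglyMeasurable.mul hm)
      ((integrable_const _).add (hi.norm.const_mul _)) (fun n => Eventually.of_forall fun x => ?_)
      (Eventually.of_forall fun x => ?_)
    · rw [norm_mul, Real.norm_of_nonneg (cutoff_nonneg n x)]
      exact (mul_le_of_le_one_left (norm_nonneg _) (cutoff_le_one n x)).trans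
        (hβL.norm_le_norm_zero_add _)
    · simpa using (tendsto_cutoff x).mul_const (β ((μ t).rnDeriv (target V) x).toReal)
  have t1 := (hlim b (ha.trans hab)).sub (hlim a ha)
  have t2 := tendsto_integral_of_dominated_convergence (fun s => L * (1 + ‖ρ s‖) ^ 2)
    (fun n => (hloc n).1) hIL (fun n => hslice.mono fun s hs => hs.1 n)
    (hslice.mono fun s hs => hs.2)
  exact tendsto_nhds_unique (t1.congr fun n => (hloc n).2) t2

end Balance

/-! ### Affine truncations of the entropy function -/

section Truncation

/-- The truncation of `r` to `[e⁻ⁿ, eⁿ]`. -/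
def expClamp (n : ℕ) (r : ℝ) : ℝ := min (max r (Real.exp (-n))) (Real.exp n)

/-- The affinely extended entropy function: it agrees with `klFun` on `[e⁻ⁿ, eⁿ]` and is affine
on either side. -/
def truncKlFun (n : ℕ) (r : ℝ) : ℝ := r * Real.log (expClamp n r) - expClamp n r + 1

lemma exp_neg_le_exp_nat (n : ℕ) : Real.exp (-n) ≤ Real.exp n :=
  Real.exp_le_exp.2 (by linarith [n.cast_nonneg (α := ℝ)])

lemma expClamp_mem (n : ℕ) (r : ℝ) : expClamp n r ∈ Icc (Real.exp (-n)) (Real.exp n) :=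
  ⟨le_min (le_max_right _ _) (exp_neg_le_exp_nat n), min_le_right _ _⟩

lemma expClamp_pos (n : ℕ) (r : ℝ) : 0 < expClamp n r :=
  (Real.exp_pos _).trans_le (expClamp_mem n r).1

lemma lipschitzWith_expClamp (n : ℕ) : LipschitzWith 1 (expClamp n) :=
  (LipschitzWith.id.max_const _).min_const _

lemma continuous_log_expClamp (n : ℕ) : Continuous fun r => Real.log (expClamp n r) :=
  (lipschitzWith_expClamp n).continuous.log fun r => (expClamp_pos n r).ne'

lemma norm_log_expClamp_le (n : ℕ) (r : ℝ) : ‖Real.log (expClamp n r)‖ ≤ n := by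
  obtain ⟨h1, h2⟩ := expClamp_mem n r
  rw [Real.norm_eq_abs, abs_le]
  constructor
  · rw [← Real.log_exp (-n : ℝ)]
    exact Real.log_le_log (Real.exp_pos _) h1
  · rw [← Real.log_exp (n : ℝ)]
    exact Real.log_le_log (expClamp_pos n r) h2

/-- Variational characterization of `truncKlFun`. -/
lemma le_truncKlFun (n : ℕ) (r : ℝ) {c : ℝ} (hc : c ∈ Icc (Real.exp (-n)) (Real.exp n)) :
    r * Real.log c - c + 1 ≤ truncKlFun n r := by
  have hpos := expClamp_pos n r
  have hc0 : 0 < c := (Real.exp_pos _).trans_le hc.1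
  have h1 : (r - expClamp n r) * (Real.log c - Real.log (expClamp n r)) ≤ 0 := by
    rcases le_or_gt r (expClamp n r) with h | h
    · rcases h.eq_or_lt with h | h
      · rw [← h]; simp
      · have : expClamp n r ≤ c := by
          rw [expClamp] at h ⊢
          rcases max_cases r (Real.exp (-n)) with ⟨e, h'⟩ | ⟨e, h'⟩
          · rw [e] at h
            exact absurd h (by simp)
          · rw [e]
            exact (min_le_left _ _).trans hc.1
        exact mul_nonpos_of_nonpos_of_nonneg (by linarith)
          (sub_nonneg.2 (Real.log_le_log hpos this))
    · have : c ≤ expClamp n r := by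
        rw [expClamp] at h ⊢
        rcases min_cases (max r (Real.exp (-n))) (Real.exp n) with ⟨e, h'⟩ | ⟨e, h'⟩
        · rw [e] at h
          exact absurd h (by simp)
        · rw [e]
          exact hc.2
      exact mul_nonpos_of_nonneg_of_nonpos (by linarith)
        (sub_nonpos.2 (Real.log_le_log hc0 this))
  have h2 : expClamp n r * (Real.log c - Real.log (expClamp n r)) ≤ c - expClamp n r := by
    rw [← Real.log_div hc0.ne' hpos.ne']
    calc _ ≤ expClamp n r * (c / expClamp n r - 1) := by
          gcongr
          exact Real.log_le_sub_one_of_pos (by positivity)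
      _ = _ := by field_simp
  rw [truncKlFun]
  linarith

/-- As a maximum of affine functions attained at the clamped value, `truncKlFun n` has `log
(expClamp n r)` as a subgradient. The remainder at `y` thus lies between `0` and `(y - r)` times the
increment of a continuous function, which avoids a case split at the gluing points. -/
lemma hasDerivAt_truncKlFun (n : ℕ) (r : ℝ) :
    HasDerivAt (truncKlFun n) (Real.log (expClamp n r)) r := by
  have hsub : ∀ x y : ℝ, (y - x) * Real.log (expClamp n x) ≤ truncKlFun n y - truncKlFun n x := by
    intro x y
    have := le_truncKlFun n y (expClamp_mem n x)
    rw [truncKlFun] at this ⊢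
    rw [truncKlFun]
    linarith
  rw [hasDerivAt_iff_isLittleO]
  have hc : Tendsto (fun y => Real.log (expClamp n y) - Real.log (expClamp n r)) (𝓝 r) (𝓝 0) := by
    simpa using ((continuous_log_expClamp n).tendsto r).sub_const (Real.log (expClamp n r))
  have ho : (fun y => (y - r) * (Real.log (expClamp n y) - Real.log (expClamp n r))) =o[𝓝 r]
      fun y => (y - r) * (1 : ℝ) :=
    (Asymptotics.isBigO_refl _ _).mul_isLittleO ((Asymptotics.isLittleO_one_iff ℝ).2 hc)
  simp only [mul_one] at ho
  refine Asymptotics.IsBigO.trans_isLittleO (Asymptotics.IsBigO.of_bound' ?_) ho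
  refine Eventually.of_forall fun y => ?_
  have h1 := hsub r y
  have h2 := hsub y r
  rw [smul_eq_mul, Real.norm_eq_abs, Real.norm_eq_abs, abs_of_nonneg (by linarith)]
  exact le_trans (by linarith) (le_abs_self _)

/-- The logarithm of the clamp is bounded by `n`, and `r log (clamp r)` equals the truncation plus
`clamp r - 1`; the clamp accounts for the extra `1` in the constant. -/
lemma isRenormalization_truncKlFun (n : ℕ) :
    IsRenormalization (truncKlFun n) (fun r => Real.log (expClamp n r)) (n + 1) where
  hasDerivAt := hasDerivAt_truncKlFun n
  continuous_deriv := continuous_log_expClamp n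
  bound r := (norm_log_expClamp_le n r).trans (by simp)
  lipschitz := by
    have h : LipschitzWith n (truncKlFun n) :=
      lipschitzWith_of_nnnorm_deriv_le (fun r => (hasDerivAt_truncKlFun n r).differentiableAt)
        fun r => by
          rw [(hasDerivAt_truncKlFun n r).deriv]
          exact_mod_cast norm_log_expClamp_le n r
    have h2 := (h.add (lipschitzWith_expClamp n)).sub (LipschitzWith.const (1 : ℝ))
    rw [add_zero] at h2
    have e : (fun r => r * Real.log (expClamp n r)) =
        fun r => truncKlFun n r + expClamp n r - 1 := by
      ext r
      rw [truncKlFun]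
      ring
    rw [e]
    exact h2

lemma truncKlFun_nonneg (n : ℕ) (r : ℝ) : 0 ≤ truncKlFun n r := by
  have := le_truncKlFun n r (c := 1) ⟨by simp, by simp⟩
  simpa using this

lemma truncKlFun_le_klFun (n : ℕ) {r : ℝ} (hr : 0 ≤ r) : truncKlFun n r ≤ klFun r := by
  have hpos := expClamp_pos n r
  rw [truncKlFun, klFun]
  rcases hr.eq_or_lt with rfl | hr
  · simp; linarith
  · have h := Real.log_le_sub_one_of_pos (div_pos hpos hr)
    rw [Real.log_div hpos.ne' hr.ne'] at h
    have h2 := mul_le_mul_of_nonneg_left h hr.le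
    have h3 : r * (expClamp n r / r - 1) = expClamp n r - r := by field_simp
    rw [h3] at h2
    linarith

/-- The reason for this truncation: multiplied by `ρ - 1`, the dissipation density becomes
`-(expClamp n ρ - 1) (ρ - 1)`, which has a sign for every `n`. -/
lemma truncKlFun_sub_mul (n : ℕ) (r : ℝ) :
    truncKlFun n r - r * Real.log (expClamp n r) = 1 - expClamp n r := by
  rw [truncKlFun]; ring

lemma expClamp_sub_one_mul_nonneg (n : ℕ) (r : ℝ) : 0 ≤ (expClamp n r - 1) * (r - 1) := by
  have h1 : (expClamp n 1) = 1 := by simp [expClamp]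
  have hm : Monotone (expClamp n) := fun x y h => by
    rw [expClamp, expClamp]; gcongr
  rcases le_total r 1 with h | h
  · have := hm h
    nlinarith
  · have := hm h
    nlinarith

lemma eventually_expClamp_eq {r : ℝ} (hr : 0 < r) : ∀ᶠ n : ℕ in atTop, expClamp n r = r := by
  have h := tendsto_natCast_atTop_atTop (R := ℝ)
  filter_upwards [(Real.tendsto_exp_atTop.comp h).eventually_ge_atTop r,
    ((Real.tendsto_exp_neg_atTop_nhds_zero).comp h).eventually_le_const hr] with n h1 h2
  simp only [Function.comp_apply] at h1 h2
  rw [expClamp, max_eq_left h2, min_eq_left h1]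

lemma tendsto_expClamp {r : ℝ} (hr : 0 ≤ r) :
    Tendsto (fun n => expClamp n r) atTop (𝓝 r) := by
  rcases hr.eq_or_lt with rfl | hr
  · refine ((Real.tendsto_exp_neg_atTop_nhds_zero).comp
      (tendsto_natCast_atTop_atTop (R := ℝ))).congr fun n => ?_
    rw [Function.comp_apply, expClamp, max_eq_right (Real.exp_pos _).le,
      min_eq_left (exp_neg_le_exp_nat n)]
  · exact tendsto_const_nhds.congr' ((eventually_expClamp_eq hr).mono fun n h => h.symm)

lemma tendsto_truncKlFun {r : ℝ} (hr : 0 ≤ r) :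
    Tendsto (fun n => truncKlFun n r) atTop (𝓝 (klFun r)) := by
  rcases hr.eq_or_lt with rfl | hr
  · have := ((tendsto_expClamp le_rfl).const_sub (1 : ℝ))
    simp only [truncKlFun, klFun, zero_mul, zero_add, zero_sub, sub_zero] at this ⊢
    exact this.congr fun n => by ring
  · refine tendsto_const_nhds.congr' ((eventually_expClamp_eq hr).mono fun n h => ?_)
    simp only [truncKlFun, h, klFun]
    ring

end Truncation

/-! ### Entropy against chi-squared -/

section Entropy

variable {d : ℕ} {V : EuclideanSpace ℝ (Fin d) → ℝ} [IsProbabilityMeasure (target V)]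
  {μ : ℝ → Measure (EuclideanSpace ℝ (Fin d))} {ρ u : ℝ → Lp ℝ 2 (target V)}
  {v : ℝ → Lp (EuclideanSpace ℝ (Fin d)) 2 (target V)} {C : ℝ}

lemma lintegral_sub_one_sq (ρ : Lp ℝ 2 (target V)) (h1 : ∫ x, ρ x ∂(target V) = 1) :
    ∫⁻ x, ENNReal.ofReal ((ρ x - 1) ^ 2) ∂(target V) = ENNReal.ofReal (‖ρ‖ ^ 2 - 1) := by
  obtain ⟨i1, i2⟩ := Lp_two_norm_sq ρ
  have i3 : Integrable (fun x => ρ x) (target V) := (Lp.memLp ρ).integrable (by norm_num)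
  have e : ∀ x, (ρ x - 1) ^ 2 = ‖ρ x‖ ^ 2 - 2 * ρ x + 1 := fun x => by
    rw [Real.norm_eq_abs, sq_abs]; ring
  have i4 : Integrable (fun x => ‖ρ x‖ ^ 2 - 2 * ρ x) (target V) := i1.sub (i3.const_mul 2)
  have i5 : Integrable (fun x => (ρ x - 1) ^ 2) (target V) := by
    simp_rw [e]
    exact i4.add (integrable_const 1)
  rw [← ofReal_integral_eq_lintegral_ofReal i5 (Eventually.of_forall fun x => sq_nonneg _)]
  congr 1
  simp_rw [e]
  rw [integral_add i4 (integrable_const 1), integral_sub i1 (i3.const_mul 2), i2,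
    integral_const_mul, h1]
  simp
  ring

/-- Comparison of the Kullback-Leibler and chi-squared divergences. -/
lemma lintegral_klFun_le_log (ρ : Lp ℝ 2 (target V)) (h0 : ∀ᵐ x ∂(target V), 0 ≤ ρ x)
    (h1 : ∫ x, ρ x ∂(target V) = 1) :
    1 ≤ ‖ρ‖ ^ 2 ∧ ∫⁻ x, ENNReal.ofReal (klFun (ρ x)) ∂(target V) ≤
      ENNReal.ofReal (Real.log (‖ρ‖ ^ 2)) := by
  obtain ⟨i1, i2⟩ := Lp_two_norm_sq ρ
  have i3 : Integrable (fun x => ρ x) (target V) := (Lp.memLp ρ).integrable (by norm_num)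
  obtain ⟨a, ha⟩ : ∃ a, a = ‖ρ‖ ^ 2 := ⟨_, rfl⟩
  have ha1 : 1 ≤ a := by
    have h : ⟪Lp.const 2 (target V) (1 : ℝ), ρ⟫ = 1 := by rw [inner_const_one, h1]
    have h2 := real_inner_le_norm (Lp.const 2 (target V) (1 : ℝ)) ρ
    rw [h, norm_Lp_const_one, one_mul] at h2
    rw [ha]
    nlinarith
  have ha0 : 0 < a := by linarith
  rw [← ha] at i2 ⊢
  refine ⟨ha1, ?_⟩
  have i4 := (i3.mul_const (Real.log a)).add (i1.const_mul a⁻¹)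
  have i5 := (i4.sub (i3.const_mul 2)).add (integrable_const (1 : ℝ))
  -- Jensen made explicit: the logarithm lies below its tangent at `a = ‖ρ‖²`. The majorant
  -- integrates to `log a + 1 - 2 + 1 = log a`.
  have hle : ∀ᵐ x ∂(target V), klFun (ρ x) ≤
      ρ x * Real.log a + a⁻¹ * ‖ρ x‖ ^ 2 - 2 * ρ x + 1 := by
    filter_upwards [h0] with x hx
    generalize ρ x = r at hx ⊢
    rw [Real.norm_eq_abs, sq_abs, klFun]
    rcases hx.eq_or_lt with rfl | hx
    · simp
    · have h := Real.log_le_sub_one_of_pos (div_pos hx ha0)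
      rw [Real.log_div hx.ne' ha0.ne'] at h
      have h2 := mul_le_mul_of_nonneg_left h hx.le
      have h3 : r * (r / a - 1) = a⁻¹ * r ^ 2 - r := by field_simp
      rw [h3] at h2
      linarith
  have hint : ∫ x, (ρ x * Real.log a + a⁻¹ * ‖ρ x‖ ^ 2 - 2 * ρ x + 1) ∂(target V) =
      Real.log a := by
    have s1 := integral_add (i4.sub (i3.const_mul 2)) (integrable_const (1 : ℝ))
    have s2 := integral_sub i4 (i3.const_mul 2)
    have s3 := integral_add (i3.mul_const (Real.log a)) (i1.const_mul a⁻¹)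
    simp only [Pi.add_apply, Pi.sub_apply] at s1 s2 s3
    rw [s1, s2, s3, integral_mul_const, integral_const_mul, integral_const_mul, h1, i2]
    simp [ha0.ne']
    ring
  rw [← hint]
  refine le_of_le_of_eq ?_ (ofReal_integral_eq_lintegral_ofReal i5 ?_).symm
  · exact lintegral_mono_ae (hle.mono fun x hx => ENNReal.ofReal_le_ofReal hx)
  · filter_upwards [h0, hle] with x hx hx2
    exact (klFun_nonneg hx).trans hx2

end Entropy

/-- The entropy balance bounds only the sum of entropy and dissipation, so the two Fatou limits have
to be taken together. -/
lemma ENNReal.liminf_add_liminf_le_of_forall_add_le {f g : ℕ → ℝ≥0∞} {c : ℝ≥0∞}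
    (h : ∀ n, f n + g n ≤ c) : liminf f atTop + liminf g atTop ≤ c := by
  have hm : ∀ u : ℕ → ℝ≥0∞, Monotone fun n => ⨅ i ≥ n, u i := fun u m n hmn =>
    le_iInf₂ fun i hi => iInf₂_le i (hmn.trans hi)
  rw [liminf_eq_iSup_iInf_of_nat, liminf_eq_iSup_iInf_of_nat,
    ENNReal.iSup_add_iSup_of_monotone (hm f) (hm g)]
  exact iSup_le fun n => (add_le_add (iInf₂_le n le_rfl) (iInf₂_le n le_rfl)).trans (h n)

/-! ### The entropy dissipation inequality -/

section EntropyDissipation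

variable {d : ℕ} {V : EuclideanSpace ℝ (Fin d) → ℝ} [IsProbabilityMeasure (target V)]
  {μ : ℝ → Measure (EuclideanSpace ℝ (Fin d))} {ρ u : ℝ → Lp ℝ 2 (target V)}
  {v : ℝ → Lp (EuclideanSpace ℝ (Fin d)) 2 (target V)} {C : ℝ}

lemma ofReal_neg_dissipation_truncKlFun (n : ℕ) (ρ : Lp ℝ 2 (target V)) :
    dissipation V (truncKlFun n) (fun r => Real.log (expClamp n r)) ρ ≤ 0 ∧
    ENNReal.ofReal (-dissipation V (truncKlFun n) (fun r => Real.log (expClamp n r)) ρ) =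
      ∫⁻ x, ENNReal.ofReal ((expClamp n (ρ x) - 1) * (ρ x - 1)) ∂(target V) := by
  have hi : Integrable (fun x => (expClamp n (ρ x) - 1) * (ρ x - 1)) (target V) := by
    have i3 : Integrable (fun x => ρ x - 1) (target V) :=
      ((Lp.memLp ρ).integrable (by norm_num)).sub (integrable_const 1)
    refine i3.bdd_mul (c := Real.exp n + 1)
      (((lipschitzWith_expClamp n).continuous.comp_aestronglyMeasurable
        (Lp.aestronglyMeasurable ρ)).sub aestronglyMeasurable_const)
      (Eventually.of_forall fun x => ?_)
    rw [Real.norm_eq_abs, abs_le]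
    have h1 := expClamp_pos n (ρ x)
    have h2 := (expClamp_mem n (ρ x)).2
    have h3 := Real.exp_pos (n : ℝ)
    constructor <;> linarith
  have e : -dissipation V (truncKlFun n) (fun r => Real.log (expClamp n r)) ρ =
      ∫ x, (expClamp n (ρ x) - 1) * (ρ x - 1) ∂(target V) := by
    rw [dissipation, ← integral_neg]
    refine integral_congr_ae ?_
    filter_upwards [Lp.coeFn_sub ρ (Lp.const 2 (target V) (1 : ℝ)),
      Lp.coeFn_const (p := 2) (μ := target V) (1 : ℝ)] with x h1 h2
    rw [h1, Pi.sub_apply, h2, truncKlFun_sub_mul]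
    simp only [Function.const_apply]
    ring
  refine ⟨?_, ?_⟩
  · have : 0 ≤ ∫ x, (expClamp n (ρ x) - 1) * (ρ x - 1) ∂(target V) :=
      integral_nonneg fun x => expClamp_sub_one_mul_nonneg n _
    linarith
  · rw [e, ofReal_integral_eq_lintegral_ofReal hi
      (Eventually.of_forall fun x => expClamp_sub_one_mul_nonneg n _)]

lemma integrable_truncKlFun_rnDeriv (n : ℕ) (ν : Measure (EuclideanSpace ℝ (Fin d)))
    [IsFiniteMeasure ν] :
    Integrable (fun x => truncKlFun n (ν.rnDeriv (target V) x).toReal) (target V) := by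
  have hL := (isRenormalization_truncKlFun n).lipschitzWith
  have hi : Integrable (fun x => (ν.rnDeriv (target V) x).toReal) (target V) :=
    Measure.integrable_toReal_rnDeriv
  refine ((integrable_const ‖truncKlFun n 0‖).add
    (hi.norm.const_mul ((n + 1 : ℝ≥0) : ℝ))).mono'
    (hL.continuous.comp_aestronglyMeasurable hi.1) (Eventually.of_forall fun x => ?_)
  exact hL.norm_le_norm_zero_add _

lemma IsRegularFlow.ae_density (h : IsRegularFlow V μ ρ u v C) {a b : ℝ} (ha : 0 ≤ a) :
    ∀ᵐ s ∂(volume.restrict (Ioc a b)), (∀ᵐ x ∂(target V), 0 ≤ ρ s x) ∧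
      ∫ x, ρ s x ∂(target V) = 1 ∧
      klDiv (μ s) (target V) = ∫⁻ x, ENNReal.ofReal (klFun (ρ s x)) ∂(target V) := by
  filter_upwards [h.ae_of_Ioc (b := b) ha] with s hs
  obtain ⟨-, hp, hac, hd, -, -⟩ := hs
  refine ⟨hd.mono fun x hx => hx ▸ ENNReal.toReal_nonneg, ?_, ?_⟩
  · rw [integral_congr_ae hd, Measure.integral_toReal_rnDeriv hac]
    simp
  · rw [klDiv_eq_lintegral_klFun_of_ac hac]
    exact lintegral_congr_ae (hd.mono fun x hx => by simp only [hx])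

/-- The entropy dissipation inequality. -/
lemma IsRegularFlow.klDiv_add_lintegral_le (hV : ContDiff ℝ 1 V)
    (hint : Integrable (fun x => Real.exp (-V x)) volume) (h : IsRegularFlow V μ ρ u v C)
    (hC : 0 ≤ C) {a b : ℝ} (ha : 0 ≤ a) (hab : a ≤ b) :
    klDiv (μ b) (target V) + ∫⁻ s in Ioc a b, ENNReal.ofReal (‖ρ s‖ ^ 2 - 1) ≤
      klDiv (μ a) (target V) := by
  have hb : 0 ≤ b := ha.trans hab
  have := h.prob a ha
  have := h.prob b hb
  rw [klDiv_eq_lintegral_klFun_of_ac (h.ac a ha), klDiv_eq_lintegral_klFun_of_ac (h.ac b hb)]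
  obtain ⟨D, hD⟩ : ∃ D : ℕ → ℝ → ℝ, D = fun n s =>
    dissipation V (truncKlFun n) (fun r => Real.log (expClamp n r)) (ρ s) := ⟨_, rfl⟩
  have hbal := fun n => h.balance hV hint hC (isRenormalization_truncKlFun n) ha hab
  have hDi : ∀ n, IntegrableOn (D n) (Ioc a b) := fun n => hD ▸ (hbal n).1
  have hn : ∀ n, (∫⁻ x, ENNReal.ofReal (truncKlFun n ((μ b).rnDeriv (target V) x).toReal)
        ∂(target V)) + (∫⁻ s in Ioc a b, ENNReal.ofReal (-D n s)) ≤
      ∫⁻ x, ENNReal.ofReal (klFun ((μ a).rnDeriv (target V) x).toReal) ∂(target V) := by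
    intro n
    have hD0 : ∀ s, 0 ≤ -D n s := fun s => by
      have := (ofReal_neg_dissipation_truncKlFun n (ρ s)).1
      rw [hD]
      simpa using this
    have e := (hbal n).2
    have e2 : ∫ s in Ioc a b, -D n s = -∫ s in Ioc a b, dissipation V (truncKlFun n)
        (fun r => Real.log (expClamp n r)) (ρ s) := by
      rw [integral_neg, hD]
    rw [← ofReal_integral_eq_lintegral_ofReal (f := fun s => -D n s) (hDi n).neg
        (Eventually.of_forall hD0),
      ← ofReal_integral_eq_lintegral_ofReal (integrable_truncKlFun_rnDeriv n (μ b))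
        (Eventually.of_forall fun x => truncKlFun_nonneg n _),
      ← ENNReal.ofReal_add (integral_nonneg fun x => truncKlFun_nonneg n _)
        (integral_nonneg hD0)]
    calc _ = ENNReal.ofReal (∫ x, truncKlFun n ((μ a).rnDeriv (target V) x).toReal
          ∂(target V)) := by
          congr 1
          rw [e2]
          linarith
      _ = ∫⁻ x, ENNReal.ofReal (truncKlFun n ((μ a).rnDeriv (target V) x).toReal)
          ∂(target V) := ofReal_integral_eq_lintegral_ofReal
            (integrable_truncKlFun_rnDeriv n (μ a))
            (Eventually.of_forall fun x => truncKlFun_nonneg n _)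
      _ ≤ _ := lintegral_mono fun x =>
          ENNReal.ofReal_le_ofReal (truncKlFun_le_klFun n ENNReal.toReal_nonneg)
  have f1 : ∫⁻ x, ENNReal.ofReal (klFun ((μ b).rnDeriv (target V) x).toReal) ∂(target V) ≤
      liminf (fun n => ∫⁻ x, ENNReal.ofReal
        (truncKlFun n ((μ b).rnDeriv (target V) x).toReal) ∂(target V)) atTop := by
    refine le_trans (lintegral_mono fun x => ?_) (lintegral_liminf_le' fun n =>
      (integrable_truncKlFun_rnDeriv n (μ b)).1.aemeasurable.ennreal_ofReal)
    exact ((ENNReal.tendsto_ofReal (tendsto_truncKlFun ENNReal.toReal_nonneg)).liminf_eq).ge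
  -- Fatou is applied twice, in time and then in space at almost every time. The sign of the
  -- truncated dissipation makes this possible, and the inequality obtained is in the direction
  -- needed.
  have f2 : ∫⁻ s in Ioc a b, ENNReal.ofReal (‖ρ s‖ ^ 2 - 1) ≤
      liminf (fun n => ∫⁻ s in Ioc a b, ENNReal.ofReal (-D n s)) atTop := by
    refine le_trans (lintegral_mono_ae ?_) (lintegral_liminf_le' fun n =>
      (hDi n).neg.1.aemeasurable.ennreal_ofReal)
    filter_upwards [h.ae_density ha] with s hs
    rw [← lintegral_sub_one_sq (ρ s) hs.2.1]
    simp only [hD, (ofReal_neg_dissipation_truncKlFun _ (ρ s)).2]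
    refine le_trans (lintegral_mono_ae ?_) (lintegral_liminf_le' fun n =>
      (((lipschitzWith_expClamp n).continuous.measurable.comp_aemeasurable
        (Lp.aestronglyMeasurable (ρ s)).aemeasurable).sub_const 1 |>.mul
        ((Lp.aestronglyMeasurable (ρ s)).aemeasurable.sub_const 1)).ennreal_ofReal)
    filter_upwards [hs.1] with x hx
    rw [pow_two]
    exact ((ENNReal.tendsto_ofReal
      (((tendsto_expClamp hx).sub_const 1).mul_const (ρ s x - 1))).liminf_eq).ge
  calc _ ≤ _ := add_le_add f1 f2
    _ ≤ _ := ENNReal.liminf_add_liminf_le_of_forall_add_le hn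

end EntropyDissipation

/-! ### The differential inequality in discrete form -/

section Decay

/-- One implicit Euler step. With `E = exp k₁` and `q = 1 + h (E - 1)`, the bound `1 + x ≤ exp x`
gives `exp (-k₀) ≤ 1 / (E q)`, and `(1 - 1 / E) (1 + h / q) = 1 - 1 / (E q)` exactly. Replacing `E -
1` by `B` makes the factor the same for all steps. -/
lemma one_sub_exp_neg_step {k₀ k₁ h B : ℝ} (hk : 0 ≤ k₁) (hh : 0 ≤ h)
    (hB : Real.exp k₁ - 1 ≤ B) (hle : k₁ + h * (Real.exp k₁ - 1) ≤ k₀) :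
    (1 - Real.exp (-k₁)) * (1 + h / (1 + h * B)) ≤ 1 - Real.exp (-k₀) := by
  obtain ⟨E, hE⟩ : ∃ E, E = Real.exp k₁ := ⟨_, rfl⟩
  have hE1 : 1 ≤ E := hE ▸ Real.one_le_exp hk
  rw [← hE] at hB hle
  have hd : 0 ≤ h * (E - 1) := mul_nonneg hh (by linarith)
  have hle' : h * (E - 1) ≤ h * B := mul_le_mul_of_nonneg_left hB hh
  have h1 : Real.exp (-k₀) ≤ E⁻¹ * (1 + h * (E - 1))⁻¹ := by
    rw [← mul_inv, Real.exp_neg]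
    gcongr
    calc E * (1 + h * (E - 1)) ≤ E * Real.exp (h * (E - 1)) := by
          gcongr
          linarith [Real.add_one_le_exp (h * (E - 1))]
      _ = Real.exp (k₁ + h * (E - 1)) := by rw [Real.exp_add, hE]
      _ ≤ _ := Real.exp_le_exp.2 hle
  have h2 : (1 - E⁻¹) * (h / (1 + h * B)) ≤ (1 - E⁻¹) * (h / (1 + h * (E - 1))) := by
    have : 0 ≤ 1 - E⁻¹ := sub_nonneg.2 (inv_le_one_of_one_le₀ hE1)
    gcongr
  have h3 : (1 - E⁻¹) * (1 + h / (1 + h * (E - 1))) = 1 - E⁻¹ * (1 + h * (E - 1))⁻¹ := by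
    have hE0 : E ≠ 0 := by positivity
    obtain ⟨q, hq⟩ : ∃ q, q = 1 + h * (E - 1) := ⟨_, rfl⟩
    have hq0 : q ≠ 0 := by rw [hq]; positivity
    rw [← hq]
    field_simp
    linear_combination (-1 : ℝ) * hq
  rw [Real.exp_neg k₁, ← hE]
  linarith

/-- A discrete form of the differential inequality `K' ≤ 1 - exp K`. -/
lemma one_sub_exp_neg_le_of_forall_add_mul_le {K : ℝ → ℝ} {a b : ℝ} (hab : a ≤ b)
    (h0 : ∀ t ∈ Icc a b, 0 ≤ K t)
    (hK : ∀ s t, a ≤ s → s ≤ t → t ≤ b → K t + (t - s) * (Real.exp (K t) - 1) ≤ K s) :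
    1 - Real.exp (-K b) ≤ Real.exp (-(b - a)) * (1 - Real.exp (-K a)) := by
  -- The hypothesis forces `K t ≤ K a`, so its initial value bounds `exp (K t) - 1` on the whole
  -- interval.
  obtain ⟨B, hB⟩ : ∃ B, B = Real.exp (K a) - 1 := ⟨_, rfl⟩
  have hB0 : 0 ≤ B := by
    have := Real.one_le_exp (h0 a ⟨le_rfl, hab⟩)
    linarith
  have hKB : ∀ t ∈ Icc a b, Real.exp (K t) - 1 ≤ B := by
    intro t ht
    have h1 := hK a t le_rfl ht.1 ht.2
    have h2 := Real.one_le_exp (h0 t ht)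
    have h3 : 0 ≤ (t - a) * (Real.exp (K t) - 1) :=
      mul_nonneg (by linarith [ht.1]) (by linarith)
    have h4 : Real.exp (K t) ≤ Real.exp (K a) := Real.exp_le_exp.2 (by linarith)
    linarith
  have hT : 0 ≤ b - a := by linarith
  have key : ∀ n : ℕ, 0 < n → (1 - Real.exp (-K b)) *
      (1 + ((b - a) / n) / (1 + (b - a) / n * B)) ^ n ≤ 1 - Real.exp (-K a) := by
    intro n hn
    obtain ⟨h, hh⟩ : ∃ h, h = (b - a) / n := ⟨_, rfl⟩
    rw [← hh]
    have hn' : (0 : ℝ) < n := by exact_mod_cast hn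
    have hh0 : 0 ≤ h := hh ▸ by positivity
    have hnh : a + n * h = b := by rw [hh, mul_div_cancel₀ _ hn'.ne']; ring
    have hq : 0 ≤ 1 + h / (1 + h * B) := by positivity
    have hk : ∀ k : ℕ, k ≤ n → (1 - Real.exp (-K (a + k * h))) * (1 + h / (1 + h * B)) ^ k ≤
        1 - Real.exp (-K a) := by
      intro k
      induction k with
      | zero => simp
      | succ k ih =>
        intro hkn
        have hk1 : ((k + 1 : ℕ) : ℝ) ≤ n := by exact_mod_cast hkn
        have e1 : a + (k + 1 : ℕ) * h ≤ b := by
          rw [← hnh]; gcongr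
        have e2 : a ≤ a + k * h := by
          have : 0 ≤ k * h := by positivity
          linarith
        have e3 : a + (k + 1 : ℕ) * h = a + k * h + h := by push_cast; ring
        have e4 : a + (k + 1 : ℕ) * h ∈ Icc a b := ⟨by linarith, e1⟩
        have st := one_sub_exp_neg_step (k₀ := K (a + k * h)) (h0 _ e4) hh0 (hKB _ e4) (by
          have := hK (a + k * h) (a + (k + 1 : ℕ) * h) e2 (by linarith) e1
          rwa [show a + (k + 1 : ℕ) * h - (a + k * h) = h by linarith] at this)
        rw [pow_succ', ← mul_assoc]
        refine le_trans ?_ (ih (by omega))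
        exact mul_le_mul_of_nonneg_right st (pow_nonneg hq k)
    have := hk n le_rfl
    rwa [hnh] at this
  -- The correction by `B` is of lower order in the step size, so the product of the step factors
  -- tends to the exponential; no continuity of `K` is required.
  have hlim : Tendsto (fun n : ℕ => (1 + ((b - a) / n) / (1 + (b - a) / n * B)) ^ n) atTop
      (𝓝 (Real.exp (b - a))) := by
    refine Real.tendsto_one_add_pow_exp_of_tendsto ?_
    have h1 : Tendsto (fun n : ℕ => (b - a) / n) atTop (𝓝 0) :=
      tendsto_const_div_atTop_nhds_zero_nat _
    have h2 : Tendsto (fun n : ℕ => (b - a) / (1 + (b - a) / n * B)) atTop (𝓝 (b - a)) := by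
      have := (tendsto_const_nhds (x := b - a) (f := atTop (α := ℕ))).div
        ((h1.mul_const B).const_add 1) (by simp)
      rw [zero_mul, add_zero, div_one] at this
      exact this
    refine h2.congr' ((eventually_gt_atTop 0).mono fun n hn => ?_)
    have hn' : (0 : ℝ) < n := by exact_mod_cast hn
    simp only []
    rw [← mul_div_assoc, mul_div_cancel₀ _ hn'.ne']
  have hfin := le_of_tendsto (hlim.const_mul (1 - Real.exp (-K b)))
    ((eventually_gt_atTop 0).mono key)
  rw [Real.exp_neg (b - a)]
  rw [inv_mul_eq_div, le_div_iff₀ (Real.exp_pos _)]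
  exact hfin

end Decay

/-! ### Decay of the entropy along the flow -/

section Flow

variable {d : ℕ} {V : EuclideanSpace ℝ (Fin d) → ℝ} [IsProbabilityMeasure (target V)]
  {μ : ℝ → Measure (EuclideanSpace ℝ (Fin d))} {ρ u : ℝ → Lp ℝ 2 (target V)}
  {v : ℝ → Lp (EuclideanSpace ℝ (Fin d)) 2 (target V)} {C : ℝ}

lemma IsRegularFlow.klDiv_anti (hV : ContDiff ℝ 1 V)
    (hint : Integrable (fun x => Real.exp (-V x)) volume) (h : IsRegularFlow V μ ρ u v C)
    (hC : 0 ≤ C) {a b : ℝ} (ha : 0 ≤ a) (hab : a ≤ b) :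
    klDiv (μ b) (target V) ≤ klDiv (μ a) (target V) :=
  le_self_add.trans (h.klDiv_add_lintegral_le hV hint hC ha hab)

/-- Some earlier positive time has a density in `L²(π)`, where the entropy is at most the logarithm
of the squared norm. Monotonicity carries finiteness forward, even from infinite initial entropy. -/
lemma IsRegularFlow.klDiv_ne_top (hV : ContDiff ℝ 1 V)
    (hint : Integrable (fun x => Real.exp (-V x)) volume) (h : IsRegularFlow V μ ρ u v C)
    (hC : 0 ≤ C) {t : ℝ} (ht : 0 < t) : klDiv (μ t) (target V) ≠ ⊤ := by
  have : NeZero (volume.restrict (Ioc 0 t)) := ⟨by simp [ht]⟩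
  obtain ⟨s, hs, hmem⟩ := ((h.ae_density (b := t) le_rfl).and
    (ae_restrict_mem measurableSet_Ioc)).exists
  refine ne_top_of_le_ne_top ?_ (h.klDiv_anti hV hint hC hmem.1.le hmem.2)
  rw [hs.2.2]
  exact ne_top_of_le_ne_top ENNReal.ofReal_ne_top (lintegral_klFun_le_log (ρ s) hs.1 hs.2.1).2

/-- At almost every `s` in the interval the chi-squared divergence is at least `exp` of the entropy
minus one. By monotonicity of the entropy it is at least that quantity at the final time. -/
lemma IsRegularFlow.toReal_klDiv_add_le (hV : ContDiff ℝ 1 V)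
    (hint : Integrable (fun x => Real.exp (-V x)) volume) (h : IsRegularFlow V μ ρ u v C)
    (hC : 0 ≤ C) {a b : ℝ} (ha : 0 ≤ a) (hab : a ≤ b) (hfin : klDiv (μ a) (target V) ≠ ⊤) :
    (klDiv (μ b) (target V)).toReal +
      (b - a) * (Real.exp (klDiv (μ b) (target V)).toReal - 1) ≤
      (klDiv (μ a) (target V)).toReal := by
  have hfb := ne_top_of_le_ne_top hfin (h.klDiv_anti hV hint hC ha hab)
  obtain ⟨k, hk⟩ : ∃ k, k = (klDiv (μ b) (target V)).toReal := ⟨_, rfl⟩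
  have hk0 : 0 ≤ k := hk ▸ ENNReal.toReal_nonneg
  have hk1 : 0 ≤ Real.exp k - 1 := by linarith [Real.one_le_exp hk0]
  have hlow : ENNReal.ofReal ((b - a) * (Real.exp k - 1)) ≤
      ∫⁻ s in Ioc a b, ENNReal.ofReal (‖ρ s‖ ^ 2 - 1) := by
    calc _ = ∫⁻ _ in Ioc a b, ENNReal.ofReal (Real.exp k - 1) := by
          rw [setLIntegral_const, Real.volume_Ioc, mul_comm, ENNReal.ofReal_mul hk1]
      _ ≤ _ := lintegral_mono_ae ?_
    filter_upwards [h.ae_density (b := b) ha, ae_restrict_mem measurableSet_Ioc] with s hs hmem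
    obtain ⟨q1, q2⟩ := lintegral_klFun_le_log (ρ s) hs.1 hs.2.1
    refine ENNReal.ofReal_le_ofReal ?_
    have h1 := (h.klDiv_anti hV hint hC (ha.trans hmem.1.le) hmem.2).trans (hs.2.2.le.trans q2)
    have h2 : k ≤ Real.log (‖ρ s‖ ^ 2) :=
      hk ▸ ENNReal.toReal_le_of_le_ofReal (Real.log_nonneg q1) h1
    have h3 := Real.exp_le_exp.2 h2
    rw [Real.exp_log (by linarith)] at h3
    linarith
  have hmain := (add_le_add (le_refl (klDiv (μ b) (target V))) hlow).trans
    (h.klDiv_add_lintegral_le hV hint hC ha hab)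
  have := ENNReal.toReal_mono hfin hmain
  rw [ENNReal.toReal_add hfb ENNReal.ofReal_ne_top,
    ENNReal.toReal_ofReal (mul_nonneg (by linarith) hk1), ← hk] at this
  rw [← hk]
  exact this

/-- The decay of `1 - exp (-KL)` along the flow. -/
lemma IsRegularFlow.one_sub_exp_neg_klDiv_le (hV : ContDiff ℝ 1 V)
    (hint : Integrable (fun x => Real.exp (-V x)) volume) (h : IsRegularFlow V μ ρ u v C)
    (hC : 0 ≤ C) {a b : ℝ} (ha : 0 ≤ a) (hab : a ≤ b) (hfin : klDiv (μ a) (target V) ≠ ⊤) :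
    1 - Real.exp (-(klDiv (μ b) (target V)).toReal) ≤
      Real.exp (-(b - a)) * (1 - Real.exp (-(klDiv (μ a) (target V)).toReal)) :=
  one_sub_exp_neg_le_of_forall_add_mul_le (K := fun t => (klDiv (μ t) (target V)).toReal) hab
    (fun _ _ => ENNReal.toReal_nonneg) fun _ _ hs hst _ =>
      h.toReal_klDiv_add_le hV hint hC (ha.trans hs) hst
        (ne_top_of_le_ne_top hfin (h.klDiv_anti hV hint hC ha hs))

lemma IsRegularFlow.klDiv_le_mul_exp_neg (hV : ContDiff ℝ 1 V)
    (hint : Integrable (fun x => Real.exp (-V x)) volume) (h : IsRegularFlow V μ ρ u v C)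
    (hC : 0 ≤ C) {t : ℝ} (ht : 0 < t) :
    klDiv (μ t) (target V) ≤ klDiv (μ 0) (target V) * ENNReal.ofReal (Real.exp (-t)) := by
  by_cases hfin : klDiv (μ 0) (target V) = ⊤
  · rw [hfin, ENNReal.top_mul (by simp [Real.exp_pos])]
    exact le_top
  have h1 := h.one_sub_exp_neg_klDiv_le hV hint hC le_rfl ht.le hfin
  rw [sub_zero] at h1
  obtain ⟨k, hk⟩ : ∃ k, k = (klDiv (μ 0) (target V)).toReal := ⟨_, rfl⟩
  rw [← hk] at h1
  obtain ⟨θ, hθ⟩ : ∃ θ, θ = Real.exp (-t) := ⟨_, rfl⟩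
  rw [← hθ] at h1 ⊢
  have hθ0 : 0 ≤ θ := hθ ▸ (Real.exp_pos _).le
  have hθ1 : θ ≤ 1 := hθ ▸ Real.exp_le_one_iff.2 (by linarith)
  -- Convexity between `0` and `-k` gives `exp (-θ k) ≤ 1 - θ (1 - exp (-k))`, which converts decay
  -- of `1 - exp (-k)` into decay of `k`.
  have hconv := convexOn_exp.2 (mem_univ (0 : ℝ)) (mem_univ (-k)) (sub_nonneg.2 hθ1) hθ0
    (by ring)
  simp only [smul_eq_mul, mul_zero, zero_add, Real.exp_zero, mul_one] at hconv
  have h2 : Real.exp (θ * -k) ≤ Real.exp (-(klDiv (μ t) (target V)).toReal) := by linarith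
  have h3 := Real.exp_le_exp.1 h2
  rw [← ENNReal.ofReal_toReal (h.klDiv_ne_top hV hint hC ht), ← ENNReal.ofReal_toReal hfin,
    ← ENNReal.ofReal_mul ENNReal.toReal_nonneg, ← hk]
  exact ENNReal.ofReal_le_ofReal (by linarith)

lemma IsRegularFlow.klDiv_le_two_mul_exp_neg (hV : ContDiff ℝ 1 V)
    (hint : Integrable (fun x => Real.exp (-V x)) volume) (h : IsRegularFlow V μ ρ u v C)
    (hC : 0 ≤ C) {t : ℝ} (ht : 1 ≤ t) :
    klDiv (μ t) (target V) ≤ 2 * ENNReal.ofReal (Real.exp (-t)) := by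
  have ht0 : 0 < t := by linarith
  have h1 : 1 - Real.exp (-(klDiv (μ t) (target V)).toReal) ≤ Real.exp (-t) := by
    -- The initial entropy may be infinite, so the decay starts at a time `s > 0`, with `1 - exp
    -- (-k)` bounded by `1`, and then `s` tends to `0`.
    have hlim : Tendsto (fun s => Real.exp (-(t - s))) (𝓝[>] 0) (𝓝 (Real.exp (-t))) := by
      have hc : Continuous fun s => Real.exp (-(t - s)) := by fun_prop
      have := hc.tendsto 0
      rw [sub_zero] at this
      exact this.mono_left nhdsWithin_le_nhds
    refine ge_of_tendsto hlim ?_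
    filter_upwards [Ioc_mem_nhdsGT ht0] with s hs
    refine (h.one_sub_exp_neg_klDiv_le hV hint hC hs.1.le hs.2
      (h.klDiv_ne_top hV hint hC hs.1)).trans ?_
    refine mul_le_of_le_one_right (Real.exp_pos _).le ?_
    linarith [Real.exp_pos (-(klDiv (μ s) (target V)).toReal)]
  obtain ⟨θ, hθ⟩ : ∃ θ, θ = Real.exp (-t) := ⟨_, rfl⟩
  rw [← hθ] at h1 ⊢
  have hθ0 : 0 ≤ θ := hθ ▸ (Real.exp_pos _).le
  have hθ1 : θ ≤ 1 / 2 := by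
    have he : 2 ≤ Real.exp t := by linarith [Real.add_one_le_exp t]
    rw [hθ, Real.exp_neg, inv_eq_one_div]
    exact one_div_le_one_div_of_le two_pos he
  -- This follows from `(1 - θ) (1 + 2 θ) ≥ 1`, valid exactly for `0 ≤ θ ≤ 1 / 2`; the constant `2`
  -- and the restriction `t ≥ 1` come from here.
  have h2 : Real.exp (-(2 * θ)) ≤ 1 - θ := by
    have he : 1 + 2 * θ ≤ Real.exp (2 * θ) := by linarith [Real.add_one_le_exp (2 * θ)]
    rw [Real.exp_neg, inv_le_comm₀ (Real.exp_pos _) (by linarith)]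
    refine le_trans ?_ he
    rw [inv_le_iff_one_le_mul₀ (by linarith)]
    nlinarith
  have h3 := Real.exp_le_exp.1 (h2.trans (by linarith :
    1 - θ ≤ Real.exp (-(klDiv (μ t) (target V)).toReal)))
  have h4 : ENNReal.ofReal (2 * θ) = 2 * ENNReal.ofReal θ := by
    rw [ENNReal.ofReal_mul two_pos.le, ENNReal.ofReal_ofNat]
  rw [← ENNReal.ofReal_toReal (h.klDiv_ne_top hV hint hC ht0), ← h4]
  exact ENNReal.ofReal_le_ofReal (by linarith)

end Flow

end

theorem theorem4 {d : ℕ} (V : EuclideanSpace ℝ (Fin d) → ℝ)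
    (hV : ContDiff ℝ 1 V) (hint : Integrable (fun x => Real.exp (-V x)) volume)
    (lam : ℕ → ℝ) (φ : HilbertBasis ℕ ℝ (Lp ℝ 2 (target V)))
    (hspec : HasDiscreteSpectrum V lam φ)
    (hP : ∃ C : ℝ≥0, PoincareInequality (target V) C) :
    (0 < lam 1 ∧
      ∀ f g : Lp ℝ 2 (target V), (∫ x, f x ∂(target V)) = 0 → (∫ x, g x ∂(target V)) = 0 →
        (IsSpectralKernelImage lam φ g f ↔ IsLangevin V f g)) ∧
    ∀ μ : ℝ → Measure (EuclideanSpace ℝ (Fin d)), IsLAWGDFlow V lam φ μ →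
      ∀ t : ℝ, 1 ≤ t →
        klDiv (μ t) (target V) ≤
          min (klDiv (μ 0) (target V)) 2 * ENNReal.ofReal (Real.exp (-t)) := by
  obtain ⟨C, hP⟩ := hP
  have := isProbabilityMeasure_target hint
  refine ⟨⟨hspec.pos hV hP, fun f g hf hg => hspec.isSpectralKernelImage_iff hV hP hf hg⟩,
    fun μ hμ t ht => ?_⟩
  obtain ⟨ρ, u, v, h⟩ := hμ.exists_isRegularFlow hV hint hspec hP
  have hC : (0 : ℝ) ≤ 2 + 2 * C := by positivity
  rcases min_choice (klDiv (μ 0) (target V)) 2 with e | e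
  · rw [e]
    exact h.klDiv_le_mul_exp_neg hV hint hC (by linarith)
  · rw [e]
    exact h.klDiv_le_two_mul_exp_neg hV hint hC ht
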